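/- Conventions. Let $R$ be a semilocal connected commutative ring with $2\in R^\times$ (semilocal: finitely many maximal ideals). An Azumaya algebra with involution over $R$ is a pair $(A,\sigma)$, where $A$ is an $R$-algebra that is projective as an $R$-module and separable over $R$, $\sigma$ is an $R$-linear involution, and $R\to A$ identifies $R$ with the set of $\sigma$-symmetric elements of the centre $Z(A)$. Two algebras $A,B$ over a commutative ring $S$ are Brauer equivalent over $S$ if $A\otimes_S\mathrm{End}_S(U)\cong B\otimes_S\mathrm{End}_S(V)$ for some faithful finitely generated projective $S$-modules $U,V$. For $\varepsilon\in Z(A)$ with $\sigma(\varepsilon)\varepsilon=1$, $\mathrm{Herm}^\varepsilon(A,\sigma)$ is the category of $\varepsilon$-hermitian forms $(M,h)$ on finitely generated projective right $A$-modules ($h(xa,yb)=\sigma(a)h(x,y)b$, $h(x,y)=\varepsilon\sigma(h(y,x))$), with isometries as morphisms; a form is nonsingular if $x\mapsto h(x,\cdot)$ is a bijection $M\to\mathrm{Hom}_A(M,A)$, and hyperbolic if it is nonsingular and $M$ is the direct sum of two totally isotropic submodules. Let $(A,\sigma)$ and $(B,\tau)$ be Azumaya algebras with involution over $R$ with common centre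 $S=Z(A)=Z(B)$. Assume that $S$ is connected, that $\sigma|_S=\tau|_S$, and that $A$ and $B$ are Brauer equivalent over $S$. Let $\varepsilon\in S$ with $\sigma(\varepsilon)\varepsilon=1$. For $\delta\in\{-1,1\}$, a $\delta$-hermitian form $(P,\vartheta)$ over $(B,\tau)$ admits $(A,\sigma)$ if $P$ is an $A$-$B$-bimodule on which the left and right actions of $S$ (hence of $R$) coincide and $\vartheta(\sigma(a)p,q)=\vartheta(p,aq)$ for all $a\in A$, $p,q\in P$. Such a form defines a functor $$\mathscr F_\vartheta:\mathrm{Herm}^\varepsilon(A,\sigma)\to\mathrm{Herm}^{\delta\varepsilon}(B,\tau),\quad (M,h)\mapsto(M\otimes_A P,\vartheta\bullet h),\quad f\mapsto f\otimes\mathrm{id}_P,$$ where $(\vartheta\bullet h)(m\otimes p,m'\otimes p')=\vartheta(p,h(m,m')p')$. It is called a hermitian Morita equivalence if it is an equivalence of categories that preserves orthogonal sums, maps nonsingular forms to nonsingular forms, and hyperbolic forms to hyperbolic forms. Let $R\to T$ be a homomorphism of commutative rings such that $T$ is semilocal connected and $S_1:=S\otimes_R T$ is connected. Let $\mathscr U_{(A,\sigma,T)}:\mathrm{Herm}^\varepsilon(A,\sigma)\to\mathrm{Herm}^{\varepsilon\otimes1}(A\otimes_R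 T,\sigma\otimes\mathrm{id})$ be the scalar extension functor $(M,h)\mapsto(M\otimes_R T,h_T)$, $f\mapsto f\otimes\mathrm{id}_T$, with $h_T(m\otimes t,m'\otimes t')=h(m,m')\otimes tt'$; likewise $\mathscr U_{(B,\tau,T)}$ on $\mathrm{Herm}^{\delta\varepsilon}(B,\tau)$. Theorem. (1) $A\otimes_R T$ and $B\otimes_R T$ are Brauer equivalent over $S_1$. (2) There are $\delta\in\{-1,1\}$ and a nonsingular $\delta$-hermitian form $(P,\vartheta)$ over $(B,\tau)$ which admits $(A,\sigma)$ such that $\mathscr F_\vartheta$ is a hermitian Morita equivalence. (3) Let $\delta\in\{-1,1\}$ and let $(P,\vartheta)$ be any nonsingular $\delta$-hermitian form over $(B,\tau)$ which admits $(A,\sigma)$. Then $\vartheta_T$ is nonsingular; if $\mathscr F_\vartheta$ is a hermitian Morita equivalence, then so is $\mathscr F_{\vartheta_T}:\mathrm{Herm}^{\varepsilon\otimes1}(A\otimes_R T,\sigma\otimes\mathrm{id})\to\mathrm{Herm}^{\delta\varepsilon\otimes1}(B\otimes_R T,\tau\otimes\mathrm{id})$; and the functors $\mathscr F_{\vartheta_T}\circ\mathscr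 U_{(A,\sigma,T)}$ and $\mathscr U_{(B,\tau,T)}\circ\mathscr F_\vartheta$ are naturally isomorphic. -/

import Mathlib

open CategoryTheory TensorProduct MulOpposite

universe u

set_option linter.unusedSectionVars false
set_option linter.style.haveILetI false

/-! ### Algebras with involution -/

section Algebras

/-- An `R`-linear involution of an `R`-algebra `A`. -/
structure AlgInvolution (R A : Type u) [CommRing R] [Ring A] [Algebra R A] where
  toLin : A →ₗ[R] A
  map_mul' : ∀ x y, toLin (x * y) = toLin y * toLin x
  invol' : ∀ x, toLin (toLin x) = x

instance (R A : Type u) [CommRing R] [Ring A] [Algebra R A] :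
    CoeFun (AlgInvolution R A) (fun _ => A → A) := ⟨fun σ => σ.toLin⟩

/-- `A` is separable over `R`: it is projective as a left module over `A ⊗ Aᵐᵒᵖ`, the action being
`(a ⊗ op b) • x = a * x * b`. -/
def IsSeparableAlgebra (R A : Type u) [CommRing R] [Ring A] [Algebra R A] : Prop :=
  letI : Module (A ⊗[R] Aᵐᵒᵖ) A := instModuleTensorProductMop R A
  Module.Projective (A ⊗[R] Aᵐᵒᵖ) A

/-- `(A, σ)` is an Azumaya algebra with involution over `R`: `A` is separable and projective over
`R`, and `R → A` identifies `R` with the `σ`-symmetric elements of the centre of `A`. -/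
structure IsAzumayaWithInvolution {R A : Type u} [CommRing R] [Ring A] [Algebra R A]
    (σ : AlgInvolution R A) : Prop where
  projective : Module.Projective R A
  separable : IsSeparableAlgebra R A
  injective : Function.Injective (algebraMap R A)
  range_eq : Set.range (algebraMap R A) = {a | a ∈ Subring.center A ∧ σ a = a}

/-- The structure map `S → A` identifies `S` with the centre of `A`. -/
structure IsCentre (S A : Type u) [CommRing S] [Ring A] [Algebra S A] : Prop where
  injective : Function.Injective (algebraMap S A)
  range_eq : (algebraMap S A).range = Subring.center A

/-- Brauer equivalence of `S`-algebras: `A ⊗ End_S(P) ≅ B ⊗ End_S(Q)` as `S`-algebras, for some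
faithful finitely generated projective `S`-modules `P` and `Q`. -/
def BrauerEquivalent (S A B : Type u) [CommRing S] [Ring A] [Algebra S A] [Ring B] [Algebra S B] :
    Prop :=
  ∃ (P Q : Type u) (_ : AddCommGroup P) (_ : Module S P) (_ : AddCommGroup Q) (_ : Module S Q),
    (FaithfulSMul S P ∧ Module.Finite S P ∧ Module.Projective S P) ∧
    (FaithfulSMul S Q ∧ Module.Finite S Q ∧ Module.Projective S Q) ∧
    Nonempty (A ⊗[S] Module.End S P ≃ₐ[S] B ⊗[S] Module.End S Q)

variable (R S A : Type u) [CommRing R] [CommRing S] [Algebra R S] [Ring A] [Algebra R A]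
  [Algebra S A] [IsScalarTower R S A] (T : Type u) [CommRing T] [Algebra R T]

/-- The map `T ⊗ S → T ⊗ A` induced by the structure map `S → A`. -/
def scalarExtMap : T ⊗[R] S →ₐ[T] T ⊗[R] A :=
  Algebra.TensorProduct.map (AlgHom.id T T) (IsScalarTower.toAlgHom R S A)

/-- For an `S`-algebra `A`, the scalar extension `T ⊗[R] A` is an algebra over `T ⊗[R] S`. -/
instance scalarExtAlgebra : Algebra (T ⊗[R] S) (T ⊗[R] A) :=
  (scalarExtMap R S A T).toRingHom.toAlgebra' (by
    intro c x
    change scalarExtMap R S A T c * x = x * scalarExtMap R S A T c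
    induction c using TensorProduct.induction_on with
    | zero => simp
    | add c d hc hd => rw [map_add, add_mul, mul_add, hc, hd]
    | tmul t s =>
      induction x using TensorProduct.induction_on with
      | zero => simp
      | add x y hx hy => rw [mul_add, add_mul, hx, hy]
      | tmul t' a =>
        simp [scalarExtMap, Algebra.TensorProduct.tmul_mul_tmul, mul_comm t t',
          Algebra.commutes s a])

theorem algebraMap_scalarExt (t : T) (s : S) :
    algebraMap (T ⊗[R] S) (T ⊗[R] A) (t ⊗ₜ s) = t ⊗ₜ algebraMap S A s := rfl

instance : IsScalarTower T (T ⊗[R] S) (T ⊗[R] A) :=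
  IsScalarTower.of_algebraMap_eq fun t => by
    simp [Algebra.TensorProduct.algebraMap_apply, algebraMap_scalarExt]

variable {R A}

/-- The involution `id ⊗ σ` on `T ⊗[R] A`. -/
def AlgInvolution.scalarExt (σ : AlgInvolution R A) : AlgInvolution T (T ⊗[R] A) where
  toLin := σ.toLin.baseChange T
  map_mul' x y := by
    induction x using TensorProduct.induction_on with
    | zero => simp
    | add c d hc hd => rw [map_add, add_mul, mul_add, map_add, hc, hd]
    | tmul t s =>
      induction y using TensorProduct.induction_on with
      | zero => simp
      | add x y hx hy => rw [mul_add, map_add, map_add, add_mul, hx, hy]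
      | tmul t' a => simp [Algebra.TensorProduct.tmul_mul_tmul, mul_comm t t', σ.map_mul']
  invol' x := by
    induction x using TensorProduct.induction_on with
    | zero => simp
    | add c d hc hd => rw [map_add, map_add, hc, hd]
    | tmul t s => simp [σ.invol']

end Algebras

/-! ### Finitely generated projective modules through dual bases -/

section DualBasis

theorem exists_dualBasis (E M : Type u) [Ring E] [AddCommGroup M] [Module E M]
    [Module.Finite E M] [Module.Projective E M] :
    ∃ (n : ℕ) (e : Fin n → M) (f : Fin n → M →ₗ[E] E), ∀ m, ∑ k, f k m • e k = m := by
  obtain ⟨n, s, i, -, -, h⟩ := Module.Finite.exists_comp_eq_id_of_projective E M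
  refine ⟨n, fun k => s (Pi.single k 1), fun k => LinearMap.proj k ∘ₗ i, fun m => ?_⟩
  have h' : s (i m) = m := LinearMap.congr_fun h m
  conv_rhs => rw [← h', pi_eq_sum_univ' (i m), map_sum]
  refine Finset.sum_congr rfl fun k _ => ?_
  rw [← map_smul]
  congr 1

theorem finite_projective_of_dualBasis {E M ι : Type*} [Ring E] [AddCommGroup M] [Module E M]
    [Fintype ι] (e : ι → M) (f : ι → M →ₗ[E] E) (h : ∀ m, ∑ k, f k m • e k = m) :
    Module.Finite E M ∧ Module.Projective E M := by
  classical
  have hs : (Fintype.linearCombination E e) ∘ₗ (LinearMap.pi f) = LinearMap.id := by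
    ext m
    simp [Fintype.linearCombination_apply, h]
  exact ⟨Module.Finite.of_surjective _
    (LinearMap.surjective_of_comp_eq_id (LinearMap.pi f) (Fintype.linearCombination E e) hs),
    Module.Projective.of_split (LinearMap.pi f) (Fintype.linearCombination E e) hs⟩

end DualBasis

/-! ### Hermitian forms -/

section Herm

variable {R A : Type u} [CommRing R] [Ring A] [Algebra R A]

/-- An `ε`-hermitian form `(M, h)` over `(A, σ)`: a finitely generated projective right `A`-module
`M` with a biadditive `h : M × M → A` such that `h (x a) (y b) = σ a * h x y * b` and
`h x y = ε * σ (h y x)`. Right `A`-modules are modules over `Aᵐᵒᵖ`; the `R`-module structure is the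
one induced by `R → A`. -/
structure HermForm (σ : AlgInvolution R A) (ε : A) : Type (u + 1) where
  carrier : Type u
  [instAddCommGroup : AddCommGroup carrier]
  [instModuleBase : Module R carrier]
  [instModule : Module Aᵐᵒᵖ carrier]
  [instTower : IsScalarTower R Aᵐᵒᵖ carrier]
  [instFinite : Module.Finite Aᵐᵒᵖ carrier]
  [instProjective : Module.Projective Aᵐᵒᵖ carrier]
  form : carrier →ₗ[R] carrier →ₗ[R] A
  smul_left : ∀ (a : A) (x y : carrier), form (op a • x) y = σ a * form x y
  smul_right : ∀ (a : A) (x y : carrier), form x (op a • y) = form x y * a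
  herm : ∀ x y : carrier, form x y = ε * σ (form y x)

attribute [instance] HermForm.instAddCommGroup HermForm.instModuleBase HermForm.instModule
  HermForm.instTower HermForm.instFinite HermForm.instProjective

namespace HermForm

variable {σ : AlgInvolution R A} {ε : A}

/-- Isometries of hermitian forms. -/
@[ext]
structure Isometry (X Y : HermForm σ ε) : Type u where
  toEquiv : X.carrier ≃ₗ[Aᵐᵒᵖ] Y.carrier
  form_map : ∀ x y, Y.form (toEquiv x) (toEquiv y) = X.form x y

/-- The category `Herm^ε(A, σ)`, whose morphisms are the isometries. -/
instance : Category (HermForm σ ε) where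
  Hom X Y := Isometry X Y
  id X := ⟨LinearEquiv.refl _ _, fun _ _ => rfl⟩
  comp f g := ⟨f.toEquiv.trans g.toEquiv, fun x y => by simp [g.form_map, f.form_map]⟩

/-- The form is nonsingular: its adjoint map `M → Hom_A(M, A)`, `x ↦ h x _`, is bijective. -/
def Nonsingular (X : HermForm σ ε) : Prop :=
  Function.Bijective (fun x : X.carrier =>
    ({ toFun := fun y => X.form x y
       map_add' := fun y z => map_add _ y z
       map_smul' := fun a y => X.smul_right (unop a) x y } : X.carrier →ₗ[Aᵐᵒᵖ] A))

/-- The form is hyperbolic: it is nonsingular and its module is the direct sum of two totally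
isotropic submodules. -/
def Hyperbolic (X : HermForm σ ε) : Prop :=
  X.Nonsingular ∧ ∃ L L' : Submodule Aᵐᵒᵖ X.carrier, IsCompl L L' ∧
    (∀ x ∈ L, ∀ y ∈ L, X.form x y = 0) ∧ (∀ x ∈ L', ∀ y ∈ L', X.form x y = 0)

/-- The orthogonal sum of two forms. -/
def orthSum (X Y : HermForm σ ε) : HermForm σ ε where
  carrier := X.carrier × Y.carrier
  form := X.form.compl₁₂ (LinearMap.fst R _ _) (LinearMap.fst R _ _) +
    Y.form.compl₁₂ (LinearMap.snd R _ _) (LinearMap.snd R _ _)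
  smul_left a x y := by simp [X.smul_left, Y.smul_left, mul_add]
  smul_right a x y := by simp [X.smul_right, Y.smul_right, add_mul]
  herm x y := by
    simp only [LinearMap.add_apply, LinearMap.compl₁₂_apply, map_add, mul_add]
    rw [X.herm, Y.herm]

end HermForm

variable {B : Type u} [Ring B] [Algebra R B]

/-- A functor between categories of hermitian forms is a hermitian Morita equivalence: it is an
equivalence of categories, it preserves orthogonal sums, and it maps nonsingular forms to
nonsingular forms and hyperbolic forms to hyperbolic forms. -/
structure IsHermitianMorita {σ : AlgInvolution R A} {τ : AlgInvolution R B} {ε : A} {η : B}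
    (F : HermForm σ ε ⥤ HermForm τ η) : Prop where
  isEquivalence : F.IsEquivalence
  orthSum : ∀ X Y, Nonempty (F.obj (X.orthSum Y) ≅ (F.obj X).orthSum (F.obj Y))
  nonsingular : ∀ X, X.Nonsingular → (F.obj X).Nonsingular
  hyperbolic : ∀ X, X.Hyperbolic → (F.obj X).Hyperbolic

variable (S : Type u) [CommRing S] [Algebra S A] [Algebra S B]

/-- A `δ`-hermitian form `(P, ϑ)` over `(B, τ)` which admits `(A, σ)`: `P` is an `A`-`B`-bimodule
on which the left and right actions of `R` coincide, as do those of `S`, and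
`ϑ (σ a • p) q = ϑ p (a • q)`. -/
structure AdmittingForm (σ : AlgInvolution R A) (τ : AlgInvolution R B) (δ : B) : Type (u + 1)
    extends HermForm τ δ where
  [instLeft : Module A carrier]
  [instLeftTower : IsScalarTower R A carrier]
  [instComm : SMulCommClass A Bᵐᵒᵖ carrier]
  central : ∀ (s : S) (p : carrier), algebraMap S A s • p = op (algebraMap S B s) • p
  admits : ∀ (a : A) (p q : carrier), form (σ a • p) q = form p (a • q)

attribute [instance] AdmittingForm.instLeft AdmittingForm.instLeftTower AdmittingForm.instComm

end Herm

/-! ### The tensor product over a noncommutative algebra, and the functor `F_ϑ` -/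

section BalancedTensor

variable (R A : Type u) [CommRing R] [Ring A] [Algebra R A]
  (M : Type u) [AddCommGroup M] [Module R M] [Module Aᵐᵒᵖ M] [IsScalarTower R Aᵐᵒᵖ M]
  (P : Type u) [AddCommGroup P] [Module R P] [Module A P] [IsScalarTower R A P]

/-- The relations `m a ⊗ p - m ⊗ a p` in `M ⊗[R] P`. -/
def balancedRel : Submodule R (M ⊗[R] P) :=
  Submodule.span R {t | ∃ (m : M) (a : A) (p : P), t = (op a • m) ⊗ₜ[R] p - m ⊗ₜ[R] (a • p)}

/-- The tensor product `M ⊗_A P` of a right `A`-module `M` and a left `A`-module `P` over the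
`R`-algebra `A`. -/
def BalancedTensor : Type u := (M ⊗[R] P) ⧸ balancedRel R A M P

namespace BalancedTensor

instance : AddCommGroup (BalancedTensor R A M P) :=
  inferInstanceAs (AddCommGroup ((M ⊗[R] P) ⧸ balancedRel R A M P))

instance : Module R (BalancedTensor R A M P) :=
  inferInstanceAs (Module R ((M ⊗[R] P) ⧸ balancedRel R A M P))

/-- The quotient map `M ⊗[R] P → M ⊗_A P`. -/
def proj : M ⊗[R] P →ₗ[R] BalancedTensor R A M P := (balancedRel R A M P).mkQ

variable {M P}

/-- The element `m ⊗ p` of `M ⊗_A P`. -/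
def tmul (m : M) (p : P) : BalancedTensor R A M P := proj R A M P (m ⊗ₜ p)

theorem smul_tmul (a : A) (m : M) (p : P) :
    tmul R A (op a • m) p = tmul R A m (a • p) :=
  (Submodule.Quotient.eq _).2 (Submodule.subset_span ⟨m, a, p, rfl⟩)

theorem tmul_add (m : M) (p q : P) : tmul R A m (p + q) = tmul R A m p + tmul R A m q := by
  simp [tmul, TensorProduct.tmul_add]

theorem add_tmul (m n : M) (p : P) : tmul R A (m + n) p = tmul R A m p + tmul R A n p := by
  simp [tmul, TensorProduct.add_tmul]

theorem sum_tmul {ι : Type*} (s : Finset ι) (m : ι → M) (p : P) :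
    tmul R A (∑ i ∈ s, m i) p = ∑ i ∈ s, tmul R A (m i) p := by
  simp [tmul, TensorProduct.sum_tmul]

theorem tmul_sum {ι : Type*} (s : Finset ι) (m : M) (p : ι → P) :
    tmul R A m (∑ i ∈ s, p i) = ∑ i ∈ s, tmul R A m (p i) := by
  simp [tmul, TensorProduct.tmul_sum]

variable {R A}

theorem induction_on {motive : BalancedTensor R A M P → Prop} (x : BalancedTensor R A M P)
    (zero : motive 0) (tmul : ∀ m p, motive (tmul R A m p))
    (add : ∀ x y, motive x → motive y → motive (x + y)) : motive x := by
  obtain ⟨x, rfl⟩ : ∃ y, proj R A M P y = x := Submodule.mkQ_surjective _ x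
  induction x using TensorProduct.induction_on with
  | zero => rw [map_zero]; exact zero
  | tmul m p => exact tmul m p
  | add x y hx hy => rw [map_add]; exact add _ _ hx hy

/-- An `R`-bilinear map on `M × P` is `A`-balanced. -/
def IsBalanced {N : Type u} [AddCommGroup N] [Module R N] (f : M →ₗ[R] P →ₗ[R] N) : Prop :=
  ∀ m (a : A) p, f (op a • m) p = f m (a • p)

/-- The map out of `M ⊗_A P` induced by an `A`-balanced `R`-bilinear map. -/
def lift {N : Type u} [AddCommGroup N] [Module R N] (f : M →ₗ[R] P →ₗ[R] N)
    (hf : IsBalanced (A := A) f) : BalancedTensor R A M P →ₗ[R] N :=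
  (balancedRel R A M P).liftQ (TensorProduct.lift f) (by
    rw [balancedRel, Submodule.span_le]
    rintro _ ⟨m, a, p, rfl⟩
    simp [hf m a p])

@[simp]
theorem lift_tmul {N : Type u} [AddCommGroup N] [Module R N] (f : M →ₗ[R] P →ₗ[R] N)
    (hf : IsBalanced (A := A) f) (m : M) (p : P) :
    lift f hf (tmul R A m p) = f m p := by
  change (balancedRel R A M P).liftQ (TensorProduct.lift f) _ ((balancedRel R A M P).mkQ _) = _
  simp

theorem hom_ext {N : Type u} [AddCommGroup N] [Module R N]
    {f g : BalancedTensor R A M P →ₗ[R] N}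
    (h : ∀ m p, f (tmul R A m p) = g (tmul R A m p)) : f = g := by
  ext x
  induction x using induction_on with
  | zero => simp
  | tmul m p => exact h m p
  | add x y hx hy => rw [map_add, map_add, hx, hy]

variable (R A M P)

/-- The `R`-bilinear map `(m, p) ↦ m ⊗ p`. -/
def mk : M →ₗ[R] P →ₗ[R] BalancedTensor R A M P :=
  (TensorProduct.mk R M P).compr₂ (proj R A M P)

@[simp]
theorem mk_apply (m : M) (p : P) : mk R A M P m p = tmul R A m p := rfl

variable {M P}

section Right

variable {B : Type u} [Ring B] [Algebra R B] [Module Bᵐᵒᵖ P] [IsScalarTower R Bᵐᵒᵖ P]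
  [SMulCommClass A Bᵐᵒᵖ P]

theorem isBalanced_rightMul (b : Bᵐᵒᵖ) :
    IsBalanced (A := A) ((mk R A M P).compl₂ (Algebra.lsmul R R P b)) := fun m a p => by
  simp [smul_tmul, smul_comm]

/-- The right action of `b` on `M ⊗_A P`, `(m ⊗ p) b = m ⊗ p b`. -/
def rightMul (b : Bᵐᵒᵖ) : BalancedTensor R A M P →ₗ[R] BalancedTensor R A M P :=
  lift ((mk R A M P).compl₂ (Algebra.lsmul R R P b)) (isBalanced_rightMul R A b)

@[simp]
theorem rightMul_tmul (b : Bᵐᵒᵖ) (m : M) (p : P) :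
    rightMul R A b (tmul R A m p) = tmul R A m (b • p) := by
  simp [rightMul]

/-- The right `B`-module structure of `M ⊗_A P` for an `A`-`B`-bimodule `P`. -/
instance : Module Bᵐᵒᵖ (BalancedTensor R A M P) where
  smul b x := rightMul R A b x
  one_smul x := by
    change rightMul R A 1 x = x
    induction x using induction_on with
    | zero => simp
    | tmul m p => simp
    | add x y hx hy => rw [map_add, hx, hy]
  mul_smul b c x := by
    change rightMul R A (b * c) x = rightMul R A b (rightMul R A c x)
    induction x using induction_on with
    | zero => simp
    | tmul m p => simp [mul_smul]
    | add x y hx hy => rw [map_add, map_add, map_add, hx, hy]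
  smul_zero b := map_zero (rightMul R A b)
  smul_add b := map_add (rightMul R A b)
  zero_smul x := by
    change rightMul R A 0 x = 0
    induction x using induction_on with
    | zero => simp
    | tmul m p => rw [rightMul_tmul]; simp [tmul]
    | add x y hx hy => rw [map_add, hx, hy, add_zero]
  add_smul b c x := by
    change rightMul R A (b + c) x = rightMul R A b x + rightMul R A c x
    induction x using induction_on with
    | zero => simp
    | tmul m p => simp [add_smul, tmul_add]
    | add x y hx hy => rw [map_add, map_add, map_add, hx, hy]; abel

theorem op_smul_eq (b : Bᵐᵒᵖ) (x : BalancedTensor R A M P) : b • x = rightMul R A b x := rfl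

@[simp]
theorem op_smul_tmul (b : Bᵐᵒᵖ) (m : M) (p : P) :
    b • tmul R A m p = tmul R A m (b • p) := rightMul_tmul R A b m p

instance : IsScalarTower R Bᵐᵒᵖ (BalancedTensor R A M P) where
  smul_assoc r b x := by
    rw [op_smul_eq, op_smul_eq]
    induction x using induction_on with
    | zero => simp
    | tmul m p => rw [rightMul_tmul, rightMul_tmul]; simp [tmul]
    | add x y hx hy => rw [map_add, map_add, smul_add, hx, hy]

theorem finite_projective [Module.Finite Aᵐᵒᵖ M] [Module.Projective Aᵐᵒᵖ M]
    [Module.Finite Bᵐᵒᵖ P] [Module.Projective Bᵐᵒᵖ P] :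
    Module.Finite Bᵐᵒᵖ (BalancedTensor R A M P) ∧
      Module.Projective Bᵐᵒᵖ (BalancedTensor R A M P) := by
  obtain ⟨n, e, f, hf⟩ := exists_dualBasis Aᵐᵒᵖ M
  obtain ⟨l, q, g, hg⟩ := exists_dualBasis Bᵐᵒᵖ P
  let F₀ : Fin n × Fin l → M →ₗ[R] P →ₗ[R] Bᵐᵒᵖ := fun k =>
    LinearMap.mk₂ R (fun m p => g k.2 (unop (f k.1 m) • p))
      (fun m m' p => by simp [add_smul])
      (fun r m p => by
        rw [(f k.1).map_smul_of_tower, unop_smul, smul_assoc, (g k.2).map_smul_of_tower])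
      (fun m p p' => by simp)
      (fun r m p => by
        rw [← algebraMap_smul A r p, smul_smul, ← Algebra.commutes, mul_smul, algebraMap_smul,
          ← algebraMap_smul Bᵐᵒᵖ r, map_smul, algebraMap_smul])
  have hF₀ : ∀ k, IsBalanced (A := A) (F₀ k) := by
    intro k m a p
    simp [F₀, mul_smul]
  refine finite_projective_of_dualBasis (ι := Fin n × Fin l)
    (fun k => tmul R A (e k.1) (q k.2))
    (fun k => { lift (F₀ k) (hF₀ k) with
      map_smul' := fun b x => by
        induction x using induction_on with
        | zero => simp
        | tmul m p => simp [F₀, smul_comm]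
        | add x y hx hy =>
          simp only [smul_add, map_add, AddHom.toFun_eq_coe, LinearMap.coe_toAddHom] at *
          rw [hx, hy] }) (fun x => ?_)
  induction x using induction_on with
  | zero => simp
  | tmul m p =>
    simp only [LinearMap.coe_toAddHom, LinearMap.coe_mk, lift_tmul, F₀, LinearMap.mk₂_apply, op_smul_tmul, Fintype.sum_prod_type]
    simp only [← tmul_sum, hg, ← smul_tmul, op_unop]
    rw [← sum_tmul, hf]
  | add x y hx hy =>
    simp only [map_add, add_smul, Finset.sum_add_distrib] at *
    rw [hx, hy]

theorem isBalanced_map {M' : Type u} [AddCommGroup M'] [Module R M'] [Module Aᵐᵒᵖ M']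
    [IsScalarTower R Aᵐᵒᵖ M'] (f : M →ₗ[Aᵐᵒᵖ] M') :
    IsBalanced (A := A) ((mk R A M' P).comp (f.restrictScalars R)) := fun m a p => by
  simp [smul_tmul]

/-- `M ⊗_A P` for varying `M`: the map `f ⊗ id`. -/
def mapEquiv {M' : Type u} [AddCommGroup M'] [Module R M'] [Module Aᵐᵒᵖ M']
    [IsScalarTower R Aᵐᵒᵖ M'] (f : M ≃ₗ[Aᵐᵒᵖ] M') :
    BalancedTensor R A M P ≃ₗ[Bᵐᵒᵖ] BalancedTensor R A M' P :=
  let φ : BalancedTensor R A M P →ₗ[R] BalancedTensor R A M' P :=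
    lift ((mk R A M' P).comp (f.toLinearMap.restrictScalars R)) (isBalanced_map R A _)
  let ψ : BalancedTensor R A M' P →ₗ[R] BalancedTensor R A M P :=
    lift ((mk R A M P).comp (f.symm.toLinearMap.restrictScalars R)) (isBalanced_map R A _)
  { φ with
    map_smul' := fun b x => by
      induction x using induction_on with
      | zero => simp
      | tmul m p => simp [φ]
      | add x y hx hy =>
        simp only [smul_add, map_add, AddHom.toFun_eq_coe, LinearMap.coe_toAddHom] at *
        rw [hx, hy]
    invFun := ψ
    left_inv := fun x => by
      have h : ψ ∘ₗ φ = LinearMap.id := hom_ext fun m p => by simp [φ, ψ]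
      exact LinearMap.congr_fun h x
    right_inv := fun x => by
      have h : φ ∘ₗ ψ = LinearMap.id := hom_ext fun m p => by simp [φ, ψ]
      exact LinearMap.congr_fun h x }

@[simp]
theorem mapEquiv_tmul {M' : Type u} [AddCommGroup M'] [Module R M'] [Module Aᵐᵒᵖ M']
    [IsScalarTower R Aᵐᵒᵖ M'] (f : M ≃ₗ[Aᵐᵒᵖ] M') (m : M) (p : P) :
    mapEquiv R A (B := B) f (tmul R A m p) = tmul R A (f m) p := by
  change lift ((mk R A M' P).comp (f.toLinearMap.restrictScalars R)) (isBalanced_map R A _) _ = _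
  simp

theorem mapEquiv_refl (x : BalancedTensor R A M P) :
    mapEquiv R A (B := B) (LinearEquiv.refl Aᵐᵒᵖ M) x = x := by
  induction x using induction_on with
  | zero => simp
  | add x x' hx hx' => simp only [map_add, hx, hx']
  | tmul m p => simp

theorem mapEquiv_trans {M' M'' : Type u} [AddCommGroup M'] [Module R M'] [Module Aᵐᵒᵖ M']
    [IsScalarTower R Aᵐᵒᵖ M'] [AddCommGroup M''] [Module R M''] [Module Aᵐᵒᵖ M'']
    [IsScalarTower R Aᵐᵒᵖ M''] (f : M ≃ₗ[Aᵐᵒᵖ] M') (g : M' ≃ₗ[Aᵐᵒᵖ] M'')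
    (x : BalancedTensor R A M P) :
    mapEquiv R A (B := B) (f.trans g) x = mapEquiv R A (B := B) g (mapEquiv R A (B := B) f x) := by
  induction x using induction_on with
  | zero => simp
  | add x x' hx hx' => simp only [map_add, hx, hx']
  | tmul m p => simp

end Right

end BalancedTensor

end BalancedTensor

section MoritaFunctor

variable {R A B S : Type u} [CommRing R] [Ring A] [Algebra R A] [Ring B] [Algebra R B]
  [CommRing S] [Algebra S A] [Algebra S B]
  {σ : AlgInvolution R A} {τ : AlgInvolution R B} {δ ε η : S}

namespace AdmittingForm

section Product

variable {e : A} {d : B} (ϑ : AdmittingForm S σ τ d) (X : HermForm σ e)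

/-- The map `(m', p') ↦ ϑ p (h m m' • p')`. -/
def prodFormAux (m : X.carrier) (p : ϑ.carrier) : X.carrier →ₗ[R] ϑ.carrier →ₗ[R] B :=
  LinearMap.mk₂ R (fun m' p' => ϑ.form p (X.form m m' • p'))
    (fun m' m'' p' => by simp [add_smul])
    (fun r m' p' => by simp)
    (fun m' p' p'' => by simp)
    (fun r m' p' => by
      rw [← algebraMap_smul A r p', smul_smul, ← Algebra.commutes, mul_smul, algebraMap_smul,
        map_smul])

theorem isBalanced_prodFormAux (m : X.carrier) (p : ϑ.carrier) :
    BalancedTensor.IsBalanced (A := A) (ϑ.prodFormAux X m p) := fun m' a p' => by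
  simp [prodFormAux, X.smul_right, mul_smul]

/-- The map `(m, p) ↦ (m' ⊗ p' ↦ ϑ p (h m m' • p'))`. -/
def prodFormCurried :
    X.carrier →ₗ[R] ϑ.carrier →ₗ[R] BalancedTensor R A X.carrier ϑ.carrier →ₗ[R] B :=
  LinearMap.mk₂ R
    (fun m p => BalancedTensor.lift (ϑ.prodFormAux X m p) (ϑ.isBalanced_prodFormAux X m p))
    (fun m m' p => BalancedTensor.hom_ext fun n q => by simp [prodFormAux, add_smul])
    (fun r m p => BalancedTensor.hom_ext fun n q => by simp [prodFormAux])
    (fun m p p' => BalancedTensor.hom_ext fun n q => by simp [prodFormAux])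
    (fun r m p => BalancedTensor.hom_ext fun n q => by simp [prodFormAux])

theorem isBalanced_prodFormCurried :
    BalancedTensor.IsBalanced (A := A) (ϑ.prodFormCurried X) := fun m a p => by
  refine BalancedTensor.hom_ext fun n q => ?_
  have := ϑ.admits (σ a) p (X.form m n • q)
  rw [σ.invol'] at this
  simp [prodFormCurried, prodFormAux, X.smul_left, mul_smul, this]

/-- The product `ϑ • h` on `M ⊗_A P`, given by
`(ϑ • h) (m ⊗ p) (m' ⊗ p') = ϑ p (h m m' • p')`. -/
def prodForm :
    BalancedTensor R A X.carrier ϑ.carrier →ₗ[R]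
      BalancedTensor R A X.carrier ϑ.carrier →ₗ[R] B :=
  BalancedTensor.lift (ϑ.prodFormCurried X) (ϑ.isBalanced_prodFormCurried X)

@[simp]
theorem prodForm_tmul (m m' : X.carrier) (p p' : ϑ.carrier) :
    ϑ.prodForm X (BalancedTensor.tmul R A m p) (BalancedTensor.tmul R A m' p') =
      ϑ.form p (X.form m m' • p') := by
  simp [prodForm, prodFormCurried, prodFormAux]

theorem prodForm_mapEquiv {X Y : HermForm σ e} (f : HermForm.Isometry X Y)
    (x y : BalancedTensor R A X.carrier ϑ.carrier) :
    ϑ.prodForm Y (BalancedTensor.mapEquiv R A (B := B) f.toEquiv x)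
      (BalancedTensor.mapEquiv R A (B := B) f.toEquiv y) = ϑ.prodForm X x y := by
  induction x using BalancedTensor.induction_on with
  | zero => simp
  | add x x' hx hx' => simp only [map_add, LinearMap.add_apply, hx, hx']
  | tmul m p =>
    induction y using BalancedTensor.induction_on with
    | zero => simp
    | add y y' hy hy' => simp only [map_add, hy, hy']
    | tmul m' p' => simp [f.form_map]

end Product

/-- The form `(M ⊗_A P, ϑ • h)` over `(B, τ)`; it is `δε`-hermitian. -/
abbrev prodObj (ϑ : AdmittingForm S σ τ (algebraMap S B δ)) (hη : η = δ * ε)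
    (X : HermForm σ (algebraMap S A ε)) : HermForm τ (algebraMap S B η) where
  carrier := BalancedTensor R A X.carrier ϑ.carrier
  instFinite := (BalancedTensor.finite_projective R A).1
  instProjective := (BalancedTensor.finite_projective R A).2
  form := ϑ.prodForm X
  smul_left b x y := by
    induction x using BalancedTensor.induction_on with
    | zero => simp
    | add x x' hx hx' => simp only [smul_add, map_add, LinearMap.add_apply, mul_add, hx, hx']
    | tmul m p =>
      induction y using BalancedTensor.induction_on with
      | zero => simp
      | add y y' hy hy' => simp only [map_add, mul_add, hy, hy']
      | tmul m' p' => simp [ϑ.smul_left]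
  smul_right b x y := by
    induction x using BalancedTensor.induction_on with
    | zero => simp
    | add x x' hx hx' => simp only [map_add, LinearMap.add_apply, add_mul, hx, hx']
    | tmul m p =>
      induction y using BalancedTensor.induction_on with
      | zero => simp
      | add y y' hy hy' => simp only [smul_add, map_add, add_mul, hy, hy']
      | tmul m' p' =>
        rw [BalancedTensor.op_smul_tmul, prodForm_tmul, prodForm_tmul, smul_comm, ϑ.smul_right]
  herm x y := by
    induction x using BalancedTensor.induction_on with
    | zero => simp
    | add x x' hx hx' => simp only [map_add, LinearMap.add_apply, mul_add, hx, hx']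
    | tmul m p =>
      induction y using BalancedTensor.induction_on with
      | zero => simp
      | add y y' hy hy' => simp only [map_add, LinearMap.add_apply, mul_add, hy, hy']
      | tmul m' p' =>
        have h := ϑ.admits (σ (X.form m' m)) p p'
        rw [σ.invol'] at h
        rw [prodForm_tmul, prodForm_tmul, X.herm m m', mul_smul, ϑ.central, ϑ.smul_right, ← h,
          ϑ.herm, ← Algebra.commutes, hη, mul_comm δ ε, map_mul, mul_assoc]

/-- The functor `F_ϑ : Herm^ε(A, σ) → Herm^{δε}(B, τ)`, `(M, h) ↦ (M ⊗_A P, ϑ • h)` on objects and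
`f ↦ f ⊗ id_P` on morphisms. The sign of the target is a variable `η` with `η = δ * ε`. -/
def moritaFunctor (ϑ : AdmittingForm S σ τ (algebraMap S B δ)) (hη : η = δ * ε) :
    HermForm σ (algebraMap S A ε) ⥤ HermForm τ (algebraMap S B η) where
  obj X := ϑ.prodObj hη X
  map f :=
    { toEquiv := BalancedTensor.mapEquiv R A f.toEquiv
      form_map := ϑ.prodForm_mapEquiv f }
  map_id _ := HermForm.Isometry.ext (LinearEquiv.ext fun x => BalancedTensor.mapEquiv_refl R A x)
  map_comp f g := HermForm.Isometry.ext (LinearEquiv.ext fun x =>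
    BalancedTensor.mapEquiv_trans R A f.toEquiv g.toEquiv x)

end AdmittingForm

end MoritaFunctor

/-! ### Scalar extension of hermitian forms -/

section ScalarExt

variable {R : Type u} [CommRing R] (T : Type u) [CommRing T] [Algebra R T]

section Modules

variable (R) (A : Type u) [Ring A] [Algebra R A]

/-- For a right `A`-module `M`, the right `T ⊗[R] A`-module structure of `T ⊗[R] M`, given by
`(t' ⊗ m) (t ⊗ a) = t t' ⊗ m a`. -/
abbrev scalarExtRight (M : Type u) [AddCommGroup M] [Module R M] [Module Aᵐᵒᵖ M]
    [IsScalarTower R Aᵐᵒᵖ M] : Module (T ⊗[R] A)ᵐᵒᵖ (T ⊗[R] M) :=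
  let act : T ⊗[R] A →ₗ[R] T ⊗[R] M →ₗ[R] T ⊗[R] M :=
    TensorProduct.map₂ (LinearMap.mul R T) (LinearMap.mk₂ R (fun (a : A) (m : M) => op a • m)
      (fun a b m => by simp [add_smul]) (fun r a m => by simp) (fun a m n => by simp)
      (fun r a m => smul_algebra_smul_comm r (op a) m))
  { smul := fun x y => act (unop x) y
    one_smul := fun y => by
      change act 1 y = y
      induction y using TensorProduct.induction_on with
      | zero => simp
      | add y z hy hz => rw [map_add, hy, hz]
      | tmul t m => simp [act, Algebra.TensorProduct.one_def]
    mul_smul := fun x x' y => by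
      change act (unop x' * unop x) y = act (unop x) (act (unop x') y)
      induction y using TensorProduct.induction_on with
      | zero => simp
      | add y z hy hz => rw [map_add, map_add, map_add, hy, hz]
      | tmul t m =>
        generalize unop x = x, unop x' = x'
        induction x using TensorProduct.induction_on with
        | zero => simp
        | add x z hx hz => rw [mul_add, map_add, map_add, LinearMap.add_apply, hx, hz]; rfl
        | tmul u a =>
          induction x' using TensorProduct.induction_on with
          | zero => simp
          | add x z hx hz =>
            rw [add_mul, map_add, map_add, LinearMap.add_apply, hx, hz, LinearMap.add_apply, map_add]
          | tmul u' a' =>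
            simp [act, Algebra.TensorProduct.tmul_mul_tmul, mul_smul, mul_left_comm, mul_assoc]
    smul_zero := fun x => map_zero (act (unop x))
    smul_add := fun x => map_add (act (unop x))
    zero_smul := fun y => by change act 0 y = 0; simp
    add_smul := fun x x' y => by
      change act (unop x + unop x') y = act (unop x) y + act (unop x') y
      simp }

theorem scalarExtRight_smul_tmul (M : Type u) [AddCommGroup M] [Module R M] [Module Aᵐᵒᵖ M]
    [IsScalarTower R Aᵐᵒᵖ M] (t t' : T) (a : A) (m : M) :
    letI := scalarExtRight R T A M
    op (t ⊗ₜ[R] a) • (t' ⊗ₜ[R] m) = (t * t') ⊗ₜ[R] (op a • m) := rfl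

theorem scalarExtRight_tower (M : Type u) [AddCommGroup M] [Module R M] [Module Aᵐᵒᵖ M]
    [IsScalarTower R Aᵐᵒᵖ M] :
    letI := scalarExtRight R T A M
    IsScalarTower T (T ⊗[R] A)ᵐᵒᵖ (T ⊗[R] M) := by
  letI := scalarExtRight R T A M
  refine ⟨fun t x y => ?_⟩
  induction x using MulOpposite.rec' with | _ x
  rw [← op_smul]
  induction y using TensorProduct.induction_on with
  | zero => simp
  | add y z hy hz => rw [smul_add, smul_add, smul_add, hy, hz]
  | tmul t' m =>
    induction x using TensorProduct.induction_on with
    | zero => simp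
    | add x z hx hz => rw [smul_add, MulOpposite.op_add, add_smul, MulOpposite.op_add, add_smul, smul_add, hx, hz]
    | tmul u a =>
      rw [smul_tmul', scalarExtRight_smul_tmul, scalarExtRight_smul_tmul, smul_tmul', smul_eq_mul,
        smul_eq_mul, mul_assoc]

theorem scalarExtRight_finite_projective (M : Type u) [AddCommGroup M] [Module R M] [Module Aᵐᵒᵖ M]
    [IsScalarTower R Aᵐᵒᵖ M] [Module.Finite Aᵐᵒᵖ M] [Module.Projective Aᵐᵒᵖ M] :
    letI := scalarExtRight R T A M
    Module.Finite (T ⊗[R] A)ᵐᵒᵖ (T ⊗[R] M) ∧ Module.Projective (T ⊗[R] A)ᵐᵒᵖ (T ⊗[R] M) := by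
  letI := scalarExtRight R T A M
  obtain ⟨n, e, f, hf⟩ := exists_dualBasis Aᵐᵒᵖ M
  let g : Fin n → T ⊗[R] M →ₗ[R] T ⊗[R] A := fun k =>
    LinearMap.lTensor T ((opLinearEquiv R).symm.toLinearMap ∘ₗ (f k).restrictScalars R)
  have hg : ∀ k t m, g k (t ⊗ₜ m) = t ⊗ₜ unop (f k m) := fun k t m => rfl
  refine finite_projective_of_dualBasis (ι := Fin n) (fun k => (1 : T) ⊗ₜ[R] e k)
    (fun k =>
      { toFun := fun y => op (g k y)
        map_add' := fun y z => by simp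
        map_smul' := fun x y => by
          induction x using MulOpposite.rec' with | _ x
          rw [RingHom.id_apply, smul_eq_mul, ← op_mul]
          congr 1
          induction y using TensorProduct.induction_on with
          | zero => simp
          | add y z hy hz => rw [smul_add, map_add, map_add, add_mul, hy, hz]
          | tmul t' m =>
            induction x using TensorProduct.induction_on with
            | zero => simp
            | add x z hx hz => rw [MulOpposite.op_add, add_smul, map_add, mul_add, hx, hz]
            | tmul u a =>
              rw [scalarExtRight_smul_tmul, hg, hg, Algebra.TensorProduct.tmul_mul_tmul, mul_comm u,
                map_smul, smul_eq_mul, unop_mul, unop_op] }) (fun y => ?_)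
  induction y using TensorProduct.induction_on with
  | zero => simp
  | add y z hy hz =>
    simp only [map_add, add_smul, Finset.sum_add_distrib] at *
    rw [hy, hz]
  | tmul t m =>
    simp only [LinearMap.coe_mk, AddHom.coe_mk, hg, scalarExtRight_smul_tmul, mul_one, op_unop]
    rw [← TensorProduct.tmul_sum, hf]

/-- For a left `A`-module `P`, the left `T ⊗[R] A`-module structure of `T ⊗[R] P`, given by
`(t ⊗ a) (t' ⊗ p) = t t' ⊗ a p`. -/
abbrev scalarExtLeft (P : Type u) [AddCommGroup P] [Module R P] [Module A P]
    [IsScalarTower R A P] : Module (T ⊗[R] A) (T ⊗[R] P) :=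
  let act : T ⊗[R] A →ₗ[R] T ⊗[R] P →ₗ[R] T ⊗[R] P :=
    TensorProduct.map₂ (LinearMap.mul R T) (LinearMap.mk₂ R (fun (a : A) (p : P) => a • p)
      (fun a b m => by simp [add_smul]) (fun r a m => by simp) (fun a m n => by simp)
      (fun r a m => smul_algebra_smul_comm r a m))
  { smul := fun x y => act x y
    one_smul := fun y => by
      change act 1 y = y
      induction y using TensorProduct.induction_on with
      | zero => simp
      | add y z hy hz => rw [map_add, hy, hz]
      | tmul t m => simp [act, Algebra.TensorProduct.one_def]
    mul_smul := fun x x' y => by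
      change act (x * x') y = act x (act x' y)
      induction y using TensorProduct.induction_on with
      | zero => simp
      | add y z hy hz => rw [map_add, map_add, map_add, hy, hz]
      | tmul t m =>
        induction x using TensorProduct.induction_on with
        | zero => simp
        | add x z hx hz => rw [add_mul, map_add, map_add, LinearMap.add_apply, hx, hz]; rfl
        | tmul u a =>
          induction x' using TensorProduct.induction_on with
          | zero => simp
          | add x z hx hz =>
            rw [mul_add, map_add, map_add, LinearMap.add_apply, hx, hz, LinearMap.add_apply, map_add]
          | tmul u' a' =>
            simp [act, Algebra.TensorProduct.tmul_mul_tmul, mul_smul, mul_assoc]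
    smul_zero := fun x => map_zero (act x)
    smul_add := fun x => map_add (act x)
    zero_smul := fun y => by change act 0 y = 0; simp
    add_smul := fun x x' y => by
      change act (x + x') y = act x y + act x' y
      simp }

theorem scalarExtLeft_smul_tmul (P : Type u) [AddCommGroup P] [Module R P] [Module A P]
    [IsScalarTower R A P] (t t' : T) (a : A) (p : P) :
    letI := scalarExtLeft R T A P
    (t ⊗ₜ[R] a) • (t' ⊗ₜ[R] p) = (t * t') ⊗ₜ[R] (a • p) := rfl

theorem scalarExtLeft_tower (P : Type u) [AddCommGroup P] [Module R P] [Module A P]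
    [IsScalarTower R A P] :
    letI := scalarExtLeft R T A P
    IsScalarTower T (T ⊗[R] A) (T ⊗[R] P) := by
  letI := scalarExtLeft R T A P
  refine ⟨fun t x y => ?_⟩
  induction y using TensorProduct.induction_on with
  | zero => simp
  | add y z hy hz => rw [smul_add, smul_add, smul_add, hy, hz]
  | tmul t' m =>
    induction x using TensorProduct.induction_on with
    | zero => simp
    | add x z hx hz => rw [smul_add, add_smul, add_smul, smul_add, hx, hz]
    | tmul u a =>
      rw [smul_tmul', scalarExtLeft_smul_tmul, scalarExtLeft_smul_tmul, smul_tmul', smul_eq_mul,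
        smul_eq_mul, mul_assoc]

theorem scalarExt_smulComm (B : Type u) [Ring B] [Algebra R B] (P : Type u) [AddCommGroup P]
    [Module R P] [Module A P] [IsScalarTower R A P] [Module Bᵐᵒᵖ P] [IsScalarTower R Bᵐᵒᵖ P]
    [SMulCommClass A Bᵐᵒᵖ P] :
    letI := scalarExtLeft R T A P
    letI := scalarExtRight R T B P
    SMulCommClass (T ⊗[R] A) (T ⊗[R] B)ᵐᵒᵖ (T ⊗[R] P) := by
  letI := scalarExtLeft R T A P
  letI := scalarExtRight R T B P
  refine ⟨fun x z y => ?_⟩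
  induction z using MulOpposite.rec' with | _ z
  induction y using TensorProduct.induction_on with
  | zero => simp
  | add y y' hy hy' => rw [smul_add, smul_add, smul_add, smul_add, hy, hy']
  | tmul t p =>
    induction x using TensorProduct.induction_on with
    | zero => simp
    | add x x' hx hx' => rw [add_smul, add_smul, smul_add, hx, hx']
    | tmul u a =>
      induction z using TensorProduct.induction_on with
      | zero => simp
      | add z z' hz hz' => rw [MulOpposite.op_add, add_smul, add_smul, smul_add, hz, hz']
      | tmul v b =>
        rw [scalarExtLeft_smul_tmul, scalarExtRight_smul_tmul, scalarExtRight_smul_tmul,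
          scalarExtLeft_smul_tmul, smul_comm, mul_left_comm]

end Modules

variable {A : Type u} [Ring A] [Algebra R A] {σ : AlgInvolution R A}

/-- The scalar extension `(T ⊗ M, h_T)` of an `ε`-hermitian form, with
`h_T (t ⊗ m) (t' ⊗ m') = t t' ⊗ h m m'`; it is `1 ⊗ ε`-hermitian over `(T ⊗ A, id ⊗ σ)`. -/
abbrev HermForm.scalarExt {ε : A} (X : HermForm σ ε) :
    HermForm (σ.scalarExt T) ((1 : T) ⊗ₜ[R] ε) :=
  letI := scalarExtRight R T A X.carrier
  { carrier := T ⊗[R] X.carrier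
    instTower := scalarExtRight_tower R T A X.carrier
    instFinite := (scalarExtRight_finite_projective R T A X.carrier).1
    instProjective := (scalarExtRight_finite_projective R T A X.carrier).2
    form := LinearMap.BilinMap.baseChange T X.form
    smul_left := fun a x y => by
      induction x using TensorProduct.induction_on with
      | zero => simp
      | add x x' hx hx' => simp only [smul_add, map_add, LinearMap.add_apply, mul_add, hx, hx']
      | tmul t m =>
        induction y using TensorProduct.induction_on with
        | zero => simp
        | add y y' hy hy' => simp only [map_add, mul_add, hy, hy']
        | tmul t' m' =>
          induction a using TensorProduct.induction_on with
          | zero => simp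
          | add a a' ha ha' =>
            simp only [MulOpposite.op_add, add_smul, map_add, LinearMap.add_apply, add_mul, ha, ha']
          | tmul u a =>
            rw [scalarExtRight_smul_tmul]
            simp [AlgInvolution.scalarExt, X.smul_left, mul_left_comm, mul_comm]
    smul_right := fun a x y => by
      induction x using TensorProduct.induction_on with
      | zero => simp
      | add x x' hx hx' => simp only [map_add, LinearMap.add_apply, add_mul, hx, hx']
      | tmul t m =>
        induction y using TensorProduct.induction_on with
        | zero => simp
        | add y y' hy hy' => simp only [smul_add, map_add, add_mul, hy, hy']
        | tmul t' m' =>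
          induction a using TensorProduct.induction_on with
          | zero => simp
          | add a a' ha ha' =>
            simp only [MulOpposite.op_add, add_smul, map_add, mul_add, ha, ha']
          | tmul u a =>
            rw [scalarExtRight_smul_tmul]
            simp [X.smul_right, mul_left_comm, mul_comm]
    herm := fun x y => by
      induction x using TensorProduct.induction_on with
      | zero => simp
      | add x x' hx hx' => simp only [map_add, LinearMap.add_apply, mul_add, hx, hx']
      | tmul t m =>
        induction y using TensorProduct.induction_on with
        | zero => simp
        | add y y' hy hy' => simp only [map_add, LinearMap.add_apply, mul_add, hy, hy']
        | tmul t' m' =>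
          have := X.herm m m'
          simp [AlgInvolution.scalarExt, ← this, mul_comm] }

theorem HermForm.scalarExt_form_tmul {ε : A} (X : HermForm σ ε) (t t' : T) (m m' : X.carrier) :
    (X.scalarExt T).form (t ⊗ₜ[R] m) (t' ⊗ₜ[R] m') = (t * t') ⊗ₜ[R] X.form m m' := by
  change LinearMap.BilinMap.baseChange T X.form (t ⊗ₜ[R] m) (t' ⊗ₜ[R] m') = _
  simp

section MapEquiv

variable {M M' : Type u} [AddCommGroup M] [Module R M] [Module Aᵐᵒᵖ M] [IsScalarTower R Aᵐᵒᵖ M]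
  [AddCommGroup M'] [Module R M'] [Module Aᵐᵒᵖ M'] [IsScalarTower R Aᵐᵒᵖ M']

/-- The map `id_T ⊗ f` induced by an isomorphism `f` of right `A`-modules. -/
def scalarExtMapEquiv (f : M ≃ₗ[Aᵐᵒᵖ] M') :
    letI := scalarExtRight R T A M
    letI := scalarExtRight R T A M'
    T ⊗[R] M ≃ₗ[(T ⊗[R] A)ᵐᵒᵖ] T ⊗[R] M' :=
  letI := scalarExtRight R T A M
  letI := scalarExtRight R T A M'
  { LinearEquiv.lTensor T (f.restrictScalars R) with
    map_smul' := fun x y => by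
      induction x using MulOpposite.rec' with | _ x
      change LinearEquiv.lTensor T (f.restrictScalars R) (op x • y) =
        op x • LinearEquiv.lTensor T (f.restrictScalars R) y
      induction y using TensorProduct.induction_on with
      | zero => simp
      | add y z hy hz => rw [smul_add, map_add, map_add, smul_add, hy, hz]
      | tmul t m =>
        induction x using TensorProduct.induction_on with
        | zero => simp
        | add x z hx hz => rw [MulOpposite.op_add, add_smul, add_smul, map_add, hx, hz]
        | tmul u a =>
          rw [scalarExtRight_smul_tmul]
          simp only [LinearEquiv.lTensor_tmul, LinearEquiv.restrictScalars_apply, map_smul]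
          rw [scalarExtRight_smul_tmul] }

end MapEquiv

theorem scalarExt_form_map {ε : A} {X Y : HermForm σ ε} (f : HermForm.Isometry X Y)
    (x y : T ⊗[R] X.carrier) :
    LinearMap.BilinMap.baseChange T Y.form
        (LinearEquiv.lTensor T (f.toEquiv.restrictScalars R) x)
        (LinearEquiv.lTensor T (f.toEquiv.restrictScalars R) y) =
      LinearMap.BilinMap.baseChange T X.form x y := by
  induction x using TensorProduct.induction_on with
  | zero => simp
  | add x x' hx hx' => simp only [map_add, LinearMap.add_apply, hx, hx']
  | tmul t m =>
    induction y using TensorProduct.induction_on with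
    | zero => simp
    | add y y' hy hy' => simp only [map_add, hy, hy']
    | tmul t' m' => simp [f.form_map]

variable (S : Type u) {B : Type u} [CommRing S] [Algebra R S] [Algebra S A] [IsScalarTower R S A]
  [Ring B] [Algebra R B] [Algebra S B] [IsScalarTower R S B] {τ : AlgInvolution R B}

/-- For `ε` in `S`, the functor `U_T : Herm^ε(A, σ) → Herm^{1 ⊗ ε}(T ⊗ A, id ⊗ σ)`, which is
`(M, h) ↦ (M_T, h_T)` on objects and `f ↦ id_T ⊗ f` on morphisms. -/
def scalarExtFunctor (σ : AlgInvolution R A) (ε : S) :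
    HermForm σ (algebraMap S A ε) ⥤
      HermForm (σ.scalarExt T) (algebraMap (T ⊗[R] S) (T ⊗[R] A) ((1 : T) ⊗ₜ[R] ε)) where
  obj X := X.scalarExt T
  map f :=
    { toEquiv := scalarExtMapEquiv T f.toEquiv
      form_map := scalarExt_form_map T f }
  map_id X := HermForm.Isometry.ext (LinearEquiv.ext fun x =>
    LinearMap.congr_fun (LinearMap.lTensor_id T X.carrier) x)
  map_comp f g := HermForm.Isometry.ext (LinearEquiv.ext fun x =>
    LinearMap.congr_fun (LinearMap.lTensor_comp T (g.toEquiv.toLinearMap.restrictScalars R)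
      (f.toEquiv.toLinearMap.restrictScalars R)) x)

variable {S}

/-- The sign `1 ⊗ δε` is the product of `1 ⊗ δ` and `1 ⊗ ε`. -/
theorem scalarExt_sign (δ ε : S) :
    (1 : T) ⊗ₜ[R] (δ * ε) = ((1 : T) ⊗ₜ[R] δ) * ((1 : T) ⊗ₜ[R] ε) := by
  rw [Algebra.TensorProduct.tmul_mul_tmul, one_mul]

theorem AdmittingForm.scalarExt_central {δ : B} (ϑ : AdmittingForm S σ τ δ) (s : T ⊗[R] S)
    (p : T ⊗[R] ϑ.carrier) :
    letI := scalarExtLeft R T A ϑ.carrier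
    letI := scalarExtRight R T B ϑ.carrier
    algebraMap (T ⊗[R] S) (T ⊗[R] A) s • p = op (algebraMap (T ⊗[R] S) (T ⊗[R] B) s) • p := by
  letI := scalarExtLeft R T A ϑ.carrier
  letI := scalarExtRight R T B ϑ.carrier
  induction p using TensorProduct.induction_on with
  | zero => simp
  | add p q hp hq => rw [smul_add, smul_add, hp, hq]
  | tmul t p =>
    induction s using TensorProduct.induction_on with
    | zero => simp
    | add r s hr hs =>
      rw [map_add, map_add, add_smul, MulOpposite.op_add, add_smul, hr, hs]
    | tmul u s =>
      rw [algebraMap_scalarExt, algebraMap_scalarExt, scalarExtLeft_smul_tmul,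
        scalarExtRight_smul_tmul, ϑ.central]

theorem AdmittingForm.scalarExt_admits {δ : B} (ϑ : AdmittingForm S σ τ δ) (a : T ⊗[R] A)
    (p q : T ⊗[R] ϑ.carrier) :
    letI := scalarExtLeft R T A ϑ.carrier
    LinearMap.BilinMap.baseChange T ϑ.form ((σ.scalarExt T) a • p) q =
      LinearMap.BilinMap.baseChange T ϑ.form p (a • q) := by
  letI := scalarExtLeft R T A ϑ.carrier
  induction p using TensorProduct.induction_on with
  | zero => simp
  | add p p' hp hp' => simp only [smul_add, map_add, LinearMap.add_apply, hp, hp']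
  | tmul t p =>
    induction q using TensorProduct.induction_on with
    | zero => simp
    | add q q' hq hq' => simp only [smul_add, map_add, hq, hq']
    | tmul t' q =>
      induction a using TensorProduct.induction_on with
      | zero => simp
      | add a a' ha ha' =>
        simp only [add_smul, map_add, LinearMap.add_apply, ha, ha']
      | tmul u a =>
        have h : (σ.scalarExt T) (u ⊗ₜ[R] a) = u ⊗ₜ[R] σ a := by
          simp [AlgInvolution.scalarExt]
        rw [h, scalarExtLeft_smul_tmul, scalarExtLeft_smul_tmul]
        simp [ϑ.admits, mul_left_comm, mul_comm]

/-- The scalar extension `(T ⊗ P, ϑ_T)` of a form `(P, ϑ)` over `(B, τ)` which admits `(A, σ)`: a form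
over `(T ⊗ B, id ⊗ τ)` which admits `(T ⊗ A, id ⊗ σ)`. -/
def AdmittingForm.scalarExt {δ : S} (ϑ : AdmittingForm S σ τ (algebraMap S B δ)) :
    AdmittingForm (T ⊗[R] S) (σ.scalarExt T) (τ.scalarExt T)
      (algebraMap (T ⊗[R] S) (T ⊗[R] B) ((1 : T) ⊗ₜ[R] δ)) where
  toHermForm := ϑ.toHermForm.scalarExt T
  instLeft := scalarExtLeft R T A ϑ.carrier
  instLeftTower := scalarExtLeft_tower R T A ϑ.carrier
  instComm := scalarExt_smulComm R T A B ϑ.carrier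
  central := ϑ.scalarExt_central T
  admits := ϑ.scalarExt_admits T

end ScalarExt

/-!
The three assertions rest on one notion: a *companion* of an admitting form `ϑ : P × P → B`, i.e. a
second pairing `φ : P × P → A` with `φ(p, q) x = p ϑ(q, x)` such that `1 ∈ A` and `1 ∈ B` are sums
of values of `φ` and `ϑ`. A companion makes `P` a Morita context between `A` and `B` which is
compatible with the involutions.

* If `ϑ` has a companion, then `F_ϑ` is a hermitian Morita equivalence
  (`AdmittingForm.Companion.isHermitianMorita`): contraction with `φ(_, q)` maps `M ⊗_A P` back to
  `M` and shows that `F_ϑ` is fully faithful and that it preserves nonsingular and hyperbolic forms,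
  and `N ⊗_B P`, with the action on `P` twisted by the involutions, is a preimage of `N`.
* Conversely, if `ϑ` is nonsingular and `F_ϑ` is an equivalence, then `ϑ` has a companion
  (`AdmittingForm.nonempty_companion`). As morphisms of hermitian forms are isometries only, one
  looks at unipotent automorphisms of the zero form on `A × A`.
* A companion, and likewise a dual basis, which witnesses that a form is nonsingular, survives
  scalar extension. Together with the isomorphism
  `(T ⊗ M) ⊗_{T ⊗ A} (T ⊗ P) ≃ T ⊗ (M ⊗_A P)` this proves the assertions on `ϑ_T`.

For the existence of `ϑ`, the centre `S` is shown to be finite over `R`, hence semilocal. Projective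
modules over `S` are then free, so that Brauer equivalence becomes an isomorphism
`f : M_m(A) ≃ M_n(B)` over `S` (`BrauerEquivalent.exists_matrix_algEquiv`), which also gives the
Brauer equivalence after scalar extension. By means of `f` there are two involutions on `M_n(B)`
with the same restriction to the centre. By the theorem of Skolem and Noether
(`IsSeparabilityFamily.exists_isUnit_twisted_commute`) they differ by conjugation with a unit `u`,
and a version of Hilbert's theorem 90 (`exists_isUnit_mul_eq`) allows one to choose `u` such that
`u^* = δ u` with `δ = ± 1`. For `e = f(E₀₀)` the form `(v, w) ↦ v^* u w` on `P = e Bⁿ` admits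
`(A, σ)`, and `(p, q) ↦ p q^* u ∈ e M_n(B) e ≃ A` is its companion
(`nonempty_companion_cornerForm`).

The theorems of Skolem and Noether and of Hilbert are proved over the residue fields, where they are
statements about separability idempotents, and lifted by the Chinese remainder theorem and
Nakayama's lemma.
-/

/-! ### Hermitian Morita contexts -/

section MoritaContext

variable {R A B S : Type u} [CommRing R] [Ring A] [Algebra R A] [Ring B] [Algebra R B]
  [CommRing S] [Algebra S A] [Algebra S B]
  {σ : AlgInvolution R A} {τ : AlgInvolution R B}

theorem AlgInvolution.map_mul (σ : AlgInvolution R A) (x y : A) : σ (x * y) = σ y * σ x :=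
  σ.map_mul' x y

theorem AlgInvolution.invol (σ : AlgInvolution R A) (x : A) : σ (σ x) = x := σ.invol' x

theorem AlgInvolution.map_one (σ : AlgInvolution R A) : σ 1 = 1 := by
  have h := σ.map_mul (σ 1) 1
  rw [mul_one, σ.invol, mul_one] at h
  exact h.symm

namespace AdmittingForm

theorem sign_apply {δ : S} (ϑ : AdmittingForm S σ τ (algebraMap S B δ)) (hδ : δ = 1 ∨ δ = -1)
    (x y : ϑ.carrier) : τ (ϑ.form x y) = algebraMap S B δ * ϑ.form y x := by
  rw [ϑ.herm y x]
  rcases hδ with rfl | rfl <;> simp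

/-- A companion `φ : P × P → A` of an admitting form `ϑ : P × P → B`, playing the role of the
second pairing of a Morita context: `φ p q` is the element of `A` acting on `P` as the operator
`x ↦ p ϑ(q, x)`, and both pairings are surjective in the sense that `1` is a sum of values. -/
structure Companion {d : B} (ϑ : AdmittingForm S σ τ d) where
  form : ϑ.carrier →ₗ[R] ϑ.carrier →ₗ[R] A
  smul_left : ∀ (a : A) (p q : ϑ.carrier), form (a • p) q = a * form p q
  assoc : ∀ p q x : ϑ.carrier, form p q • x = op (ϑ.form q x) • p
  exists_sum_left : ∃ (k : ℕ) (p q : Fin k → ϑ.carrier), ∑ j, form (p j) (q j) = 1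
  exists_sum_right : ∃ (k : ℕ) (p q : Fin k → ϑ.carrier), ∑ j, ϑ.form (q j) (p j) = 1

namespace Companion

section General

variable {d : B} {ϑ : AdmittingForm S σ τ d} (φ : ϑ.Companion)
include φ

theorem faithful {a b : A} (h : ∀ x : ϑ.carrier, a • x = b • x) : a = b := by
  obtain ⟨k, p, q, hpq⟩ := φ.exists_sum_left
  rw [← mul_one a, ← mul_one b, ← hpq, Finset.mul_sum, Finset.mul_sum]
  simp only [← φ.smul_left, h]

theorem exists_dualBasis :
    ∃ (k : ℕ) (p q : Fin k → ϑ.carrier), ∀ x, ∑ j, op (ϑ.form (q j) x) • p j = x := by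
  obtain ⟨k, p, q, hpq⟩ := φ.exists_sum_left
  refine ⟨k, p, q, fun x => ?_⟩
  simp only [← φ.assoc, ← Finset.sum_smul, hpq, one_smul]

theorem smul_right (a : A) (p q : ϑ.carrier) : φ.form p (a • q) = φ.form p q * σ a :=
  φ.faithful fun x => by
    rw [φ.assoc, mul_smul, φ.assoc, ← ϑ.admits (σ a), σ.invol]

theorem op_smul_left (b : B) (p q : ϑ.carrier) : φ.form (op b • p) q = φ.form p (op (τ b) • q) :=
  φ.faithful fun x => by
    rw [φ.assoc, φ.assoc, ϑ.smul_left, τ.invol, smul_smul, op_mul]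

variable {e : A} (X : HermForm σ e)

theorem isBalanced_contractAux (q : ϑ.carrier) :
    BalancedTensor.IsBalanced (A := A) (LinearMap.mk₂ R
      (fun (m : X.carrier) (p : ϑ.carrier) => op (φ.form p q) • m)
      (fun m m' p => by simp) (fun r m p => by rw [smul_algebra_smul_comm])
      (fun m p p' => by simp [add_smul]) (fun r m p => by simp)) := fun m a p => by
  simp [φ.smul_left, smul_smul]

/-- The contraction `M ⊗_A P → M`, `m ⊗ p ↦ m φ(p, q)`. -/
def contract (q : ϑ.carrier) : BalancedTensor R A X.carrier ϑ.carrier →ₗ[R] X.carrier :=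
  BalancedTensor.lift _ (φ.isBalanced_contractAux X q)

@[simp]
theorem contract_tmul (q : ϑ.carrier) (m : X.carrier) (p : ϑ.carrier) :
    φ.contract X q (BalancedTensor.tmul R A m p) = op (φ.form p q) • m := by
  simp [contract]

/-- Contracting with `q` and tensoring with `x` is right multiplication by `ϑ(q, x)`. -/
theorem contract_tensor (q x : ϑ.carrier) (y : BalancedTensor R A X.carrier ϑ.carrier) :
    BalancedTensor.tmul R A (φ.contract X q y) x = op (ϑ.form q x) • y := by
  induction y using BalancedTensor.induction_on with
  | zero => simp [BalancedTensor.tmul]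
  | tmul m p =>
    rw [contract_tmul, BalancedTensor.smul_tmul, φ.assoc, BalancedTensor.op_smul_tmul]
  | add y z hy hz => rw [map_add, BalancedTensor.add_tmul, hy, hz, smul_add]

theorem contract_op_smul (q : ϑ.carrier) (b : B)
    (y : BalancedTensor R A X.carrier ϑ.carrier) :
    φ.contract X q (op b • y) = φ.contract X (op (τ b) • q) y := by
  induction y using BalancedTensor.induction_on with
  | zero => simp
  | tmul m p => rw [BalancedTensor.op_smul_tmul, contract_tmul, contract_tmul, op_smul_left]
  | add y z hy hz => rw [smul_add, map_add, map_add, hy, hz]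

/-- Elements of `M ⊗_A P` can be recovered from their contractions. -/
theorem exists_sum_contract : ∃ (k : ℕ) (p q : Fin k → ϑ.carrier), ∀ X : HermForm σ e,
    ∀ y : BalancedTensor R A X.carrier ϑ.carrier,
      ∑ j, BalancedTensor.tmul R A (φ.contract X (q j) y) (p j) = y := by
  obtain ⟨k, p, q, hpq⟩ := φ.exists_sum_right
  refine ⟨k, p, q, fun X y => ?_⟩
  simp only [contract_tensor, ← Finset.sum_smul, ← Finset.op_sum, hpq, op_one, one_smul]

variable {X}

theorem tensor_injective {m n : X.carrier}
    (h : ∀ x : ϑ.carrier, BalancedTensor.tmul R A m x = BalancedTensor.tmul R A n x) : m = n := by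
  obtain ⟨k, p, q, hpq⟩ := φ.exists_sum_left
  have key : ∀ m : X.carrier, m = ∑ j, φ.contract X (q j) (BalancedTensor.tmul R A m (p j)) := by
    intro m
    simp only [contract_tmul, ← Finset.sum_smul, ← Finset.op_sum, hpq, op_one, one_smul]
  rw [key m, key n]
  simp only [h]

theorem eq_zero_of_contract {y : BalancedTensor R A X.carrier ϑ.carrier}
    (h : ∀ q, φ.contract X q y = 0) : y = 0 := by
  obtain ⟨k, p, q, hpq⟩ := φ.exists_sum_contract (e := e)
  rw [← hpq X y]
  simp [h, BalancedTensor.tmul]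

/-- A `B`-linear map `M ⊗_A P → M' ⊗_A P` is `f ⊗ id` for an `A`-linear map `f`. -/
theorem exists_descend {Y : HermForm σ e}
    (g : BalancedTensor R A X.carrier ϑ.carrier →ₗ[Bᵐᵒᵖ] BalancedTensor R A Y.carrier ϑ.carrier) :
    ∃ f : X.carrier →ₗ[Aᵐᵒᵖ] Y.carrier, ∀ m x,
      BalancedTensor.tmul R A (f m) x = g (BalancedTensor.tmul R A m x) := by
  obtain ⟨k, p, q, hpq⟩ := φ.exists_dualBasis
  let f : X.carrier → Y.carrier :=
    fun m => ∑ j, φ.contract Y (q j) (g (BalancedTensor.tmul R A m (p j)))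
  have hf : ∀ m x, BalancedTensor.tmul R A (f m) x = g (BalancedTensor.tmul R A m x) := by
    intro m x
    simp only [f, BalancedTensor.sum_tmul, contract_tensor, ← map_smul,
      BalancedTensor.op_smul_tmul]
    rw [← map_sum, ← BalancedTensor.tmul_sum, hpq]
  refine ⟨{ toFun := f
            map_add' := fun m n => φ.tensor_injective fun x => ?_
            map_smul' := fun a m => φ.tensor_injective fun x => ?_ }, hf⟩
  · rw [BalancedTensor.add_tmul, hf, hf, hf, BalancedTensor.add_tmul, map_add]
  · induction a using MulOpposite.rec' with | _ a
    rw [RingHom.id_apply, BalancedTensor.smul_tmul, hf, hf, BalancedTensor.smul_tmul]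

theorem nondegenerate {x : ϑ.carrier} (h : ∀ y, ϑ.form x y = 0) : x = 0 := by
  obtain ⟨k, p, q, hpq⟩ := φ.exists_dualBasis
  rw [← hpq x]
  refine Finset.sum_eq_zero fun j _ => ?_
  rw [ϑ.herm, h, map_zero, mul_zero, op_zero, zero_smul]

end General

section Sign

variable {δ ε η : S} {ϑ : AdmittingForm S σ τ (algebraMap S B δ)} (φ : ϑ.Companion)
  (hδ : δ = 1 ∨ δ = -1)
include φ hδ

/-- The companion of a `δ`-hermitian form is `δ`-hermitian. -/
theorem herm (p q : ϑ.carrier) : σ (φ.form p q) = algebraMap S A δ * φ.form q p := by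
  refine φ.faithful fun x => sub_eq_zero.1 (φ.nondegenerate fun y => ?_)
  rw [map_sub, LinearMap.sub_apply, ϑ.admits, φ.assoc, mul_smul, φ.assoc, ϑ.central,
    ϑ.smul_left, ϑ.smul_left, ϑ.smul_right, ϑ.sign_apply hδ p x]
  rcases hδ with rfl | rfl <;> simp [τ.map_one]

/-- Up to the sign `δ`, contraction with `q` is adjoint to `m' ↦ m' ⊗ x`. -/
theorem form_contract (hη : η = δ * ε) (X : HermForm σ (algebraMap S A ε)) (p q x : ϑ.carrier)
    (m' : X.carrier) (y : BalancedTensor R A X.carrier ϑ.carrier) :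
    ϑ.form p (X.form (φ.contract X q y) m' • x) =
      algebraMap S B δ * ϑ.form p q * (ϑ.prodObj hη X).form y (BalancedTensor.tmul R A m' x) := by
  induction y using BalancedTensor.induction_on with
  | zero => simp
  | tmul m r =>
    rw [contract_tmul, X.smul_left, φ.herm hδ, mul_smul, mul_smul, φ.assoc, ϑ.central,
      ϑ.smul_right, ϑ.smul_right, prodForm_tmul, ← Algebra.commutes, mul_assoc]
  | add y z hy hz =>
    rw [map_add, map_add, LinearMap.add_apply, add_smul, map_add, hy, hz, map_add,
      LinearMap.add_apply, mul_add]

/-- A functional `g` on `M ⊗_A P` gives for each `r` the functional `m' ↦ a` on `M`, where `a ∈ A`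
acts on `P` as `x ↦ r g(m' ⊗ x)`. These are represented by elements `w r` of `M`, and `g` is
represented by `δ ∑ w (q' i) ⊗ p' i`, where `∑ ϑ(q' i, p' i) = 1`. -/
theorem nonsingular_prodObj (hη : η = δ * ε) {X : HermForm σ (algebraMap S A ε)}
    (hX : X.Nonsingular) : (ϑ.prodObj hη X).Nonsingular := by
  refine ⟨fun y z h => ?_, fun g => ?_⟩
  · have h' : ∀ w, (ϑ.prodObj hη X).form (y - z) w = 0 := fun w => by
      have := LinearMap.congr_fun h w
      rw [map_sub, LinearMap.sub_apply]
      exact sub_eq_zero.2 this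
    refine sub_eq_zero.1 (φ.eq_zero_of_contract (X := X) fun q => hX.1 ?_)
    ext m'
    change X.form (φ.contract X q (y - z)) m' = X.form 0 m'
    rw [map_zero, LinearMap.zero_apply]
    refine φ.faithful fun x => ?_
    rw [zero_smul]
    refine φ.nondegenerate fun w => ?_
    rw [ϑ.herm, φ.form_contract hδ hη, h', mul_zero, map_zero, mul_zero]
  · obtain ⟨k, p, q, hpq⟩ := φ.exists_sum_left
    obtain ⟨l, p', q', hpq'⟩ := φ.exists_sum_right
    let G : ϑ.carrier → X.carrier → A := fun r m' =>
      ∑ j, φ.form (op (g (BalancedTensor.tmul R A m' (p j))) • r) (q j)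
    have hG : ∀ r m' x, G r m' • x = op (g (BalancedTensor.tmul R A m' x)) • r := by
      intro r m' x
      simp only [G, Finset.sum_smul, φ.assoc, smul_smul, ← op_mul]
      rw [← Finset.sum_smul, ← Finset.op_sum]
      congr 2
      have : ∀ b : B, ∀ z, g (op b • z) = g z * b := fun b z => by rw [map_smul]; rfl
      simp only [← this, BalancedTensor.op_smul_tmul]
      rw [← map_sum, ← BalancedTensor.tmul_sum]
      simp only [← φ.assoc, ← Finset.sum_smul, hpq, one_smul]
    let G' : ϑ.carrier → X.carrier →ₗ[Aᵐᵒᵖ] A := fun r =>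
      { toFun := G r
        map_add' := fun m n => φ.faithful fun x => by
          rw [add_smul, hG, hG, hG, BalancedTensor.add_tmul, map_add, MulOpposite.op_add, add_smul]
        map_smul' := fun a m => φ.faithful fun x => by
          induction a using MulOpposite.rec' with | _ a
          rw [RingHom.id_apply, op_smul_eq_mul, mul_smul, hG, hG, BalancedTensor.smul_tmul] }
    choose w hw using fun r => hX.2 (G' r)
    have hw' : ∀ r m', X.form (w r) m' = G r m' := fun r m' => LinearMap.congr_fun (hw r) m'
    refine ⟨algebraMap S Bᵐᵒᵖ δ • ∑ i, BalancedTensor.tmul R A (w (q' i)) (p' i), ?_⟩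
    ext z
    change (ϑ.prodObj hη X).form _ z = g z
    have hsum : ∑ i, ϑ.form (p' i) (q' i) = algebraMap S B δ := by
      have := congrArg (fun b => algebraMap S B δ * τ b) hpq'
      simp only [map_sum, Finset.mul_sum, ← ϑ.herm, τ.map_one, mul_one] at this
      exact this
    have hd : τ (algebraMap S B δ) * algebraMap S B δ = 1 := by
      rcases hδ with rfl | rfl <;> simp [τ.map_one]
    induction z using BalancedTensor.induction_on with
    | zero => simp
    | add y z hy hz => rw [map_add, map_add, hy, hz]
    | tmul m x =>
      change (ϑ.prodObj hη X).form (op (algebraMap S B δ) • _) _ = _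
      rw [(ϑ.prodObj hη X).smul_left, map_sum, LinearMap.sum_apply]
      simp only [prodForm_tmul, hw', hG, ϑ.smul_right]
      rw [← Finset.sum_mul, hsum, ← mul_assoc, hd, one_mul]

/-- A totally isotropic summand `L` of `M` gives the totally isotropic summand of `M ⊗_A P` which
consists of the elements all of whose contractions are in `L`. -/
theorem hyperbolic_prodObj (hη : η = δ * ε) {X : HermForm σ (algebraMap S A ε)}
    (hX : X.Hyperbolic) : (ϑ.prodObj hη X).Hyperbolic := by
  obtain ⟨hns, L, L', hc, hL, hL'⟩ := hX
  refine ⟨φ.nonsingular_prodObj hδ hη hns, ?_⟩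
  let F : Submodule Aᵐᵒᵖ X.carrier → Submodule Bᵐᵒᵖ (BalancedTensor R A X.carrier ϑ.carrier) :=
    fun L =>
    { carrier := {y | ∀ q, φ.contract X q y ∈ L}
      add_mem' := fun {y z} hy hz q => by rw [map_add]; exact L.add_mem (hy q) (hz q)
      zero_mem' := fun q => by rw [map_zero]; exact L.zero_mem
      smul_mem' := fun b y hy q => by
        induction b using MulOpposite.rec' with | _ b
        rw [contract_op_smul]
        exact hy _ }
  have iso : ∀ L : Submodule Aᵐᵒᵖ X.carrier, (∀ x ∈ L, ∀ y ∈ L, X.form x y = 0) →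
      ∀ x ∈ F L, ∀ y ∈ F L, (ϑ.prodObj hη X).form x y = 0 := by
    intro L hL x hx y hy
    obtain ⟨k, p, q, hpq⟩ := φ.exists_sum_contract (e := algebraMap S A ε)
    rw [← hpq X x, ← hpq X y, map_sum]
    refine Finset.sum_eq_zero fun j _ => ?_
    rw [map_sum, LinearMap.sum_apply]
    refine Finset.sum_eq_zero fun i _ => ?_
    rw [prodForm_tmul, hL _ (hx _) _ (hy _), zero_smul, map_zero]
  refine ⟨F L, F L', ⟨?_, ?_⟩, iso L hL, iso L' hL'⟩
  · rw [Submodule.disjoint_def]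
    intro y hy hy'
    exact φ.eq_zero_of_contract (X := X) fun q =>
      Submodule.disjoint_def.1 hc.disjoint _ (hy q) (hy' q)
  · rw [codisjoint_iff, eq_top_iff]
    rintro y -
    have mem : ∀ L : Submodule Aᵐᵒᵖ X.carrier, ∀ m ∈ L, ∀ p : ϑ.carrier,
        BalancedTensor.tmul R A m p ∈ F L := fun L m hm p q => by
      rw [contract_tmul]
      exact L.smul_mem _ hm
    induction y using BalancedTensor.induction_on with
    | zero => exact Submodule.zero_mem _
    | add y z hy hz => exact Submodule.add_mem _ hy hz
    | tmul m p =>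
      obtain ⟨l, hl, l', hl', rfl⟩ := Submodule.mem_sup.1
        (hc.sup_eq_top ▸ Submodule.mem_top : m ∈ L ⊔ L')
      rw [BalancedTensor.add_tmul]
      exact Submodule.add_mem_sup (mem _ _ hl _) (mem _ _ hl' _)

end Sign

end Companion

end AdmittingForm

end MoritaContext

/-! ### The functor of a Morita context is a hermitian Morita equivalence -/

section MapTensor

variable {R A : Type u} [CommRing R] [Ring A] [Algebra R A] {B : Type u} [Ring B] [Algebra R B]
  {P : Type u} [AddCommGroup P] [Module R P] [Module A P] [IsScalarTower R A P] [Module Bᵐᵒᵖ P]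
  [IsScalarTower R Bᵐᵒᵖ P] [SMulCommClass A Bᵐᵒᵖ P]

namespace BalancedTensor

theorem hom_ext_right {M N : Type u} [AddCommGroup M] [Module R M] [Module Aᵐᵒᵖ M]
    [IsScalarTower R Aᵐᵒᵖ M] [AddCommGroup N] [Module Bᵐᵒᵖ N]
    {f g : BalancedTensor R A M P →ₗ[Bᵐᵒᵖ] N}
    (h : ∀ m p, f (tmul R A m p) = g (tmul R A m p)) : f = g := by
  ext x
  induction x using induction_on with
  | zero => simp
  | tmul m p => exact h m p
  | add x y hx hy => rw [map_add, map_add, hx, hy]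

theorem bilin_ext {M M' N : Type u} [AddCommGroup M] [Module R M] [Module Aᵐᵒᵖ M]
    [IsScalarTower R Aᵐᵒᵖ M] [AddCommGroup M'] [Module R M'] [Module Aᵐᵒᵖ M']
    [IsScalarTower R Aᵐᵒᵖ M'] [AddCommGroup N] [Module R N]
    {f g : BalancedTensor R A M P →ₗ[R] BalancedTensor R A M' P →ₗ[R] N}
    (h : ∀ m p m' p', f (tmul R A m p) (tmul R A m' p') = g (tmul R A m p) (tmul R A m' p')) :
    f = g :=
  hom_ext fun m p => hom_ext fun m' p' => h m p m' p'

/-- The map out of `M ⊗_A P` induced by a balanced map which is linear over `B` on the right. -/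
def liftRight {M N : Type u} [AddCommGroup M] [Module R M] [Module Aᵐᵒᵖ M]
    [IsScalarTower R Aᵐᵒᵖ M] [AddCommGroup N] [Module R N] [Module Bᵐᵒᵖ N]
    (f : M →ₗ[R] P →ₗ[R] N) (hf : IsBalanced (A := A) f)
    (h : ∀ (b : B) m p, f m (op b • p) = op b • f m p) : BalancedTensor R A M P →ₗ[Bᵐᵒᵖ] N :=
  { lift f hf with
    map_smul' := fun b x => by
      induction b using MulOpposite.rec' with | _ b
      induction x using induction_on with
      | zero => simp
      | tmul m p => simp [h]
      | add x y hx hy =>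
        simp only [smul_add, map_add, AddHom.toFun_eq_coe, LinearMap.coe_toAddHom] at *
        rw [hx, hy] }

@[simp]
theorem liftRight_tmul {M N : Type u} [AddCommGroup M] [Module R M] [Module Aᵐᵒᵖ M]
    [IsScalarTower R Aᵐᵒᵖ M] [AddCommGroup N] [Module R N] [Module Bᵐᵒᵖ N]
    (f : M →ₗ[R] P →ₗ[R] N) (hf : IsBalanced (A := A) f)
    (h : ∀ (b : B) m p, f m (op b • p) = op b • f m p) (m : M) (p : P) :
    liftRight f hf h (tmul R A m p) = f m p := lift_tmul f hf m p

/-- The map `f ⊗ id_P` induced by a linear map `f` of right `A`-modules. -/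
def mapRight {M M' : Type u} [AddCommGroup M] [Module R M] [Module Aᵐᵒᵖ M]
    [IsScalarTower R Aᵐᵒᵖ M] [AddCommGroup M'] [Module R M'] [Module Aᵐᵒᵖ M']
    [IsScalarTower R Aᵐᵒᵖ M'] (f : M →ₗ[Aᵐᵒᵖ] M') :
    BalancedTensor R A M P →ₗ[Bᵐᵒᵖ] BalancedTensor R A M' P :=
  liftRight ((mk R A M' P).comp (f.restrictScalars R)) (isBalanced_map R A f) fun b m p => by simp

@[simp]
theorem mapRight_tmul {M M' : Type u} [AddCommGroup M] [Module R M] [Module Aᵐᵒᵖ M]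
    [IsScalarTower R Aᵐᵒᵖ M] [AddCommGroup M'] [Module R M'] [Module Aᵐᵒᵖ M']
    [IsScalarTower R Aᵐᵒᵖ M'] (f : M →ₗ[Aᵐᵒᵖ] M') (m : M) (p : P) :
    mapRight (B := B) f (tmul R A m p) = tmul R A (f m) p :=
  liftRight_tmul _ _ _ m p

end BalancedTensor

/-- An isometry is an isomorphism of hermitian forms. -/
def HermForm.Isometry.toIso {σ : AlgInvolution R A} {ε : A} {X Y : HermForm σ ε}
    (f : HermForm.Isometry X Y) : X ≅ Y where
  hom := f
  inv := ⟨f.toEquiv.symm, fun x y => by rw [← f.form_map]; simp⟩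
  hom_inv_id := HermForm.Isometry.ext (LinearEquiv.ext fun x => f.toEquiv.symm_apply_apply x)
  inv_hom_id := HermForm.Isometry.ext (LinearEquiv.ext fun x => f.toEquiv.apply_symm_apply x)

end MapTensor

section MoritaContext

variable {R A B S : Type u} [CommRing R] [Ring A] [Algebra R A] [Ring B] [Algebra R B]
  [CommRing S] [Algebra S A] [Algebra S B]
  {σ : AlgInvolution R A} {τ : AlgInvolution R B}

namespace AdmittingForm

theorem nonempty_orthSum_iso {δ ε η : S} (ϑ : AdmittingForm S σ τ (algebraMap S B δ))
    (hη : η = δ * ε) (X Y : HermForm σ (algebraMap S A ε)) :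
    Nonempty ((ϑ.moritaFunctor hη).obj (X.orthSum Y) ≅
      ((ϑ.moritaFunctor hη).obj X).orthSum ((ϑ.moritaFunctor hη).obj Y)) := by
  let F : BalancedTensor R A (X.carrier × Y.carrier) ϑ.carrier →ₗ[Bᵐᵒᵖ]
      BalancedTensor R A X.carrier ϑ.carrier × BalancedTensor R A Y.carrier ϑ.carrier :=
    (BalancedTensor.mapRight (LinearMap.fst Aᵐᵒᵖ X.carrier Y.carrier)).prod
      (BalancedTensor.mapRight (LinearMap.snd Aᵐᵒᵖ X.carrier Y.carrier))
  let G : BalancedTensor R A X.carrier ϑ.carrier × BalancedTensor R A Y.carrier ϑ.carrier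
      →ₗ[Bᵐᵒᵖ] BalancedTensor R A (X.carrier × Y.carrier) ϑ.carrier :=
    (BalancedTensor.mapRight (LinearMap.inl Aᵐᵒᵖ X.carrier Y.carrier)).coprod
      (BalancedTensor.mapRight (LinearMap.inr Aᵐᵒᵖ X.carrier Y.carrier))
  have hF : ∀ m p, F (BalancedTensor.tmul R A m p) =
      (BalancedTensor.tmul R A m.1 p, BalancedTensor.tmul R A m.2 p) := fun m p => by simp [F]
  have hFG : F ∘ₗ G = LinearMap.id := by
    refine LinearMap.prod_ext ?_ ?_ <;>
    exact BalancedTensor.hom_ext_right fun m p => by simp [G, hF]; simp [BalancedTensor.tmul]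
  have hGF : G ∘ₗ F = LinearMap.id := BalancedTensor.hom_ext_right fun m p => by
    simp [G, hF, ← BalancedTensor.add_tmul]
  refine ⟨HermForm.Isometry.toIso ⟨LinearEquiv.ofLinearMap F G hFG hGF, fun x y => ?_⟩⟩
  have key : (ϑ.prodForm X).compl₁₂
        ((LinearMap.fst Bᵐᵒᵖ _ _ ∘ₗ F).restrictScalars R)
        ((LinearMap.fst Bᵐᵒᵖ _ _ ∘ₗ F).restrictScalars R) +
      (ϑ.prodForm Y).compl₁₂
        ((LinearMap.snd Bᵐᵒᵖ _ _ ∘ₗ F).restrictScalars R)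
        ((LinearMap.snd Bᵐᵒᵖ _ _ ∘ₗ F).restrictScalars R) =
      ϑ.prodForm (X.orthSum Y) := by
    refine BalancedTensor.bilin_ext fun m p m' p' => ?_
    refine Eq.trans ?_ (ϑ.prodForm_tmul (X.orthSum Y) m m' p p').symm
    change ϑ.prodForm X (F (BalancedTensor.tmul R A m p)).1 (F (BalancedTensor.tmul R A m' p')).1 +
      ϑ.prodForm Y (F (BalancedTensor.tmul R A m p)).2 (F (BalancedTensor.tmul R A m' p')).2 =
      ϑ.form p ((X.form m.1 m'.1 + Y.form m.2 m'.2) • p')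
    rw [hF, hF, prodForm_tmul, prodForm_tmul, add_smul, map_add]
  exact LinearMap.congr_fun₂ key x y

/-- The `B`-`A`-bimodule obtained from the `A`-`B`-bimodule `P` of an admitting form by means of the
involutions: the new product `b p a` is `σ(a) p τ(b)`. -/
def Twist {d : B} (ϑ : AdmittingForm S σ τ d) : Type u := ϑ.carrier

section Twist

variable {d : B} (ϑ : AdmittingForm S σ τ d)

instance : AddCommGroup ϑ.Twist := inferInstanceAs (AddCommGroup ϑ.carrier)

instance : Module R ϑ.Twist := inferInstanceAs (Module R ϑ.carrier)

/-- An element of `P`, seen in the twisted bimodule. -/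
def toTwist : ϑ.carrier ≃ₗ[R] ϑ.Twist := LinearEquiv.refl R ϑ.carrier

instance : Module B ϑ.Twist where
  smul b q := ϑ.toTwist (op (τ b) • ϑ.toTwist.symm q)
  one_smul q := by
    change ϑ.toTwist (op (τ 1) • ϑ.toTwist.symm q) = q
    simp [τ.map_one]
  mul_smul b c q := by
    change ϑ.toTwist (op (τ (b * c)) • ϑ.toTwist.symm q) =
      ϑ.toTwist (op (τ b) • ϑ.toTwist.symm (ϑ.toTwist (op (τ c) • ϑ.toTwist.symm q)))
    simp [τ.map_mul, mul_smul]
  smul_zero b := by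
    change ϑ.toTwist (op (τ b) • ϑ.toTwist.symm 0) = 0
    simp
  smul_add b x y := by
    change ϑ.toTwist (op (τ b) • ϑ.toTwist.symm (x + y)) =
      ϑ.toTwist (op (τ b) • ϑ.toTwist.symm x) + ϑ.toTwist (op (τ b) • ϑ.toTwist.symm y)
    simp
  zero_smul q := by
    change ϑ.toTwist (op (τ 0) • ϑ.toTwist.symm q) = 0
    simp
  add_smul b c q := by
    change ϑ.toTwist (op (τ (b + c)) • ϑ.toTwist.symm q) =
      ϑ.toTwist (op (τ b) • ϑ.toTwist.symm q) + ϑ.toTwist (op (τ c) • ϑ.toTwist.symm q)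
    simp [add_smul]

instance : Module Aᵐᵒᵖ ϑ.Twist where
  smul a q := ϑ.toTwist (σ (unop a) • ϑ.toTwist.symm q)
  one_smul q := by
    change ϑ.toTwist (σ 1 • ϑ.toTwist.symm q) = q
    simp [σ.map_one]
  mul_smul b c q := by
    change ϑ.toTwist (σ (unop c * unop b) • ϑ.toTwist.symm q) =
      ϑ.toTwist (σ (unop b) • ϑ.toTwist.symm (ϑ.toTwist (σ (unop c) • ϑ.toTwist.symm q)))
    simp [σ.map_mul, mul_smul]
  smul_zero b := by
    change ϑ.toTwist (σ (unop b) • ϑ.toTwist.symm 0) = 0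
    simp
  smul_add b x y := by
    change ϑ.toTwist (σ (unop b) • ϑ.toTwist.symm (x + y)) =
      ϑ.toTwist (σ (unop b) • ϑ.toTwist.symm x) + ϑ.toTwist (σ (unop b) • ϑ.toTwist.symm y)
    simp
  zero_smul q := by
    change ϑ.toTwist (σ 0 • ϑ.toTwist.symm q) = 0
    simp
  add_smul b c q := by
    change ϑ.toTwist (σ (unop b + unop c) • ϑ.toTwist.symm q) =
      ϑ.toTwist (σ (unop b) • ϑ.toTwist.symm q) + ϑ.toTwist (σ (unop c) • ϑ.toTwist.symm q)
    simp [add_smul]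

theorem smul_toTwist (b : B) (q : ϑ.carrier) : b • ϑ.toTwist q = ϑ.toTwist (op (τ b) • q) := rfl

theorem op_smul_toTwist (a : A) (q : ϑ.carrier) : op a • ϑ.toTwist q = ϑ.toTwist (σ a • q) := rfl

instance : IsScalarTower R B ϑ.Twist := ⟨fun r b q => by
  obtain ⟨q, rfl⟩ := ϑ.toTwist.surjective q
  rw [smul_toTwist, smul_toTwist, τ.toLin.map_smul, op_smul, smul_assoc, ϑ.toTwist.map_smul]⟩

instance : IsScalarTower R Aᵐᵒᵖ ϑ.Twist := ⟨fun r a q => by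
  induction a using MulOpposite.rec' with | _ a
  obtain ⟨q, rfl⟩ := ϑ.toTwist.surjective q
  rw [← op_smul, op_smul_toTwist, op_smul_toTwist, σ.toLin.map_smul, smul_assoc,
    ϑ.toTwist.map_smul]⟩

instance : SMulCommClass B Aᵐᵒᵖ ϑ.Twist := ⟨fun b a q => by
  induction a using MulOpposite.rec' with | _ a
  obtain ⟨q, rfl⟩ := ϑ.toTwist.surjective q
  rw [op_smul_toTwist, smul_toTwist, smul_toTwist, op_smul_toTwist, smul_comm (σ a)]⟩

/-- If `∑ ϑ(q i, p i) = 1`, then the `p i` and the functionals `x ↦ σ(φ(x, q i))` are a dual basis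
of the twisted bimodule. -/
theorem Companion.finite_projective_twist {ϑ : AdmittingForm S σ τ d} (φ : ϑ.Companion) :
    Module.Finite Aᵐᵒᵖ ϑ.Twist ∧ Module.Projective Aᵐᵒᵖ ϑ.Twist := by
  obtain ⟨k, p, q, hpq⟩ := φ.exists_sum_right
  refine finite_projective_of_dualBasis (fun i => ϑ.toTwist (p i)) (fun i =>
    { toFun := fun x => op (σ (φ.form (ϑ.toTwist.symm x) (q i)))
      map_add' := fun x y => by simp
      map_smul' := fun a x => by
        induction a using MulOpposite.rec' with | _ a
        obtain ⟨x, rfl⟩ := ϑ.toTwist.surjective x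
        rw [op_smul_toTwist, LinearEquiv.symm_apply_apply, LinearEquiv.symm_apply_apply,
          φ.smul_left, σ.map_mul, σ.invol]
        simp }) fun x => ?_
  obtain ⟨x, rfl⟩ := ϑ.toTwist.surjective x
  simp only [LinearMap.coe_mk, AddHom.coe_mk, op_smul_toTwist, LinearEquiv.symm_apply_apply,
    σ.invol, φ.assoc]
  rw [← map_sum, ← Finset.sum_smul, ← Finset.op_sum, hpq, op_one, one_smul]

end Twist

namespace Companion

section Inverse

variable {δ ε η : S} {ϑ : AdmittingForm S σ τ (algebraMap S B δ)} (φ : ϑ.Companion)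
  {d : B} (N : HermForm τ d)

/-- The map `(n', q') ↦ φ (q k(n, n')) q'`. -/
def twistFormAux (n : N.carrier) (q : ϑ.Twist) : N.carrier →ₗ[R] ϑ.Twist →ₗ[R] A :=
  LinearMap.mk₂ R (fun n' q' => algebraMap S A δ *
      φ.form (op (N.form n n') • ϑ.toTwist.symm q) (ϑ.toTwist.symm q'))
    (fun m m' p' => by simp [add_smul, mul_add])
    (fun r m' p' => by simp)
    (fun m' p' p'' => by simp [mul_add])
    (fun r m' p' => by simp)

theorem isBalanced_twistFormAux (n : N.carrier) (q : ϑ.Twist) :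
    BalancedTensor.IsBalanced (A := B) (φ.twistFormAux N n q) := fun m' b p' => by
  obtain ⟨p', rfl⟩ := ϑ.toTwist.surjective p'
  simp [twistFormAux, N.smul_right, mul_smul, smul_toTwist, φ.op_smul_left, τ.map_mul]

/-- The map `(n, q) ↦ (n' ⊗ q' ↦ φ (q k(n, n')) q')`. -/
def twistFormCurried :
    N.carrier →ₗ[R] ϑ.Twist →ₗ[R] BalancedTensor R B N.carrier ϑ.Twist →ₗ[R] A :=
  LinearMap.mk₂ R
    (fun m p => BalancedTensor.lift (φ.twistFormAux N m p) (φ.isBalanced_twistFormAux N m p))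
    (fun m m' p => BalancedTensor.hom_ext fun n q => by
      simp [twistFormAux, add_smul, mul_add])
    (fun r m p => BalancedTensor.hom_ext fun n q => by simp [twistFormAux])
    (fun m p p' => BalancedTensor.hom_ext fun n q => by simp [twistFormAux, mul_add])
    (fun r m p => BalancedTensor.hom_ext fun n q => by
      simp only [twistFormAux, BalancedTensor.lift_tmul, LinearMap.mk₂_apply, map_smul,
        LinearMap.smul_apply]
      rw [smul_comm, map_smul, LinearMap.smul_apply, mul_smul_comm])

theorem isBalanced_twistFormCurried :
    BalancedTensor.IsBalanced (A := B) (φ.twistFormCurried N) := fun m b p => by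
  obtain ⟨p, rfl⟩ := ϑ.toTwist.surjective p
  refine BalancedTensor.hom_ext fun n q => ?_
  simp [twistFormCurried, twistFormAux, N.smul_left, mul_smul, smul_toTwist]

/-- The form `(n ⊗ q, n' ⊗ q') ↦ δ φ(q k(n, n'), q')` on `N ⊗_B P`, where `P` is the twisted
bimodule. -/
def twistForm :
    BalancedTensor R B N.carrier ϑ.Twist →ₗ[R] BalancedTensor R B N.carrier ϑ.Twist →ₗ[R] A :=
  BalancedTensor.lift (φ.twistFormCurried N) (φ.isBalanced_twistFormCurried N)

@[simp]
theorem twistForm_tmul (n n' : N.carrier) (q q' : ϑ.carrier) :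
    φ.twistForm N (BalancedTensor.tmul R B n (ϑ.toTwist q))
      (BalancedTensor.tmul R B n' (ϑ.toTwist q')) =
      algebraMap S A δ * φ.form (op (N.form n n') • q) q' := by
  simp [twistForm, twistFormCurried, twistFormAux]

theorem twist_induction {motive : BalancedTensor R B N.carrier ϑ.Twist → Prop}
    (x : BalancedTensor R B N.carrier ϑ.Twist) (zero : motive 0)
    (tmul : ∀ m p, motive (BalancedTensor.tmul R B m (ϑ.toTwist p)))
    (add : ∀ x y, motive x → motive y → motive (x + y)) : motive x :=
  BalancedTensor.induction_on x zero (fun m p => by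
    obtain ⟨p, rfl⟩ := ϑ.toTwist.surjective p
    exact tmul m p) add

end Inverse

section Equivalence

variable {δ ε η : S} {ϑ : AdmittingForm S σ τ (algebraMap S B δ)} (φ : ϑ.Companion)
  (hδ : δ = 1 ∨ δ = -1) {d : B}

include φ in
theorem faithful_moritaFunctor (hη : η = δ * ε) :
    (ϑ.moritaFunctor (ε := ε) hη).Faithful where
  map_injective {X Y f g} h := by
    refine HermForm.Isometry.ext (LinearEquiv.ext fun m => φ.tensor_injective fun x => ?_)
    have := congrArg (fun F : HermForm.Isometry _ _ => F.toEquiv (BalancedTensor.tmul R A m x)) h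
    change BalancedTensor.mapEquiv R A f.toEquiv _ = BalancedTensor.mapEquiv R A g.toEquiv _ at this
    rwa [BalancedTensor.mapEquiv_tmul, BalancedTensor.mapEquiv_tmul] at this

include φ in
theorem full_moritaFunctor (hη : η = δ * ε) : (ϑ.moritaFunctor (ε := ε) hη).Full where
  map_surjective {X Y} G := by
    obtain ⟨G, hG⟩ := G
    change BalancedTensor R A X.carrier ϑ.carrier ≃ₗ[Bᵐᵒᵖ]
      BalancedTensor R A Y.carrier ϑ.carrier at G
    obtain ⟨f, hf⟩ := φ.exists_descend (X := X) (Y := Y) G.toLinearMap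
    obtain ⟨g, hg⟩ := φ.exists_descend (X := Y) (Y := X) G.symm.toLinearMap
    simp only [LinearEquiv.coe_coe] at hf hg
    have hfg : f ∘ₗ g = LinearMap.id := LinearMap.ext fun m => φ.tensor_injective fun x => by
      rw [LinearMap.comp_apply, hf, hg]; simp
    have hgf : g ∘ₗ f = LinearMap.id := LinearMap.ext fun m => φ.tensor_injective fun x => by
      rw [LinearMap.comp_apply, hg, hf]; simp
    refine ⟨⟨LinearEquiv.ofLinearMap f g hfg hgf, fun m m' => φ.faithful fun x => ?_⟩, ?_⟩
    · refine sub_eq_zero.1 (φ.nondegenerate fun y => ?_)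
      change ϑ.form (Y.form (f m) (f m') • x - _) y = 0
      rw [ϑ.herm, map_sub, ← prodForm_tmul, ← prodForm_tmul, hf, hf]
      have := hG (BalancedTensor.tmul R A m y) (BalancedTensor.tmul R A m' x)
      change ϑ.prodForm Y (G _) (G _) = ϑ.prodForm X _ _ at this
      rw [this, sub_self, map_zero, mul_zero]
    · refine HermForm.Isometry.ext (LinearEquiv.ext fun y => ?_)
      change BalancedTensor.mapEquiv R A (B := B) (LinearEquiv.ofLinearMap f g hfg hgf) y = G y
      induction y using BalancedTensor.induction_on with
      | zero => simp
      | tmul m p => simp [hf]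
      | add y z hy hz => rw [map_add, map_add, hy, hz]

include hδ

/-- The form over `(A, σ)` whose image under `F_ϑ` is isometric to the given form. -/
def twistObj (hη : η = δ * ε) (N : HermForm τ (algebraMap S B η)) :
    HermForm σ (algebraMap S A ε) where
  carrier := BalancedTensor R B N.carrier ϑ.Twist
  instFinite :=
    have := φ.finite_projective_twist.1
    have := φ.finite_projective_twist.2
    (BalancedTensor.finite_projective R B).1
  instProjective :=
    have := φ.finite_projective_twist.1
    have := φ.finite_projective_twist.2
    (BalancedTensor.finite_projective R B).2
  form := φ.twistForm N
  smul_left a x y := by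
    induction x using twist_induction with
    | zero => simp
    | add x x' hx hx' => simp only [smul_add, map_add, LinearMap.add_apply, mul_add, hx, hx']
    | tmul m p =>
      induction y using twist_induction with
      | zero => simp
      | add y y' hy hy' => simp only [map_add, mul_add, hy, hy']
      | tmul m' p' =>
        rw [BalancedTensor.op_smul_tmul, op_smul_toTwist, twistForm_tmul, twistForm_tmul,
          ← smul_comm, φ.smul_left, Algebra.left_comm]
  smul_right a x y := by
    induction x using twist_induction with
    | zero => simp
    | add x x' hx hx' => simp only [map_add, LinearMap.add_apply, add_mul, hx, hx']
    | tmul m p =>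
      induction y using twist_induction with
      | zero => simp
      | add y y' hy hy' => simp only [smul_add, map_add, add_mul, hy, hy']
      | tmul m' p' =>
        rw [BalancedTensor.op_smul_tmul, op_smul_toTwist, twistForm_tmul, twistForm_tmul,
          φ.smul_right, σ.invol, mul_assoc]
  herm x y := by
    induction x using twist_induction with
    | zero => simp
    | add x x' hx hx' => simp only [map_add, LinearMap.add_apply, mul_add, hx, hx']
    | tmul m p =>
      induction y using twist_induction with
      | zero => simp
      | add y y' hy hy' => simp only [map_add, LinearMap.add_apply, mul_add, hy, hy']
      | tmul m' p' =>
        have hσ : ∀ z : A, σ (algebraMap S A δ * z) = algebraMap S A δ * σ z := fun z => by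
          rcases hδ with rfl | rfl <;> simp
        have hk : op (N.form m m') • p =
            algebraMap S A (δ * ε) • (op (τ (N.form m' m)) • p : ϑ.carrier) := by
          rw [ϑ.central, smul_smul, ← op_mul, ← Algebra.commutes, ← hη, ← N.herm]
        rw [twistForm_tmul, twistForm_tmul, hσ, φ.herm hδ, hk, φ.smul_left, φ.op_smul_left,
          τ.invol, ← mul_assoc, ← mul_assoc, ← mul_assoc, ← map_mul, ← map_mul, ← map_mul,
          mul_left_comm δ δ ε, mul_assoc ε]
        congr 2
        ring

omit hδ in
variable (ϑ) in
/-- The map `(n, q) ↦ (p ↦ n ϑ(q, p))`. -/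
def evalAux (N : HermForm τ d) : N.carrier →ₗ[R] ϑ.Twist →ₗ[R] ϑ.carrier →ₗ[R] N.carrier :=
  LinearMap.mk₂ R
    (fun (n : N.carrier) (q : ϑ.Twist) =>
      ({ toFun := fun p => op (ϑ.form (ϑ.toTwist.symm q) p) • n
         map_add' := fun p p' => by simp [add_smul]
         map_smul' := fun r p => by simp } : ϑ.carrier →ₗ[R] N.carrier))
    (fun m m' q => by ext; simp) (fun r m q => by ext; simp [smul_algebra_smul_comm])
    (fun m q q' => by ext; simp [add_smul]) (fun r m q => by ext; simp)

omit hδ in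
theorem evalAux_apply (N : HermForm τ d) (n : N.carrier) (q p : ϑ.carrier) :
    evalAux ϑ N n (ϑ.toTwist q) p = op (ϑ.form q p) • n := rfl

omit hδ in
theorem isBalanced_evalAux (N : HermForm τ d) :
    BalancedTensor.IsBalanced (A := B) (evalAux ϑ N) := fun m b q => by
  obtain ⟨q, rfl⟩ := ϑ.toTwist.surjective q
  ext p
  rw [smul_toTwist, evalAux_apply, evalAux_apply, ϑ.smul_left, τ.invol, smul_smul, op_mul]

omit hδ in
variable (ϑ) in
/-- The evaluation `(n ⊗ q) ⊗ p ↦ n ϑ(q, p)`. -/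
def eval (N : HermForm τ d) :
    BalancedTensor R B N.carrier ϑ.Twist →ₗ[R] ϑ.carrier →ₗ[R] N.carrier :=
  BalancedTensor.lift (evalAux ϑ N) (isBalanced_evalAux N)

omit hδ in
@[simp]
theorem eval_tmul (N : HermForm τ d) (n : N.carrier) (q p : ϑ.carrier) :
    eval ϑ N (BalancedTensor.tmul R B n (ϑ.toTwist q)) p = op (ϑ.form q p) • n := by
  rw [eval, BalancedTensor.lift_tmul, evalAux_apply]

omit hδ in
theorem isBalanced_eval (N : HermForm τ d) : BalancedTensor.IsBalanced (A := A) (eval ϑ N) :=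
    fun x a p => by
  induction x using twist_induction with
  | zero => simp
  | tmul n q => rw [BalancedTensor.op_smul_tmul, op_smul_toTwist, eval_tmul, eval_tmul, ϑ.admits]
  | add x y hx hy =>
    rw [smul_add, map_add, map_add, LinearMap.add_apply, LinearMap.add_apply, hx, hy]

omit hδ in
theorem eval_op_smul (N : HermForm τ d) (b : B) (x : BalancedTensor R B N.carrier ϑ.Twist)
    (p : ϑ.carrier) : eval ϑ N x (op b • p) = op b • eval ϑ N x p := by
  induction x using twist_induction with
  | zero => simp
  | tmul n q => rw [eval_tmul, eval_tmul, ϑ.smul_right, op_mul, mul_smul]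
  | add x y hx hy => rw [map_add, LinearMap.add_apply, LinearMap.add_apply, hx, hy, smul_add]

include φ

theorem op_smul_eq_smul (p q r : ϑ.carrier) :
    op (τ (ϑ.form q p)) • r = σ (φ.form p r) • q := by
  rw [ϑ.sign_apply hδ, φ.herm hδ, Algebra.commutes, op_mul, mul_smul, mul_smul, φ.assoc,
    ϑ.central]

/-- The evaluation `(n ⊗ q) ⊗ p ↦ n ϑ(q, p)` is an isometry from the image of `N ⊗_B P` to `N`, with
inverse `n ↦ ∑ (n ⊗ q i) ⊗ p i`, where `∑ ϑ(q i, p i) = 1`. -/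
theorem essSurj_moritaFunctor (hη : η = δ * ε) : (ϑ.moritaFunctor (ε := ε) hη).EssSurj where
  mem_essImage N := by
    let F : BalancedTensor R A (BalancedTensor R B N.carrier ϑ.Twist) ϑ.carrier →ₗ[Bᵐᵒᵖ]
        N.carrier :=
      BalancedTensor.liftRight (eval ϑ N) (isBalanced_eval N) fun b x p => eval_op_smul N b x p
    have hF : ∀ x p, F (BalancedTensor.tmul R A x p) = eval ϑ N x p :=
      BalancedTensor.liftRight_tmul _ _ _
    obtain ⟨k, p, q, hpq⟩ := φ.exists_sum_right
    let G : N.carrier → BalancedTensor R A (BalancedTensor R B N.carrier ϑ.Twist) ϑ.carrier :=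
      fun n => ∑ i, BalancedTensor.tmul R A
        (BalancedTensor.tmul R B n (ϑ.toTwist (q i))) (p i)
    have hG : ∀ n n', G (n + n') = G n + G n' := fun n n' => by
      simp only [G, BalancedTensor.add_tmul, Finset.sum_add_distrib]
    have hG0 : G 0 = 0 := by simpa using hG 0 0
    have hFG : ∀ n, F (G n) = n := fun n => by
      simp only [G, map_sum, hF, eval_tmul]
      rw [← Finset.sum_smul, ← Finset.op_sum, hpq, op_one, one_smul]
    have hGF : ∀ x, G (F x) = x := fun x => by
      induction x using BalancedTensor.induction_on with
      | zero => rw [map_zero, hG0]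
      | add x y hx hy => rw [map_add, hG, hx, hy]
      | tmul y r =>
        induction y using twist_induction with
        | zero => simp [BalancedTensor.tmul, hG0]
        | add x y hx hy => rw [BalancedTensor.add_tmul, map_add, hG, hx, hy]
        | tmul n s =>
          simp only [hF, eval_tmul, G]
          have : ∀ i, BalancedTensor.tmul R A (BalancedTensor.tmul R B
              (op (ϑ.form s r) • n) (ϑ.toTwist (q i))) (p i) =
              BalancedTensor.tmul R A (BalancedTensor.tmul R B n (ϑ.toTwist s))
                (op (ϑ.form (q i) (p i)) • r) := fun i => by
            rw [BalancedTensor.smul_tmul, smul_toTwist, φ.op_smul_eq_smul hδ, ← op_smul_toTwist,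
              ← BalancedTensor.op_smul_tmul, BalancedTensor.smul_tmul, φ.assoc]
          simp only [this]
          rw [← BalancedTensor.tmul_sum, ← Finset.sum_smul, ← Finset.op_sum, hpq, op_one,
            one_smul]
    have hbij : Function.Bijective F :=
      ⟨Function.LeftInverse.injective hGF, Function.RightInverse.surjective hFG⟩
    refine ⟨φ.twistObj hδ hη N, ⟨HermForm.Isometry.toIso
      ⟨LinearEquiv.ofBijective F hbij, fun x y => ?_⟩⟩⟩
    have key : N.form.compl₁₂ (F.restrictScalars R) (F.restrictScalars R) =
        ϑ.prodForm (φ.twistObj hδ hη N) := by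
      refine BalancedTensor.bilin_ext fun x p y p' => ?_
      refine Eq.trans ?_ (ϑ.prodForm_tmul (φ.twistObj hδ hη N) x y p p').symm
      change N.form (F _) (F _) = ϑ.form p (φ.twistForm N x y • p')
      rw [hF, hF]
      induction x using twist_induction with
      | zero => simp
      | add x x' hx hx' => simp only [map_add, LinearMap.add_apply, add_smul, hx, hx']
      | tmul n s =>
        induction y using twist_induction with
        | zero => simp
        | add y y' hy hy' => simp only [map_add, LinearMap.add_apply, add_smul, hy, hy']
        | tmul n' s' =>
          rw [twistForm_tmul, eval_tmul, eval_tmul, N.smul_left, N.smul_right, mul_smul, φ.assoc,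
            ϑ.central, ϑ.smul_right, ϑ.smul_right, ϑ.smul_right, ϑ.sign_apply hδ,
            ← Algebra.commutes, mul_assoc, mul_assoc]
    exact LinearMap.congr_fun₂ key x y

/-- An admitting form with a companion defines a hermitian Morita equivalence. -/
theorem isHermitianMorita (hη : η = δ * ε) : IsHermitianMorita (ϑ.moritaFunctor (ε := ε) hη) where
  isEquivalence :=
    { faithful := φ.faithful_moritaFunctor hη
      full := φ.full_moritaFunctor hη
      essSurj := φ.essSurj_moritaFunctor hδ hη }
  orthSum := ϑ.nonempty_orthSum_iso hη
  nonsingular _ := φ.nonsingular_prodObj hδ hη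
  hyperbolic _ := φ.hyperbolic_prodObj hδ hη

end Equivalence

end Companion

end AdmittingForm

end MoritaContext

/-! ### Dual bases of nonsingular forms, and scalar extension of nonsingular forms -/

section Nonsingular

namespace BalancedTensor

variable {R A : Type u} [CommRing R] [Ring A] [Algebra R A]
  {M : Type u} [AddCommGroup M] [Module R M] [Module Aᵐᵒᵖ M] [IsScalarTower R Aᵐᵒᵖ M]
  {P : Type u} [AddCommGroup P] [Module R P] [Module A P] [IsScalarTower R A P]

@[simp]
theorem tmul_zero (m : M) : tmul R A m (0 : P) = 0 := by simp [tmul]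

@[simp]
theorem zero_tmul (p : P) : tmul R A (0 : M) p = 0 := by simp [tmul]

theorem tmul_smul_base (r : R) (m : M) (p : P) : tmul R A m (r • p) = r • tmul R A m p := by
  simp [tmul]

theorem smul_base_tmul (r : R) (m : M) (p : P) : tmul R A (r • m) p = r • tmul R A m p := by
  rw [tmul, ← TensorProduct.smul_tmul', map_smul, tmul]

end BalancedTensor

theorem finite_projective_op_self (A : Type u) [Ring A] :
    Module.Finite Aᵐᵒᵖ A ∧ Module.Projective Aᵐᵒᵖ A :=
  finite_projective_of_dualBasis (ι := Unit) (fun _ => 1)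
    (fun _ => { toFun := op, map_add' := fun _ _ => rfl, map_smul' := fun _ _ => rfl })
    fun m => by simp

instance (A : Type u) [Ring A] : Module.Finite Aᵐᵒᵖ A := (finite_projective_op_self A).1

instance (A : Type u) [Ring A] : Module.Projective Aᵐᵒᵖ A := (finite_projective_op_self A).2

variable {R A : Type u} [CommRing R] [Ring A] [Algebra R A] {σ : AlgInvolution R A} {e : A}

namespace HermForm

theorem Nonsingular.exists_form_eq {X : HermForm σ e} (hX : X.Nonsingular)
    (f : X.carrier →ₗ[Aᵐᵒᵖ] A) : ∃ x, ∀ y, X.form x y = f y := by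
  obtain ⟨x, hx⟩ := hX.2 f
  exact ⟨x, fun y => LinearMap.congr_fun hx y⟩

theorem Nonsingular.exists_dualBasis {X : HermForm σ e} (hX : X.Nonsingular) :
    ∃ (n : ℕ) (p q : Fin n → X.carrier), ∀ x, ∑ j, op (X.form (q j) x) • p j = x := by
  obtain ⟨n, p, f, hf⟩ := _root_.exists_dualBasis Aᵐᵒᵖ X.carrier
  have : ∀ j, ∃ q, ∀ y, X.form q y = unop (f j y) := fun j =>
    hX.exists_form_eq
      { toFun := fun y => unop (f j y)
        map_add' := fun y z => by simp
        map_smul' := fun a y => by simp }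
  choose q hq using this
  exact ⟨n, p, q, fun x => by simp only [hq, op_unop, hf]⟩

/-- A form is nonsingular if (and, by `Nonsingular.exists_dualBasis`, only if) its module has a dual
basis whose functionals are represented by the form. -/
theorem nonsingular_of_dualBasis {X : HermForm σ e} {ι : Type*} [Fintype ι] (p q : ι → X.carrier)
    (h : ∀ x, ∑ j, op (X.form (q j) x) • p j = x) : X.Nonsingular := by
  refine ⟨fun x y hxy => ?_, fun f => ⟨∑ j, op (σ (f (p j))) • q j, ?_⟩⟩
  · have h0 : ∀ z, X.form (x - y) z = 0 := fun z => by
      rw [map_sub, LinearMap.sub_apply]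
      exact sub_eq_zero.2 (LinearMap.congr_fun hxy z)
    rw [← sub_eq_zero, ← h (x - y)]
    refine Finset.sum_eq_zero fun j _ => ?_
    rw [X.herm, h0, map_zero, mul_zero, op_zero, zero_smul]
  · ext x
    change X.form _ x = f x
    conv_rhs => rw [← h x, map_sum]
    simp only [map_sum, LinearMap.sum_apply, X.smul_left, σ.invol, map_smul]
    rfl

theorem Nonsingular.scalarExt (T : Type u) [CommRing T] [Algebra R T] {X : HermForm σ e}
    (hX : X.Nonsingular) : (X.scalarExt T).Nonsingular := by
  obtain ⟨n, p, q, h⟩ := hX.exists_dualBasis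
  refine nonsingular_of_dualBasis (X := X.scalarExt T) (fun j => (1 : T) ⊗ₜ[R] p j)
    (fun j => (1 : T) ⊗ₜ[R] q j) fun x => ?_
  letI := scalarExtRight R T A X.carrier
  change T ⊗[R] X.carrier at x
  induction x using TensorProduct.induction_on with
  | zero => simp
  | add x y hx hy =>
    simp only [map_add, MulOpposite.op_add, add_smul, Finset.sum_add_distrib] at *
    rw [hx, hy]
  | tmul t x =>
    have : ∀ j, op ((X.scalarExt T).form ((1 : T) ⊗ₜ[R] q j) (t ⊗ₜ[R] x)) • ((1 : T) ⊗ₜ[R] p j) =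
        t ⊗ₜ[R] (op (X.form (q j) x) • p j) := fun j => by
      rw [HermForm.scalarExt_form_tmul, scalarExtRight_smul_tmul, one_mul, mul_one]
    simp only [this]
    rw [← TensorProduct.tmul_sum, h]

/-- The zero form on a finitely generated projective right module. -/
def ofZero (σ : AlgInvolution R A) (e : A) (M : Type u) [AddCommGroup M] [Module R M]
    [Module Aᵐᵒᵖ M] [IsScalarTower R Aᵐᵒᵖ M] [Module.Finite Aᵐᵒᵖ M] [Module.Projective Aᵐᵒᵖ M] :
    HermForm σ e where
  carrier := M
  form := 0
  smul_left := by simp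
  smul_right := by simp
  herm := by simp

end HermForm

end Nonsingular

/-! ### Hermitian Morita equivalences come from Morita contexts -/

section MoritaContext

variable {R A B S : Type u} [CommRing R] [Ring A] [Algebra R A] [Ring B] [Algebra R B]
  [CommRing S] [Algebra S A] [Algebra S B]
  {σ : AlgInvolution R A} {τ : AlgInvolution R B}

namespace AdmittingForm

theorem prodForm_ofZero {d : B} (ϑ : AdmittingForm S σ τ d) (e : A) (M : Type u) [AddCommGroup M]
    [Module R M] [Module Aᵐᵒᵖ M] [IsScalarTower R Aᵐᵒᵖ M] [Module.Finite Aᵐᵒᵖ M]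
    [Module.Projective Aᵐᵒᵖ M] : ϑ.prodForm (HermForm.ofZero σ e M) = 0 :=
  BalancedTensor.bilin_ext fun m p m' p' => by
    rw [prodForm_tmul]
    change ϑ.form p ((0 : A) • p') = 0
    simp

section Equivalence

variable {δ ε η : S} (ϑ : AdmittingForm S σ τ (algebraMap S B δ)) (hη : η = δ * ε)

section Zero

variable (M : Type u) [AddCommGroup M] [Module R M] [Module Aᵐᵒᵖ M] [IsScalarTower R Aᵐᵒᵖ M]
  [Module.Finite Aᵐᵒᵖ M] [Module.Projective Aᵐᵒᵖ M]

/-- Every automorphism of `M` is an isometry of the zero form on `M`, to which faithfulness of `F_ϑ`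
applies. -/
theorem eq_refl_of_tmul_eq [h : (ϑ.moritaFunctor (ε := ε) hη).Faithful] (f : M ≃ₗ[Aᵐᵒᵖ] M)
    (hf : ∀ m (p : ϑ.carrier), BalancedTensor.tmul R A (f m) p = BalancedTensor.tmul R A m p) :
    f = LinearEquiv.refl Aᵐᵒᵖ M := by
  have h1 : BalancedTensor.mapEquiv R A (P := ϑ.carrier) (B := B) f =
      BalancedTensor.mapEquiv R A (LinearEquiv.refl Aᵐᵒᵖ M) := by
    refine LinearEquiv.ext fun y => ?_
    induction y using BalancedTensor.induction_on with
    | zero => simp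
    | add y z hy hz => rw [map_add, map_add, hy, hz]
    | tmul m p => rw [BalancedTensor.mapEquiv_tmul, BalancedTensor.mapEquiv_tmul, hf]; rfl
  let X : HermForm σ (algebraMap S A ε) := HermForm.ofZero σ _ M
  let g : HermForm.Isometry X X := ⟨f, fun _ _ => rfl⟩
  have hg : g = 𝟙 X := h.map_injective (HermForm.Isometry.ext h1)
  exact congrArg HermForm.Isometry.toEquiv hg

theorem exists_tmul_eq [h : (ϑ.moritaFunctor (ε := ε) hη).Full]
    (G : BalancedTensor R A M ϑ.carrier ≃ₗ[Bᵐᵒᵖ] BalancedTensor R A M ϑ.carrier) :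
    ∃ f : M ≃ₗ[Aᵐᵒᵖ] M, ∀ m (p : ϑ.carrier),
      BalancedTensor.tmul R A (f m) p = G (BalancedTensor.tmul R A m p) := by
  let X : HermForm σ (algebraMap S A ε) := HermForm.ofZero σ _ M
  let G' : HermForm.Isometry ((ϑ.moritaFunctor hη).obj X) ((ϑ.moritaFunctor hη).obj X) :=
    ⟨G, fun x y => by
      change ϑ.prodForm X _ _ = ϑ.prodForm X _ _
      rw [show ϑ.prodForm X = 0 from ϑ.prodForm_ofZero _ _]
      rfl⟩
  obtain ⟨f, hf⟩ := h.map_surjective (X := X) (Y := X) G'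
  have h1 : BalancedTensor.mapEquiv R A (P := ϑ.carrier) (B := B)
      (HermForm.Isometry.toEquiv f : M ≃ₗ[Aᵐᵒᵖ] M) = G :=
    congrArg HermForm.Isometry.toEquiv hf
  exact ⟨HermForm.Isometry.toEquiv f, fun m p => by
    rw [← h1]; exact (BalancedTensor.mapEquiv_tmul R A _ m p).symm⟩

end Zero

/-- If `F_ϑ` is faithful, then `A` acts faithfully on `P`: an element `a` of the annihilator gives
the unipotent automorphism `(x, y) ↦ (x + a y, y)` of the zero form on `A × A`, which becomes
trivial after tensoring with `P`. -/
theorem eq_zero_of_smul_eq_zero [(ϑ.moritaFunctor (ε := ε) hη).Faithful] {a : A}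
    (ha : ∀ p : ϑ.carrier, a • p = 0) : a = 0 := by
  let f : A → (A × A →ₗ[Aᵐᵒᵖ] A × A) := fun a =>
    { toFun := fun x => (x.1 + a * x.2, x.2)
      map_add' := fun x y => by ext <;> simp [mul_add]; abel
      map_smul' := fun b x => by ext <;> simp [mul_assoc] }
  have hf : ∀ a b, b = -a → f a ∘ₗ f b = LinearMap.id := fun a b hab => by
    exact LinearMap.ext fun x => Prod.ext (by simp [f, hab]) (by simp [f])
  have := ϑ.eq_refl_of_tmul_eq hη (A × A)
    (LinearEquiv.ofLinearMap (f a) (f (-a)) (hf _ _ rfl) (hf _ _ (neg_neg a).symm)) fun m p => by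
      change BalancedTensor.tmul R A ((m.1 + a * m.2, m.2) : A × A) p =
        BalancedTensor.tmul R A m p
      have h : ((m.1 + a * m.2, m.2) : A × A) = m + op (a * m.2) • ((1, 0) : A × A) := by
        ext <;> simp
      rw [h, BalancedTensor.add_tmul, BalancedTensor.smul_tmul, mul_smul, ha]
      simp
  have h1 := congrArg Prod.fst (LinearEquiv.congr_fun this ((0, 1) : A × A))
  change (0 : A) + a * 1 = 0 at h1
  simpa using h1

/-- If `F_ϑ` is full, then every endomorphism of `P` over `B` is given by an element of `A`: it
gives a unipotent automorphism of `(A × A) ⊗_A P`, which comes from an automorphism of `A × A`. -/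
theorem exists_smul_eq [(ϑ.moritaFunctor (ε := ε) hη).Full] (g : ϑ.carrier →ₗ[Bᵐᵒᵖ] ϑ.carrier) :
    ∃ a : A, ∀ p : ϑ.carrier, a • p = g p := by
  let N : BalancedTensor R A (A × A) ϑ.carrier →ₗ[Bᵐᵒᵖ] BalancedTensor R A (A × A) ϑ.carrier :=
    BalancedTensor.liftRight (LinearMap.mk₂ R
      (fun (m : A × A) p => BalancedTensor.tmul R A ((1, 0) : A × A) (g (m.2 • p)))
      (fun m m' p => by simp [add_smul, BalancedTensor.tmul_add])
      (fun r m p => by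
        rw [Prod.smul_snd, smul_assoc, g.map_smul_of_tower, BalancedTensor.tmul_smul_base])
      (fun m p p' => by simp [BalancedTensor.tmul_add])
      (fun r m p => by
        rw [smul_algebra_smul_comm, g.map_smul_of_tower, BalancedTensor.tmul_smul_base]))
      (fun m a p => by simp [mul_smul])
      (fun b m p => by simp [smul_comm])
  have hN : ∀ m p, N (BalancedTensor.tmul R A m p) =
      BalancedTensor.tmul R A ((1, 0) : A × A) (g (m.2 • p)) := BalancedTensor.liftRight_tmul _ _ _
  have hNN : N ∘ₗ N = 0 := BalancedTensor.hom_ext_right fun m p => by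
    rw [LinearMap.comp_apply, hN, hN]; simp
  let K : BalancedTensor R A (A × A) ϑ.carrier →ₗ[R] ϑ.carrier :=
    BalancedTensor.lift (LinearMap.mk₂ R (fun (m : A × A) p => m.1 • p)
      (fun m m' p => by simp [add_smul]) (fun r m p => by simp)
      (fun m p p' => by simp) (fun r m p => by rw [smul_algebra_smul_comm]))
      (fun m a p => by simp [mul_smul])
  have hK : ∀ m p, K (BalancedTensor.tmul R A m p) = m.1 • p := BalancedTensor.lift_tmul _ _
  obtain ⟨f, hf⟩ := ϑ.exists_tmul_eq hη (A × A)
    (LinearEquiv.ofLinearMap (LinearMap.id + N) (LinearMap.id - N)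
      (by simp [LinearMap.add_comp, LinearMap.comp_sub, hNN])
      (by simp [LinearMap.sub_comp, LinearMap.comp_add, hNN]))
  refine ⟨(f (0, 1)).1, fun p => ?_⟩
  have h := congrArg K (hf (0, 1) p)
  change K _ = K (BalancedTensor.tmul R A (0, 1) p + N (BalancedTensor.tmul R A (0, 1) p)) at h
  simpa [hK, hN] using h

/-- If `ϑ` is nonsingular and `F_ϑ` is an equivalence, then `ϑ` has a companion. As `F_ϑ` is fully
faithful, `A` is the endomorphism ring of `P` over `B`, and this defines `φ`. A preimage of the zero
form on `B` gives `X ⊗_A P ≃ B`, and all elements in the image are sums of values of `ϑ`. -/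
theorem nonempty_companion (hϑ : ϑ.Nonsingular)
    (h : (ϑ.moritaFunctor (ε := ε) hη).IsEquivalence) : Nonempty ϑ.Companion := by
  have h1 := h.faithful
  have h2 := h.full
  have h3 := h.essSurj
  have inj : ∀ {a b : A}, (∀ x : ϑ.carrier, a • x = b • x) → a = b := fun {a b} hab =>
    sub_eq_zero.1 (ϑ.eq_zero_of_smul_eq_zero hη fun x => by rw [sub_smul, hab, sub_self])
  have hex : ∀ p q : ϑ.carrier, ∃ a : A, ∀ x : ϑ.carrier, a • x = op (ϑ.form q x) • p :=
    fun p q => ϑ.exists_smul_eq hη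
      { toFun := fun x => op (ϑ.form q x) • p
        map_add' := fun x y => by simp [add_smul]
        map_smul' := fun b x => by
          induction b using MulOpposite.rec' with | _ b
          simp [ϑ.smul_right, mul_smul] }
  choose φ hφ using hex
  obtain ⟨n, p, q, hpq⟩ := HermForm.Nonsingular.exists_dualBasis hϑ
  refine ⟨⟨LinearMap.mk₂ R φ (fun p p' q => inj fun x => ?_) (fun r p q => inj fun x => ?_)
    (fun p q q' => inj fun x => ?_) (fun r p q => inj fun x => ?_), fun a p q => inj fun x => ?_,
    hφ, ⟨n, p, q, inj fun x => ?_⟩, ?_⟩⟩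
  · simp [add_smul, hφ]
  · rw [smul_assoc, hφ, hφ, smul_algebra_smul_comm]
  · simp [add_smul, hφ]
  · rw [smul_assoc, hφ, hφ]; simp
  · simp only [LinearMap.mk₂_apply]
    rw [mul_smul, hφ, hφ]
    exact (smul_comm a _ p).symm
  · simp only [LinearMap.mk₂_apply, Finset.sum_smul, hφ, hpq, one_smul]
  · obtain ⟨X, ⟨i⟩⟩ := h3.mem_essImage (HermForm.ofZero τ (algebraMap S B η) B)
    let ψ : BalancedTensor R A X.carrier ϑ.carrier ≃ₗ[Bᵐᵒᵖ] B := HermForm.Isometry.toEquiv i.hom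
    have key : ∀ y : BalancedTensor R A X.carrier ϑ.carrier,
        ∃ (k : ℕ) (p q : Fin k → ϑ.carrier), ∑ j, ϑ.form (q j) (p j) = ψ y := by
      intro y
      induction y using BalancedTensor.induction_on with
      | zero => exact ⟨0, Fin.elim0, Fin.elim0, by simp⟩
      | add y z hy hz =>
        obtain ⟨k, p, q, h⟩ := hy
        obtain ⟨k', p', q', h'⟩ := hz
        refine ⟨k + k', Fin.append p p', Fin.append q q', ?_⟩
        rw [Fin.sum_univ_add, map_add]
        simp [h, h']
      | tmul m p =>
        obtain ⟨q, hq⟩ := hϑ.exists_form_eq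
          { toFun := fun x => ψ (BalancedTensor.tmul R A m x)
            map_add' := fun x y => by rw [BalancedTensor.tmul_add, map_add]
            map_smul' := fun b x => by
              rw [← BalancedTensor.op_smul_tmul, map_smul, RingHom.id_apply] }
        exact ⟨1, fun _ => p, fun _ => q, by simpa using hq p⟩
    obtain ⟨y, hy⟩ := ψ.surjective 1
    simpa only [hy] using key y

end Equivalence

/-- The scalar extension of a companion of `ϑ` is a companion of `ϑ_T`. -/
theorem Companion.nonempty_scalarExt [Algebra R S] [IsScalarTower R S A] [IsScalarTower R S B]
    (T : Type u) [CommRing T] [Algebra R T] {δ : S} {ϑ : AdmittingForm S σ τ (algebraMap S B δ)}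
    (φ : ϑ.Companion) : Nonempty (ϑ.scalarExt T).Companion := by
  letI := scalarExtLeft R T A ϑ.carrier
  letI := scalarExtRight R T B ϑ.carrier
  have hφ : ∀ t t' p p', LinearMap.BilinMap.baseChange T φ.form (t ⊗ₜ[R] p) (t' ⊗ₜ[R] p') =
      (t * t') ⊗ₜ[R] φ.form p p' := fun t t' p p' => by simp
  have h1 : ∀ (a : T ⊗[R] A) (p q : T ⊗[R] ϑ.carrier),
      LinearMap.BilinMap.baseChange T φ.form (a • p) q =
        a * LinearMap.BilinMap.baseChange T φ.form p q := by
    intro a p q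
    induction p using TensorProduct.induction_on with
    | zero => simp
    | add p p' hp hp' => simp only [smul_add, map_add, LinearMap.add_apply, mul_add, hp, hp']
    | tmul t p =>
      induction q using TensorProduct.induction_on with
      | zero => simp
      | add q q' hq hq' => simp only [map_add, mul_add, hq, hq']
      | tmul t' q =>
        induction a using TensorProduct.induction_on with
        | zero => simp
        | add a a' ha ha' => simp only [add_smul, map_add, LinearMap.add_apply, add_mul, ha, ha']
        | tmul u a =>
          rw [scalarExtLeft_smul_tmul, hφ, hφ, φ.smul_left, Algebra.TensorProduct.tmul_mul_tmul,
            mul_assoc]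
  have h2 : ∀ (p q x : T ⊗[R] ϑ.carrier),
      LinearMap.BilinMap.baseChange T φ.form p q • x =
        op (LinearMap.BilinMap.baseChange T ϑ.form q x) • p := by
    intro p q x
    induction p using TensorProduct.induction_on with
    | zero => simp
    | add p p' hp hp' => simp only [smul_add, map_add, LinearMap.add_apply, add_smul, hp, hp']
    | tmul t p =>
      induction q using TensorProduct.induction_on with
      | zero => simp
      | add q q' hq hq' =>
        simp only [map_add, LinearMap.add_apply, add_smul, MulOpposite.op_add, hq, hq']
      | tmul t' q =>
        induction x using TensorProduct.induction_on with
        | zero => simp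
        | add a a' ha ha' => simp only [smul_add, map_add, add_smul, MulOpposite.op_add, ha, ha']
        | tmul u x =>
          rw [hφ, LinearMap.BilinMap.baseChange_tmul, scalarExtLeft_smul_tmul,
            scalarExtRight_smul_tmul, φ.assoc]
          congr 1
          ring
  obtain ⟨k, p, q, hpq⟩ := φ.exists_sum_left
  obtain ⟨l, p', q', hpq'⟩ := φ.exists_sum_right
  have h3 : ∑ j, LinearMap.BilinMap.baseChange T φ.form ((1 : T) ⊗ₜ[R] p j) ((1 : T) ⊗ₜ[R] q j) =
      1 := by
    simp only [hφ, mul_one]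
    rw [← TensorProduct.tmul_sum, hpq, Algebra.TensorProduct.one_def]
  have h4 : ∑ j, LinearMap.BilinMap.baseChange T ϑ.form ((1 : T) ⊗ₜ[R] q' j)
      ((1 : T) ⊗ₜ[R] p' j) = 1 := by
    simp only [LinearMap.BilinMap.baseChange_tmul, mul_one]
    rw [← TensorProduct.tmul_sum, hpq', Algebra.TensorProduct.one_def]
  exact ⟨⟨LinearMap.BilinMap.baseChange T φ.form, h1, h2, ⟨k, _, _, h3⟩, ⟨l, _, _, h4⟩⟩⟩

end AdmittingForm

end MoritaContext

/-! ### Scalar extension commutes with the functors of admitting forms -/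

section ScalarExtTensor

attribute [local instance] scalarExtRight scalarExtLeft scalarExtRight_tower scalarExtLeft_tower
  scalarExt_smulComm

variable {R : Type u} [CommRing R] (T : Type u) [CommRing T] [Algebra R T]

/-- The `T`-bilinear extension of an `R`-bilinear map. -/
def bilinBaseChange {M P N : Type u} [AddCommGroup M] [Module R M] [AddCommGroup P] [Module R P]
    [AddCommGroup N] [Module R N] (f : M →ₗ[R] P →ₗ[R] N) :
    T ⊗[R] M →ₗ[T] T ⊗[R] P →ₗ[T] T ⊗[R] N :=
  LinearMap.liftBaseChange T (LinearMap.baseChangeHom R T P N ∘ₗ f)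

theorem bilinBaseChange_tmul {M P N : Type u} [AddCommGroup M] [Module R M] [AddCommGroup P]
    [Module R P] [AddCommGroup N] [Module R N] (f : M →ₗ[R] P →ₗ[R] N) (t t' : T) (m : M) (p : P) :
    bilinBaseChange T f (t ⊗ₜ m) (t' ⊗ₜ p) = (t * t') ⊗ₜ f m p := by
  simp [bilinBaseChange, TensorProduct.smul_tmul']

variable {A B : Type u} [Ring A] [Algebra R A] [Ring B] [Algebra R B]
  (M : Type u) [AddCommGroup M] [Module R M] [Module Aᵐᵒᵖ M] [IsScalarTower R Aᵐᵒᵖ M]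
  (P : Type u) [AddCommGroup P] [Module R P] [Module A P] [IsScalarTower R A P]

theorem isBalanced_bilinBaseChange :
    BalancedTensor.IsBalanced (R := T) (A := T ⊗[R] A)
      (bilinBaseChange T (BalancedTensor.mk R A M P)) := fun m a p => by
  induction m using TensorProduct.induction_on with
  | zero => simp
  | add m m' hm hm' => simp only [smul_add, map_add, LinearMap.add_apply, hm, hm']
  | tmul t m =>
    induction p using TensorProduct.induction_on with
    | zero => simp
    | add p p' hp hp' => simp only [smul_add, map_add, hp, hp']
    | tmul t' p =>
      induction a using TensorProduct.induction_on with
      | zero => simp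
      | add a a' ha ha' =>
        simp only [MulOpposite.op_add, add_smul, map_add, LinearMap.add_apply, ha, ha']
      | tmul u a =>
        rw [scalarExtRight_smul_tmul, scalarExtLeft_smul_tmul, bilinBaseChange_tmul,
          bilinBaseChange_tmul, BalancedTensor.mk_apply, BalancedTensor.mk_apply,
          BalancedTensor.smul_tmul, mul_left_comm, mul_assoc]

/-- The canonical map `(T ⊗ M) ⊗_{T ⊗ A} (T ⊗ P) → T ⊗ (M ⊗_A P)`. -/
def scalarExtTensor :
    BalancedTensor T (T ⊗[R] A) (T ⊗[R] M) (T ⊗[R] P) →ₗ[T] T ⊗[R] BalancedTensor R A M P :=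
  BalancedTensor.lift (bilinBaseChange T (BalancedTensor.mk R A M P))
    (isBalanced_bilinBaseChange T M P)

theorem scalarExtTensor_tmul (t t' : T) (m : M) (p : P) :
    scalarExtTensor (A := A) T M P (BalancedTensor.tmul T (T ⊗[R] A) (t ⊗ₜ[R] m) (t' ⊗ₜ[R] p)) =
      (t * t') ⊗ₜ BalancedTensor.tmul R A m p := by
  rw [scalarExtTensor, BalancedTensor.lift_tmul, bilinBaseChange_tmul, BalancedTensor.mk_apply]

variable {M P} in
theorem BalancedTensor.scalarExt_induction
    {motive : BalancedTensor T (T ⊗[R] A) (T ⊗[R] M) (T ⊗[R] P) → Prop}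
    (x : BalancedTensor T (T ⊗[R] A) (T ⊗[R] M) (T ⊗[R] P)) (zero : motive 0)
    (tmul : ∀ t m t' p, motive (tmul T (T ⊗[R] A) (t ⊗ₜ[R] m) (t' ⊗ₜ[R] p)))
    (add : ∀ x y, motive x → motive y → motive (x + y)) : motive x := by
  induction x using BalancedTensor.induction_on with
  | zero => exact zero
  | add x y hx hy => exact add x y hx hy
  | tmul m p =>
    induction m using TensorProduct.induction_on with
    | zero => simpa using zero
    | add m m' hm hm' => rw [BalancedTensor.add_tmul]; exact add _ _ hm hm'
    | tmul t m =>
      induction p using TensorProduct.induction_on with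
      | zero => simpa using zero
      | add m m' hm hm' => rw [BalancedTensor.tmul_add]; exact add _ _ hm hm'
      | tmul t' p => exact tmul t m t' p

variable {M P} in
theorem BalancedTensor.scalarExt_bilin_ext {N : Type u} [AddCommGroup N] [Module T N]
    {f g : BalancedTensor T (T ⊗[R] A) (T ⊗[R] M) (T ⊗[R] P) →ₗ[T]
      BalancedTensor T (T ⊗[R] A) (T ⊗[R] M) (T ⊗[R] P) →ₗ[T] N}
    (h : ∀ t m t' p u m' u' p',
      f (tmul T (T ⊗[R] A) (t ⊗ₜ[R] m) (t' ⊗ₜ[R] p))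
          (tmul T (T ⊗[R] A) (u ⊗ₜ[R] m') (u' ⊗ₜ[R] p')) =
      g (tmul T (T ⊗[R] A) (t ⊗ₜ[R] m) (t' ⊗ₜ[R] p))
          (tmul T (T ⊗[R] A) (u ⊗ₜ[R] m') (u' ⊗ₜ[R] p'))) :
    f = g := by
  refine LinearMap.ext₂ fun x y => ?_
  induction x using BalancedTensor.scalarExt_induction with
  | zero => simp
  | add x x' hx hx' => simp only [map_add, LinearMap.add_apply, hx, hx']
  | tmul t m t' p =>
    induction y using BalancedTensor.scalarExt_induction with
    | zero => simp
    | add y y' hy hy' => simp only [map_add, hy, hy']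
    | tmul u m' u' p' => exact h t m t' p u m' u' p'

/-- The inverse is `t ⊗ (m ⊗ p) ↦ (t ⊗ m) ⊗ (1 ⊗ p)`. -/
theorem scalarExtTensor_bijective :
    Function.Bijective (scalarExtTensor (R := R) (A := A) T M P) := by
  letI : Module R (BalancedTensor T (T ⊗[R] A) (T ⊗[R] M) (T ⊗[R] P)) :=
    Module.compHom _ (algebraMap R T)
  have hr : ∀ (r : R) (x : BalancedTensor T (T ⊗[R] A) (T ⊗[R] M) (T ⊗[R] P)),
    r • x = algebraMap R T r • x := fun _ _ => rfl
  let G : T → BalancedTensor R A M P →ₗ[R]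
      BalancedTensor T (T ⊗[R] A) (T ⊗[R] M) (T ⊗[R] P) := fun t =>
    BalancedTensor.lift (LinearMap.mk₂ R
      (fun m p => BalancedTensor.tmul T (T ⊗[R] A) (t ⊗ₜ[R] m) ((1 : T) ⊗ₜ[R] p))
      (fun m m' p => by rw [TensorProduct.tmul_add, BalancedTensor.add_tmul])
      (fun r m p => by
        rw [hr, ← BalancedTensor.smul_base_tmul, algebraMap_smul, TensorProduct.tmul_smul])
      (fun m p p' => by rw [TensorProduct.tmul_add, BalancedTensor.tmul_add])
      (fun r m p => by
        rw [hr, ← BalancedTensor.tmul_smul_base, algebraMap_smul, TensorProduct.tmul_smul]))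
      (fun m a p => by
        simp only [LinearMap.mk₂_apply]
        have h1 : t ⊗ₜ[R] (op a • m) = op ((1 : T) ⊗ₜ[R] a) • (t ⊗ₜ[R] m) := by
          rw [scalarExtRight_smul_tmul, one_mul]
        have h2 : (1 : T) ⊗ₜ[R] (a • p) = ((1 : T) ⊗ₜ[R] a) • ((1 : T) ⊗ₜ[R] p) := by
          rw [scalarExtLeft_smul_tmul, one_mul]
        rw [h1, h2, BalancedTensor.smul_tmul])
  have hG : ∀ t m p, G t (BalancedTensor.tmul R A m p) =
      BalancedTensor.tmul T (T ⊗[R] A) (t ⊗ₜ[R] m) ((1 : T) ⊗ₜ[R] p) := fun t m p =>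
    BalancedTensor.lift_tmul _ _ _ _
  let G' : T ⊗[R] BalancedTensor R A M P →ₗ[R]
      BalancedTensor T (T ⊗[R] A) (T ⊗[R] M) (T ⊗[R] P) :=
    TensorProduct.lift
      { toFun := G
        map_add' := fun t t' => BalancedTensor.hom_ext fun m p => by
          rw [LinearMap.add_apply, hG, hG, hG, TensorProduct.add_tmul, BalancedTensor.add_tmul]
        map_smul' := fun r t => BalancedTensor.hom_ext fun m p => by
          rw [RingHom.id_apply, LinearMap.smul_apply, hG, hG, hr,
            ← BalancedTensor.smul_base_tmul, algebraMap_smul, TensorProduct.smul_tmul'] }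
  have hG' : ∀ t x, G' (t ⊗ₜ x) = G t x := fun t x => rfl
  have left : ∀ x, G' (scalarExtTensor T M P x) = x := fun x => by
    induction x using BalancedTensor.scalarExt_induction with
    | zero => simp
    | add x y hx hy => rw [map_add, map_add, hx, hy]
    | tmul t m t' p =>
      rw [scalarExtTensor_tmul, hG', hG, mul_comm, ← smul_eq_mul, ← TensorProduct.smul_tmul',
        BalancedTensor.smul_base_tmul, ← BalancedTensor.tmul_smul_base, TensorProduct.smul_tmul',
        smul_eq_mul, mul_one]
  refine ⟨Function.LeftInverse.injective left, fun y => ?_⟩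
  induction y using TensorProduct.induction_on with
  | zero => exact ⟨0, map_zero _⟩
  | add x y hx hy =>
    obtain ⟨x, rfl⟩ := hx
    obtain ⟨y, rfl⟩ := hy
    exact ⟨x + y, map_add _ _ _⟩
  | tmul t x =>
    induction x using BalancedTensor.induction_on with
    | zero => exact ⟨0, by simp⟩
    | add x y hx hy =>
      obtain ⟨x, hx⟩ := hx
      obtain ⟨y, hy⟩ := hy
      exact ⟨x + y, by rw [map_add, hx, hy, TensorProduct.tmul_add]⟩
    | tmul m p => exact ⟨_, by rw [scalarExtTensor_tmul T M P t 1, mul_one]⟩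

variable [Module Bᵐᵒᵖ P] [IsScalarTower R Bᵐᵒᵖ P] [SMulCommClass A Bᵐᵒᵖ P]

/-- The canonical isomorphism `(T ⊗ M) ⊗_{T ⊗ A} (T ⊗ P) ≃ T ⊗ (M ⊗_A P)` of right modules over
`T ⊗ B`. -/
noncomputable def scalarExtTensorEquiv :
    BalancedTensor T (T ⊗[R] A) (T ⊗[R] M) (T ⊗[R] P) ≃ₗ[(T ⊗[R] B)ᵐᵒᵖ]
      T ⊗[R] BalancedTensor R A M P :=
  LinearEquiv.ofBijective
    { scalarExtTensor (R := R) (A := A) T M P with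
      map_smul' := fun b x => by
        change scalarExtTensor T M P (b • x) = b • scalarExtTensor T M P x
        induction b using MulOpposite.rec' with | _ b
        induction x using BalancedTensor.scalarExt_induction with
        | zero => simp
        | add x y hx hy => rw [smul_add, map_add, map_add, smul_add, hx, hy]
        | tmul t m t' p =>
          rw [BalancedTensor.op_smul_tmul]
          induction b using TensorProduct.induction_on with
          | zero => simp
          | add b c hb hc =>
            rw [MulOpposite.op_add, add_smul, add_smul, BalancedTensor.tmul_add, map_add, hb, hc]
          | tmul u b =>
            rw [scalarExtRight_smul_tmul, scalarExtTensor_tmul, scalarExtTensor_tmul,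
              scalarExtRight_smul_tmul, BalancedTensor.op_smul_tmul, mul_left_comm] }
    (scalarExtTensor_bijective T M P)

end ScalarExtTensor

section ScalarExtFunctor

variable {R : Type u} [CommRing R] (T : Type u) [CommRing T] [Algebra R T] {A : Type u} [Ring A]
  [Algebra R A] {σ : AlgInvolution R A}
  {S : Type u} {B : Type u} [CommRing S] [Algebra R S] [Algebra S A] [IsScalarTower R S A]
  [Ring B] [Algebra R B] [Algebra S B] [IsScalarTower R S B] {τ : AlgInvolution R B}

namespace AdmittingForm

attribute [local instance] scalarExtRight scalarExtLeft scalarExtRight_tower scalarExtLeft_tower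
  scalarExt_smulComm

theorem scalarExt_prodForm_tmul {δ ε : S} (ϑ : AdmittingForm S σ τ (algebraMap S B δ))
    (X : HermForm σ (algebraMap S A ε)) (t t' u u' : T) (m m' : X.carrier) (p p' : ϑ.carrier) :
    (ϑ.scalarExt T).prodForm (X.scalarExt T)
        (BalancedTensor.tmul T (T ⊗[R] A) (t ⊗ₜ[R] m) (t' ⊗ₜ[R] p))
        (BalancedTensor.tmul T (T ⊗[R] A) (u ⊗ₜ[R] m') (u' ⊗ₜ[R] p')) =
      (t * t' * (u * u')) ⊗ₜ[R] ϑ.form p (X.form m m' • p') := by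
  refine Eq.trans (prodForm_tmul (ϑ.scalarExt T) (X.scalarExt T) _ _ _ _) ?_
  change LinearMap.BilinMap.baseChange T ϑ.form (t' ⊗ₜ[R] p)
    (LinearMap.BilinMap.baseChange T X.form (t ⊗ₜ[R] m) (u ⊗ₜ[R] m') • (u' ⊗ₜ[R] p')) = _
  rw [LinearMap.BilinMap.baseChange_tmul, scalarExtLeft_smul_tmul,
    LinearMap.BilinMap.baseChange_tmul]
  congr 1
  ring

theorem scalarExt_prodForm {δ ε : S} (ϑ : AdmittingForm S σ τ (algebraMap S B δ))
    (X : HermForm σ (algebraMap S A ε)) :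
    (LinearMap.BilinMap.baseChange T (ϑ.prodForm X)).compl₁₂
        (scalarExtTensor (A := A) T X.carrier ϑ.carrier)
        (scalarExtTensor (A := A) T X.carrier ϑ.carrier) =
      (ϑ.scalarExt T).prodForm (X.scalarExt T) :=
  BalancedTensor.scalarExt_bilin_ext T fun t m t' p u m' u' p' => by
    refine Eq.trans ?_ (ϑ.scalarExt_prodForm_tmul T X t t' u u' m m' p p').symm
    rw [LinearMap.compl₁₂_apply, scalarExtTensor_tmul, scalarExtTensor_tmul,
      LinearMap.BilinMap.baseChange_tmul, prodForm_tmul]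

/-- The isometries `(T ⊗ M) ⊗_{T ⊗ A} (T ⊗ P) ≃ T ⊗ (M ⊗_A P)` are natural. -/
theorem nonempty_scalarExt_iso {δ ε : S} (ϑ : AdmittingForm S σ τ (algebraMap S B δ)) :
    Nonempty (scalarExtFunctor T S σ ε ⋙
        (ϑ.scalarExt T).moritaFunctor (scalarExt_sign (R := R) T δ ε) ≅
      ϑ.moritaFunctor (rfl : δ * ε = δ * ε) ⋙ scalarExtFunctor T S τ (δ * ε)) := by
  refine ⟨NatIso.ofComponents (fun X => HermForm.Isometry.toIso
    ⟨scalarExtTensorEquiv (A := A) (B := B) T X.carrier ϑ.carrier, fun x y =>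
      LinearMap.congr_fun₂ (ϑ.scalarExt_prodForm T X) x y⟩) ?_⟩
  intro X Y f
  refine HermForm.Isometry.ext (LinearEquiv.ext fun x => ?_)
  change BalancedTensor T (T ⊗[R] A) (T ⊗[R] X.carrier) (T ⊗[R] ϑ.carrier) at x
  change scalarExtTensor (A := A) T Y.carrier ϑ.carrier
      (BalancedTensor.mapEquiv T (T ⊗[R] A) (B := T ⊗[R] B) (scalarExtMapEquiv T f.toEquiv) x) =
    scalarExtMapEquiv T (A := B) (BalancedTensor.mapEquiv R A (P := ϑ.carrier) (B := B) f.toEquiv)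
      (scalarExtTensor (A := A) T X.carrier ϑ.carrier x)
  induction x using BalancedTensor.scalarExt_induction with
  | zero => simp
  | add x y hx hy => simp only [map_add, hx, hy]
  | tmul t m t' p =>
    have h : ∀ {M M' : Type u} [AddCommGroup M] [Module R M] [Module Aᵐᵒᵖ M]
      [IsScalarTower R Aᵐᵒᵖ M] [AddCommGroup M'] [Module R M'] [Module Aᵐᵒᵖ M']
      [IsScalarTower R Aᵐᵒᵖ M'] (f : M ≃ₗ[Aᵐᵒᵖ] M') t m,
        scalarExtMapEquiv T f (t ⊗ₜ[R] m) = t ⊗ₜ[R] f m := fun _ _ _ => rfl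
    rw [BalancedTensor.mapEquiv_tmul, scalarExtTensor_tmul, h, scalarExtTensor_tmul]
    change _ = (t * t') ⊗ₜ[R]
      BalancedTensor.mapEquiv R A (B := B) f.toEquiv (BalancedTensor.tmul R A m p)
    rw [BalancedTensor.mapEquiv_tmul]

end AdmittingForm

end ScalarExtFunctor

/-! ### Separability families -/

section Separability

variable {S C : Type u} [CommRing S] [Ring C] [Algebra S C] {ι : Type*} [Fintype ι]

variable (S) in
/-- The families `x`, `y` are the components of a separability idempotent `∑ x i ⊗ y i` of the
`S`-algebra `C`. -/
structure IsSeparabilityFamily (x y : ι → C) : Prop where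
  sum_mul : ∑ i, x i * y i = 1
  balanced : ∀ c : C, ∑ i, (c * x i) ⊗ₜ[S] y i = ∑ i, x i ⊗ₜ[S] (y i * c)

/-- A splitting of the multiplication `C ⊗ Cᵐᵒᵖ → C` maps `1` to a separability idempotent. -/
theorem exists_isSeparabilityFamily (h : IsSeparableAlgebra S C) :
    ∃ (n : ℕ) (x y : Fin n → C), IsSeparabilityFamily S x y := by
  letI : Module (C ⊗[S] Cᵐᵒᵖ) C := instModuleTensorProductMop S C
  have act : ∀ a b c : C, (a ⊗ₜ[S] op b) • c = a * c * b := fun a b c => by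
    change TensorProduct.Algebra.moduleAux _ _ = _
    simp [TensorProduct.Algebra.moduleAux, ← mul_assoc]
  have : Module.Projective (C ⊗[S] Cᵐᵒᵖ) C := h
  obtain ⟨g, hg⟩ := Module.projective_lifting_property
    (LinearMap.toSpanSingleton (C ⊗[S] Cᵐᵒᵖ) C 1) LinearMap.id fun a =>
      ⟨a ⊗ₜ op 1, by rw [LinearMap.toSpanSingleton_apply, act]; simp⟩
  have hg1 : g 1 • (1 : C) = 1 := LinearMap.congr_fun hg 1
  have hcomm : ∀ c : C, (c ⊗ₜ[S] op 1) * g 1 = ((1 : C) ⊗ₜ[S] op c) * g 1 := fun c => by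
    rw [← smul_eq_mul, ← smul_eq_mul, ← map_smul, ← map_smul, act, act]
    simp
  obtain ⟨n, x, y, hxy⟩ := TensorProduct.exists_sum_tmul_eq (g 1)
  refine ⟨n, x, fun i => unop (y i), ?_, fun c => ?_⟩
  · rw [hxy, Finset.sum_smul] at hg1
    rw [← hg1]
    exact Finset.sum_congr rfl fun i _ => by rw [← op_unop (y i), act]; simp
  · have := congrArg (LinearMap.lTensor C (opLinearEquiv S (M := C)).symm.toLinearMap) (hcomm c)
    simpa [hxy, Finset.mul_sum, map_sum] using this

namespace IsSeparabilityFamily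

variable {x y : ι → C}

theorem apply_eq (h : IsSeparabilityFamily S x y) {N : Type*} [AddCommGroup N] [Module S N]
    (f : C →ₗ[S] C →ₗ[S] N) (c : C) : ∑ i, f (c * x i) (y i) = ∑ i, f (x i) (y i * c) := by
  simpa [map_sum] using congrArg (TensorProduct.lift f) (h.balanced c)

/-- A separability family remains one over a larger ring of scalars. -/
theorem tower {R : Type u} [CommRing R] [Algebra R S] [Algebra R C] [IsScalarTower R S C]
    (h : IsSeparabilityFamily R x y) : IsSeparabilityFamily S x y := by
  refine ⟨h.sum_mul, fun c => ?_⟩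
  have := congrArg (TensorProduct.mapOfCompatibleSMul S R S C C) (h.balanced c)
  simpa [map_sum] using this

/-- A projective separable algebra is finitely generated as a module: an element `a` is
`∑ x i * (y i * a)`, and only finitely many functionals of a dual basis, independently of `a`, do
not vanish on the right factors of `∑ x i ⊗ y i * a = ∑ a * x i ⊗ y i`. -/
theorem finite (h : IsSeparabilityFamily S x y) [Module.Projective S C] : Module.Finite S C := by
  classical
  obtain ⟨s, hs⟩ := (Module.projective_def (R := S) (P := C)).1 inferInstance
  have hs' : ∀ a, ((s a).sum fun b r => r • b) = a := fun a =>
    (Finsupp.linearCombination_apply S (s a)).symm.trans (hs a)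
  -- the coordinates of `∑ x i ⊗ y i a = ∑ a x i ⊗ y i` vanish outside the supports of the `y i`
  let F : Finset C := Finset.univ.biUnion fun i => (s (y i)).support
  have hF : ∀ a, ∀ b ∉ F, ∑ i, s (y i * a) b • x i = 0 := fun a b hb => by
    have := h.apply_eq (LinearMap.mk₂ S (fun u v : C => s v b • u)
      (fun u u' v => by simp) (fun r u v => by rw [smul_comm])
      (fun u v v' => by simp [add_smul]) (fun r u v => by simp [mul_smul])) a
    simp only [LinearMap.mk₂_apply] at this
    rw [← this]
    refine Finset.sum_eq_zero fun i _ => ?_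
    have : s (y i) b = 0 := by
      by_contra hne
      exact hb (Finset.mem_biUnion.2 ⟨i, Finset.mem_univ i, Finsupp.mem_support_iff.2 hne⟩)
    rw [this, zero_smul]
  refine ⟨⟨(Finset.univ ×ˢ F).image fun p : ι × C => x p.1 * p.2, eq_top_iff.2 fun a _ => ?_⟩⟩
  let F' : Finset C := F ∪ Finset.univ.biUnion fun i => (s (y i * a)).support
  have ha : a = ∑ b ∈ F', ∑ i, s (y i * a) b • (x i * b) := by
    rw [Finset.sum_comm]
    calc a = ∑ i, x i * (y i * a) := by
            simp only [← mul_assoc, ← Finset.sum_mul, h.sum_mul, one_mul]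
      _ = _ := Finset.sum_congr rfl fun i _ => by
            conv_lhs => rw [← hs' (y i * a)]
            rw [Finsupp.sum_of_support_subset (s := F') _ (Finset.subset_union_right.trans'
              (Finset.subset_biUnion_of_mem (fun i => (s (y i * a)).support) (Finset.mem_univ i))) _
              (by simp), Finset.mul_sum]
            simp only [mul_smul_comm]
  have ha' : a = ∑ b ∈ F, ∑ i, s (y i * a) b • (x i * b) := by
    refine ha.trans (Finset.sum_subset Finset.subset_union_left fun b _ hb => ?_).symm
    simp only [← smul_mul_assoc, ← Finset.sum_mul, hF a b hb, zero_mul]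
  rw [ha']
  refine Submodule.sum_mem _ fun b hb => Submodule.sum_mem _ fun i _ =>
    Submodule.smul_mem _ _ (Submodule.subset_span ?_)
  simp only [Finset.coe_image]
  exact ⟨(i, b), by simpa using hb, rfl⟩

/-- The map `c ↦ ∑ x i * c * y i` takes values in the centre. -/
theorem sum_mem_center (h : IsSeparabilityFamily S x y) (c : C) :
    ∑ i, x i * c * y i ∈ Subring.center C := by
  refine Subring.mem_center_iff.2 fun d => ?_
  have := h.apply_eq (LinearMap.mk₂ S (fun u v : C => u * c * v)
      (fun u u' v => by simp [add_mul]) (fun r u v => by simp)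
      (fun u v v' => by simp [mul_add]) (fun r u v => by simp)) d
  simp only [LinearMap.mk₂_apply] at this
  rw [Finset.mul_sum, Finset.sum_mul]
  simpa only [mul_assoc] using this

theorem sum_mul_of_mem_center (h : IsSeparabilityFamily S x y) {c : C}
    (hc : c ∈ Subring.center C) : ∑ i, x i * c * y i = c := by
  simp only [Subring.mem_center_iff.1 hc, mul_assoc c, ← Finset.mul_sum, h.sum_mul, mul_one]

theorem baseChange (h : IsSeparabilityFamily S x y) (k : Type u) [CommRing k] [Algebra S k] :
    IsSeparabilityFamily k (fun i => (1 : k) ⊗ₜ[S] x i) (fun i => (1 : k) ⊗ₜ[S] y i) := by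
  refine ⟨?_, fun c => ?_⟩
  · simp only [Algebra.TensorProduct.tmul_mul_tmul, mul_one, ← TensorProduct.tmul_sum, h.sum_mul]
    rfl
  · induction c using TensorProduct.induction_on with
    | zero => simp
    | add c d hc hd =>
      simp only [add_mul, mul_add, TensorProduct.add_tmul, TensorProduct.tmul_add,
        Finset.sum_add_distrib, hc, hd]
    | tmul t c =>
      have := h.apply_eq (LinearMap.mk₂ S (fun u v : C =>
        t • (((1 : k) ⊗ₜ[S] u) ⊗ₜ[k] ((1 : k) ⊗ₜ[S] v) : (k ⊗[S] C) ⊗[k] (k ⊗[S] C)))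
        (fun u u' v => by simp [TensorProduct.tmul_add, TensorProduct.add_tmul])
        (fun r u v => by
          rw [TensorProduct.tmul_smul, ← TensorProduct.smul_tmul', smul_comm])
        (fun u v v' => by simp [TensorProduct.tmul_add])
        (fun r u v => by
          rw [TensorProduct.tmul_smul, TensorProduct.tmul_smul, smul_comm])) c
      simp only [LinearMap.mk₂_apply] at this
      have h1 : ∀ u : C, (t ⊗ₜ[S] u : k ⊗[S] C) = t • ((1 : k) ⊗ₜ[S] u) := fun u => by
        rw [TensorProduct.smul_tmul', smul_eq_mul, mul_one]
      simp only [Algebra.TensorProduct.tmul_mul_tmul, mul_one, one_mul]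
      simp only [h1, TensorProduct.tmul_smul, ← TensorProduct.smul_tmul']
      exact this

end IsSeparabilityFamily

end Separability

/-! ### Separable algebras over a field -/

section Field

variable {k D : Type u} [Field k] [Ring D] [Algebra k D] {ι : Type*} [Fintype ι] {x y : ι → D}

/-- A sub-bimodule of a bimodule over a separable algebra over a field is a direct summand: a linear
projection is made bilinear by averaging it over the separability idempotent on both sides. -/
theorem IsSeparabilityFamily.exists_bimodule_projection (h : IsSeparabilityFamily k x y)
    {V : Type*} [AddCommGroup V] [Module k V] [Module D V] [Module Dᵐᵒᵖ V] [IsScalarTower k D V]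
    [IsScalarTower k Dᵐᵒᵖ V] [SMulCommClass D Dᵐᵒᵖ V] (N : Submodule k V)
    (hl : ∀ (d : D), ∀ v ∈ N, d • v ∈ N) (hr : ∀ (d : D), ∀ v ∈ N, op d • v ∈ N) :
    ∃ p : V →+ V, (∀ v, p v ∈ N) ∧ (∀ v ∈ N, p v = v) ∧ (∀ (d : D) v, p (d • v) = d • p v) ∧
      ∀ (d : D) v, p (op d • v) = op d • p v := by
  obtain ⟨q, hq⟩ := LinearMap.exists_leftInverse_of_injective N.subtype N.ker_subtype
  let p₀ : V →ₗ[k] V := N.subtype ∘ₗ q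
  have hp₀ : ∀ v, p₀ v ∈ N := fun v => (q v).2
  have hp₀' : ∀ v ∈ N, p₀ v = v := fun v hv =>
    congrArg Subtype.val (LinearMap.congr_fun hq ⟨v, hv⟩)
  let p₁ : V → V := fun v => ∑ i, x i • p₀ (y i • v)
  have hp₁ : ∀ v, p₁ v ∈ N := fun v => N.sum_mem fun i _ => hl _ _ (hp₀ _)
  have hp₁' : ∀ v ∈ N, p₁ v = v := fun v hv => by
    simp only [p₁, hp₀' _ (hl _ v hv), smul_smul, ← Finset.sum_smul, h.sum_mul, one_smul]
  have hadd₁ : ∀ v w, p₁ (v + w) = p₁ v + p₁ w := fun v w => by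
    simp only [p₁, smul_add, map_add, Finset.sum_add_distrib]
  have hsmul₁ : ∀ (c : k) v, p₁ (c • v) = c • p₁ v := fun c v => by
    simp only [p₁, Finset.smul_sum]
    refine Finset.sum_congr rfl fun i _ => ?_
    rw [smul_algebra_smul_comm, map_smul, smul_algebra_smul_comm]
  have hl₁ : ∀ (d : D) v, p₁ (d • v) = d • p₁ v := fun d v => by
    have := h.apply_eq (LinearMap.mk₂ k (fun u w : D => u • p₀ (w • v))
      (fun u u' w => by simp [add_smul]) (fun r u w => by simp)
      (fun u w w' => by simp [add_smul])
      (fun r u w => by rw [smul_assoc, map_smul, smul_algebra_smul_comm])) d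
    simp only [LinearMap.mk₂_apply] at this
    simp only [p₁, Finset.smul_sum, smul_smul, this]
  refine ⟨{ toFun := fun v => ∑ i, op (y i) • p₁ (op (x i) • v)
            map_zero' := by
              have : p₁ 0 = 0 := by simpa using hadd₁ 0 0
              simp [this]
            map_add' := fun v w => by
              simp only [smul_add, hadd₁, Finset.sum_add_distrib] },
    fun v => N.sum_mem fun i _ => hr _ _ (hp₁ _), fun v hv => ?_, fun d v => ?_, fun d v => ?_⟩
  · simp only [AddMonoidHom.coe_mk, ZeroHom.coe_mk, hp₁' _ (hr _ v hv), smul_smul, ← op_mul]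
    rw [← Finset.sum_smul, ← Finset.op_sum, h.sum_mul, op_one, one_smul]
  · simp only [AddMonoidHom.coe_mk, ZeroHom.coe_mk, Finset.smul_sum]
    refine Finset.sum_congr rfl fun i _ => ?_
    rw [← smul_comm d (op (x i)) v, hl₁, smul_comm d (op (y i))]
  · have := h.apply_eq (LinearMap.mk₂ k (fun u w : D => op w • p₁ (op u • v))
      (fun u u' w => by simp [add_smul, hadd₁])
      (fun r u w => by rw [op_smul, smul_assoc, hsmul₁, smul_algebra_smul_comm])
      (fun u w w' => by simp [add_smul])
      (fun r u w => by rw [op_smul, smul_assoc])) d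
    simp only [LinearMap.mk₂_apply] at this
    simp only [AddMonoidHom.coe_mk, ZeroHom.coe_mk, Finset.smul_sum, smul_smul, ← op_mul, this]

variable (h : IsSeparabilityFamily k x y)
  (hc : ∀ d ∈ Subring.center D, ∃ c : k, algebraMap k D c = d)
include h hc

/-- In a central separable algebra over a field, an element `u` with `D u = u D` is zero or a unit:
the two-sided ideal `u D` is the image of a bilinear projection, and the image of `1` is central,
hence a scalar. -/
theorem isUnit_of_twisted_commute (α : D ≃ₐ[k] D) {u : D} (hu : u ≠ 0)
    (hα : ∀ d, d * u = u * α d) : IsUnit u := by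
  obtain ⟨p, hpN, hp, hpl, hpr⟩ := h.exists_bimodule_projection
    (LinearMap.range (LinearMap.mulLeft k u)) (by
      rintro d _ ⟨w, rfl⟩
      exact ⟨α d * w, by simp [← mul_assoc, hα]⟩) (by
      rintro d _ ⟨w, rfl⟩
      exact ⟨w * d, by simp [mul_assoc]⟩)
  obtain ⟨c, hcp⟩ := hc (p 1) (Subring.mem_center_iff.2 fun d => by
    have h1 := hpl d 1
    have h2 := hpr d 1
    simp only [smul_eq_mul, mul_one, op_smul_eq_mul, one_mul] at h1 h2
    rw [← h1, h2])
  have hup : u * p 1 = u := by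
    rw [← smul_eq_mul, ← hpl, smul_eq_mul, mul_one]
    exact hp u ⟨1, by simp⟩
  have hc0 : c ≠ 0 := by
    rintro rfl
    rw [map_zero] at hcp
    exact hu (by rw [← hup, ← hcp, mul_zero])
  obtain ⟨w, hw⟩ := hpN 1
  have h1 : u * (c⁻¹ • w) = 1 := by
    rw [mul_smul_comm]
    change c⁻¹ • (LinearMap.mulLeft k u w) = 1
    rw [hw, ← hcp, Algebra.smul_def, ← map_mul, inv_mul_cancel₀ hc0, map_one]
  have h2 : α.symm (c⁻¹ • w) * u = 1 := by rw [hα, AlgEquiv.apply_symm_apply, h1]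
  exact ⟨⟨u, c⁻¹ • w, h1, by rw [← left_inv_eq_right_inv h2 h1, h2]⟩, rfl⟩

/-- If `D` is central separable over a field and the `b i` are linearly independent, then
`z ↦ ∑ a i * z * b i` vanishes only if all `a i` do. -/
theorem eq_zero_of_sum_mul_mul_eq_zero {κ : Type u} [Fintype κ] {b : κ → D}
    (hb : LinearIndependent k b) {a : κ → D} (ha : ∀ z, ∑ i, a i * z * b i = 0) : a = 0 := by
  classical
  let N : Submodule k (κ → D) :=
    { carrier := {a | ∀ z, ∑ i, a i * z * b i = 0}
      zero_mem' := by simp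
      add_mem' := fun {a a'} h h' z => by simp [add_mul, Finset.sum_add_distrib, h z, h' z]
      smul_mem' := fun c a h z => by simp [← Finset.smul_sum, h z] }
  obtain ⟨p, hpN, hp, hpl, hpr⟩ := h.exists_bimodule_projection N
    (fun d v hv z => by
      have := congrArg (d * ·) (hv z)
      simpa [Finset.mul_sum, mul_assoc] using this)
    (fun d v hv z => by simpa [mul_assoc] using hv (d * z))
  have h0 : ∀ j, p (Pi.single j 1) = 0 := fun j => by
    have hcen : ∀ i, ∃ c : k, algebraMap k D c = p (Pi.single j 1) i := fun i =>
      hc _ (Subring.mem_center_iff.2 fun d => by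
        have h1 := congrFun (hpl d (Pi.single j 1)) i
        have h2 := congrFun (hpr d (Pi.single j 1)) i
        have h3 : d • (Pi.single j 1 : κ → D) = op d • Pi.single j 1 := by
          ext l
          by_cases hl : l = j
          · subst hl; simp
          · simp [hl]
        rw [h3, h2] at h1
        simpa using h1.symm)
    choose c hcc using hcen
    have hs := hpN (Pi.single j 1) 1
    simp only [← hcc, mul_one, ← Algebra.smul_def] at hs
    have := Fintype.linearIndependent_iff.1 hb c hs
    ext i
    rw [← hcc, this, map_zero, Pi.zero_apply]
  have haN : p a = a := hp a ha
  have hsum : a = ∑ j, a j • (Pi.single j 1 : κ → D) := by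
    ext i
    simp [Finset.sum_apply, Pi.single_apply]
  rw [← haN, hsum, map_sum]
  exact Finset.sum_eq_zero fun j _ => by rw [hpl, h0, smul_zero]

/-- The theorem of Skolem and Noether over a field: the averages of the `z` satisfy
`d * u = u * α d`, and they cannot all vanish, as otherwise so would `1 = ∑ x i * y i`. -/
theorem exists_isUnit_twisted_commute_of_field [Module.Finite k D] (α : D ≃ₐ[k] D) :
    ∃ z : D, IsUnit (∑ i, x i * z * α (y i)) := by
  rcases subsingleton_or_nontrivial D with hD | hD
  · exact ⟨1, isUnit_of_subsingleton _⟩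
  by_contra hcon
  have hzero : ∀ z, ∑ i, x i * z * α (y i) = 0 := fun z => by
    by_contra hne
    refine hcon ⟨z, isUnit_of_twisted_commute h hc α hne fun d => ?_⟩
    have := h.apply_eq (LinearMap.mk₂ k (fun u v : D => u * z * α v)
      (fun u u' v => by simp [add_mul]) (fun r u v => by simp)
      (fun u v v' => by simp [mul_add]) (fun r u v => by simp)) d
    simp only [LinearMap.mk₂_apply, map_mul] at this
    rw [Finset.mul_sum, Finset.sum_mul]
    simpa only [mul_assoc] using this
  let b := Module.finBasis k D
  have hb := fun i => b.sum_repr (α (y i))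
  have ha := eq_zero_of_sum_mul_mul_eq_zero (κ := ULift (Fin (Module.finrank k D))) h hc
    (b := fun j => b j.down) (b.linearIndependent.comp _ ULift.down_injective)
    (a := fun j => ∑ i, b.repr (α (y i)) j.down • x i) fun z => by
      rw [← hzero z]
      conv_rhs => enter [2, i]; rw [← hb i]
      simp only [Finset.sum_mul, Finset.mul_sum]
      rw [Finset.sum_comm]
      refine Finset.sum_congr rfl fun i _ => ?_
      rw [← Equiv.ulift.symm.sum_comp]
      refine Finset.sum_congr rfl fun j _ => ?_
      simp
  have h1 : (1 : D) = 0 := by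
    rw [← h.sum_mul]
    have : ∀ i, y i = ∑ j, b.repr (α (y i)) j • α.symm (b j) := fun i => by
      rw [← α.symm_apply_apply (y i), ← hb i, map_sum]
      simp [hb]
    conv_lhs => enter [2, i]; rw [this i]
    simp only [Finset.mul_sum]
    rw [Finset.sum_comm]
    refine Finset.sum_eq_zero fun j _ => ?_
    have := congrArg (· * α.symm (b j)) (congrFun ha ⟨j⟩)
    simpa [Finset.sum_mul] using this
  exact one_ne_zero h1

end Field

/-! ### The theorem of Skolem and Noether over a semilocal ring -/

section SkolemNoether

variable {S : Type u} [CommRing S]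

theorem one_tmul_quotient_eq_zero_iff {M : Type*} [AddCommGroup M] [Module S M] (I : Ideal S)
    (m : M) : (1 : S ⧸ I) ⊗ₜ[S] m = 0 ↔ m ∈ I • (⊤ : Submodule S M) := by
  rw [← (TensorProduct.quotTensorEquivQuotSMul M I).map_eq_zero_iff]
  change TensorProduct.quotTensorEquivQuotSMul M I (Ideal.Quotient.mk I 1 ⊗ₜ[S] m) = 0 ↔ _
  rw [TensorProduct.quotTensorEquivQuotSMul_mk_tmul, one_smul, Submodule.Quotient.mk_eq_zero]

theorem exists_one_tmul_eq {M : Type*} [AddCommGroup M] [Module S M] (I : Ideal S)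
    (w : (S ⧸ I) ⊗[S] M) : ∃ m : M, 1 ⊗ₜ m = w :=
  TensorProduct.mk_surjective S M (S ⧸ I) Ideal.Quotient.mk_surjective w

/-- Nakayama's lemma over all maximal ideals at once. -/
theorem Submodule.eq_top_of_forall_isMaximal {M : Type*} [AddCommGroup M] [Module S M]
    [Module.Finite S M] (N : Submodule S M)
    (h : ∀ P : Ideal S, P.IsMaximal → ∀ m : M, ∃ n ∈ N, m - n ∈ P • (⊤ : Submodule S M)) :
    N = ⊤ := by
  by_contra hN
  let I : Ideal S := Module.annihilator S (M ⧸ N)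
  have hI : I ≠ ⊤ := fun hI => hN <| by
    refine Submodule.Quotient.subsingleton_iff.1 ?_
    exact Module.annihilator_eq_top_iff.1 hI
  obtain ⟨P, hP, hIP⟩ := I.exists_le_maximal hI
  have hle : (⊤ : Submodule S (M ⧸ N)) ≤ P • ⊤ := fun y _ => by
    obtain ⟨m, rfl⟩ := N.mkQ_surjective y
    obtain ⟨n, hn, hmn⟩ := h P hP m
    have : N.mkQ m = N.mkQ (m - n) := by
      rw [map_sub, LinearMap.mem_ker.1 (N.ker_mkQ.ge hn), sub_zero]
    rw [this]
    have h1 := Submodule.mem_map_of_mem (f := N.mkQ) hmn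
    rw [Submodule.map_smul''] at h1
    exact Submodule.smul_mono le_rfl le_top h1
  obtain ⟨r, hr, hr'⟩ := Submodule.exists_sub_one_mem_and_smul_eq_zero_of_fg_of_le_smul P ⊤
    Module.Finite.fg_top hle
  have hrP : r ∈ P := hIP (Module.mem_annihilator.2 fun m => hr' m trivial)
  exact hP.ne_top ((Ideal.eq_top_iff_one P).2 (by simpa using P.sub_mem hrP hr))

variable {C : Type u} [Ring C] [Algebra S C]

/-- An element of a finite algebra is a unit if it is one modulo every maximal ideal. -/
theorem isUnit_of_forall_isMaximal [Module.Finite S C] (u : C)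
    (h : ∀ P : Ideal S, P.IsMaximal → IsUnit ((1 : S ⧸ P) ⊗ₜ[S] u)) : IsUnit u := by
  have hl : LinearMap.range (LinearMap.mulLeft S u) = ⊤ :=
    Submodule.eq_top_of_forall_isMaximal _ fun P hP c => by
      obtain ⟨v, hv, -⟩ := isUnit_iff_exists.1 (h P hP)
      obtain ⟨w, hw⟩ := exists_one_tmul_eq P (v * 1 ⊗ₜ c)
      refine ⟨u * w, ⟨w, rfl⟩, (one_tmul_quotient_eq_zero_iff P _).1 ?_⟩
      have : (1 : S ⧸ P) ⊗ₜ[S] (u * w) = 1 ⊗ₜ u * 1 ⊗ₜ w := by simp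
      rw [TensorProduct.tmul_sub, this, hw, ← mul_assoc, hv, one_mul, sub_self]
  have hr : LinearMap.range (LinearMap.mulRight S u) = ⊤ :=
    Submodule.eq_top_of_forall_isMaximal _ fun P hP c => by
      obtain ⟨v, -, hv⟩ := isUnit_iff_exists.1 (h P hP)
      obtain ⟨w, hw⟩ := exists_one_tmul_eq P (1 ⊗ₜ c * v)
      refine ⟨w * u, ⟨w, rfl⟩, (one_tmul_quotient_eq_zero_iff P _).1 ?_⟩
      have : (1 : S ⧸ P) ⊗ₜ[S] (w * u) = 1 ⊗ₜ w * 1 ⊗ₜ u := by simp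
      rw [TensorProduct.tmul_sub, this, hw, mul_assoc, hv, mul_one, sub_self]
  obtain ⟨v, hv⟩ := LinearMap.range_eq_top.1 hl 1
  obtain ⟨w, hw⟩ := LinearMap.range_eq_top.1 hr 1
  rw [LinearMap.mulLeft_apply] at hv
  rw [LinearMap.mulRight_apply] at hw
  exact ⟨⟨u, v, hv, by rw [← left_inv_eq_right_inv hw hv, hw]⟩, rfl⟩

variable {ι : Type*} [Fintype ι] {x y : ι → C} (h : IsSeparabilityFamily S x y)
  (hc : ∀ d ∈ Subring.center C, ∃ c : S, algebraMap S C c = d)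
include h hc

/-- The centre of a separable algebra commutes with base change to a quotient. -/
theorem IsSeparabilityFamily.exists_algebraMap_quotient_eq (P : Ideal S) {d : (S ⧸ P) ⊗[S] C}
    (hd : d ∈ Subring.center ((S ⧸ P) ⊗[S] C)) :
    ∃ s : S, 1 ⊗ₜ algebraMap S C s = d := by
  obtain ⟨c, rfl⟩ := exists_one_tmul_eq P d
  obtain ⟨s, hs⟩ := hc _ (h.sum_mem_center c)
  refine ⟨s, ?_⟩
  rw [hs, TensorProduct.tmul_sum]
  simpa using (h.baseChange (S ⧸ P)).sum_mul_of_mem_center hd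

/-- The theorem of Skolem and Noether: an automorphism of an Azumaya algebra over a semilocal ring
is inner. The average `∑ x i * z * α (y i)` has the required commutation property for all `z`, and
the Chinese remainder theorem gives a `z` for which it is a unit modulo every maximal ideal. -/
theorem IsSeparabilityFamily.exists_isUnit_twisted_commute [Finite (MaximalSpectrum S)]
    [Module.Finite S C] (α : C ≃ₐ[S] C) : ∃ u : C, IsUnit u ∧ ∀ c, c * u = u * α c := by
  let E : C →ₗ[S] C := ∑ i, LinearMap.mulLeft S (x i) ∘ₗ LinearMap.mulRight S (α (y i))
  have hE : ∀ z, E z = ∑ i, x i * z * α (y i) := fun z => by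
    simp [E, LinearMap.sum_apply, mul_assoc]
  have key : ∀ P : MaximalSpectrum S, ∃ w : (S ⧸ P.asIdeal) ⊗[S] C,
      IsUnit (E.baseChange (S ⧸ P.asIdeal) w) := fun P => by
    have := P.isMaximal
    let _ : Field (S ⧸ P.asIdeal) := Ideal.Quotient.field _
    obtain ⟨z, hz⟩ := exists_isUnit_twisted_commute_of_field (h.baseChange (S ⧸ P.asIdeal))
      (fun d hd => by
        obtain ⟨s, rfl⟩ := h.exists_algebraMap_quotient_eq hc P.asIdeal hd
        refine ⟨Ideal.Quotient.mk _ s, ?_⟩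
        rw [Algebra.algebraMap_eq_smul_one s, TensorProduct.tmul_smul,
          Algebra.TensorProduct.algebraMap_apply, TensorProduct.smul_tmul']
        congr 1
        rw [Algebra.smul_def, mul_one]
        rfl)
      (Algebra.TensorProduct.congr AlgEquiv.refl α)
    refine ⟨z, ?_⟩
    convert hz using 1
    obtain ⟨c, rfl⟩ := exists_one_tmul_eq P.asIdeal z
    simp [hE, TensorProduct.tmul_sum]
  choose w hw using key
  obtain ⟨z, hz⟩ := Ideal.pi_tensorProductMk_quotient_surjective C
    (fun P : MaximalSpectrum S => P.asIdeal) (fun P Q hPQ =>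
      Ideal.isCoprime_of_isMaximal fun h => hPQ (MaximalSpectrum.ext h)) w
  refine ⟨E z, isUnit_of_forall_isMaximal (S := S) _ fun P hP => ?_, fun c => ?_⟩
  · have h1 := hw ⟨P, hP⟩
    rw [← congrFun hz ⟨P, hP⟩] at h1
    simpa using h1
  · have := h.apply_eq (LinearMap.mk₂ S (fun u v : C => u * z * α v)
      (fun u u' v => by simp [add_mul]) (fun r u v => by simp)
      (fun u v v' => by simp [mul_add]) (fun r u v => by simp)) c
    simp only [LinearMap.mk₂_apply, map_mul] at this
    rw [hE, Finset.mul_sum, Finset.sum_mul]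
    simpa only [mul_assoc] using this

end SkolemNoether

/-! ### The centre of an Azumaya algebra with involution -/

section Centre

variable {R S : Type u} [CommRing R] [CommRing S]

theorem PrimeSpectrum.eq_zero_or_one_of_isIdempotentElem [ConnectedSpace (PrimeSpectrum R)] {e : R}
    (he : IsIdempotentElem e) : e = 0 ∨ e = 1 := by
  have hinj := PrimeSpectrum.basicOpen_injOn_isIdempotentElem (R := R)
  have hclopen : IsClopen (PrimeSpectrum.basicOpen e : Set (PrimeSpectrum R)) :=
    PrimeSpectrum.isClopen_iff.2 ⟨e, he, rfl⟩
  rcases _root_.isClopen_iff.1 hclopen with h | h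
  · refine Or.inl (hinj he IsIdempotentElem.zero ?_)
    ext1
    rw [h]
    simp
  · refine Or.inr (hinj he IsIdempotentElem.one ?_)
    ext1
    rw [h]
    simp

variable [Algebra R S]

theorem finite_maximalSpectrum_of_finite [Module.Finite R S] [Finite (MaximalSpectrum R)] :
    Finite (MaximalSpectrum S) := by
  have hmax : ∀ Q : MaximalSpectrum S, (Q.asIdeal.comap (algebraMap R S)).IsMaximal := fun Q =>
    have := Q.isMaximal
    Ideal.isMaximal_comap_of_isIntegral_of_isMaximal Q.asIdeal
  let f : MaximalSpectrum S → MaximalSpectrum R :=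
    fun Q => ⟨Q.asIdeal.comap (algebraMap R S), hmax Q⟩
  refine Set.finite_univ_iff.1 (Set.Finite.of_finite_fibers f (Set.toFinite _) fun P _ => ?_)
  have hfin := Algebra.QuasiFinite.finite_primesOver (S := S) P.asIdeal
  refine (hfin.preimage (f := MaximalSpectrum.asIdeal)
    fun Q _ Q' _ h => MaximalSpectrum.ext h).subset ?_
  rintro Q ⟨-, hQ⟩
  exact ⟨Q.isMaximal.isPrime, ⟨by rw [← hQ]⟩⟩

variable (s : S →ₐ[R] S) (hinj : Function.Injective (algebraMap R S))
  (hs : ∀ z, s (s z) = z)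
  (hfix : ∀ z, s z = z → ∃ r : R, algebraMap R S r = z)
include hinj hs hfix

/-- If the fibres of `S` over `R` are reduced and `R` is connected, then an involution of `S` with
fixed ring `R` is trivial, or at each maximal ideal of `R` some skew element has a square which is
a unit there. Indeed, the ideal `J` generated by the squares of the skew elements and the
annihilator `I` of the skew elements satisfy `I * J = 0`, and also `I + J = R`: if `J` is contained
in a maximal ideal `P` then all skew elements vanish modulo `P`, hence, by Nakayama's lemma,
they are annihilated by some element outside of `P`. -/
theorem forall_skew_eq_zero_or_exists_sq_notMem (two_unit : IsUnit (2 : R))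
    [ConnectedSpace (PrimeSpectrum R)] [Module.Finite R S]
    (hred : ∀ P : Ideal R, P.IsMaximal → ∀ z : S, z * z ∈ P • (⊤ : Submodule R S) →
      z ∈ P • (⊤ : Submodule R S)) :
    (∀ z, s z = -z → z = 0) ∨
      ∀ P : Ideal R, P.IsMaximal → ∃ z, s z = -z ∧ ∃ r ∉ P, algebraMap R S r = z * z := by
  obtain ⟨v, hv⟩ := two_unit.exists_left_inv
  -- the projection of `S` onto the skew elements
  let q : S →ₗ[R] S := v • (LinearMap.id - s.toLinearMap)
  have hq : ∀ z, q z = v • (z - s z) := fun z => rfl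
  let K : Submodule R S := LinearMap.range q
  have hqK : ∀ z, s z = -z → q z = z := fun z hz => by
    rw [hq, hz, sub_neg_eq_add, ← two_smul R z, smul_smul, hv, one_smul]
  have hK : ∀ z ∈ K, s z = -z := by
    rintro _ ⟨z, rfl⟩
    rw [hq, map_smul, map_sub, hs, ← smul_neg, neg_sub]
  have hKfg : K.FG := by
    rw [show K = Submodule.map q ⊤ from LinearMap.range_eq_map q]
    exact Module.Finite.fg_top.map q
  let I : Ideal R := K.annihilator
  let J : Ideal R := Ideal.span {r | ∃ z, s z = -z ∧ algebraMap R S r = z * z}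
  have hIJ : ∀ a ∈ I, ∀ b ∈ J, a * b = 0 := fun a ha b hb => by
    induction hb using Submodule.span_induction with
    | mem b hb =>
      obtain ⟨z, hz, hbz⟩ := hb
      have hz0 : a • z = 0 := Submodule.mem_annihilator.1 ha z ⟨z, hqK z hz⟩
      refine hinj ?_
      rw [map_mul, hbz, ← mul_assoc, ← Algebra.smul_def, hz0, zero_mul, map_zero]
    | zero => rw [mul_zero]
    | add b b' _ _ h h' => rw [mul_add, h, h', add_zero]
    | smul t b _ h => rw [smul_eq_mul, mul_left_comm, h, mul_zero]
  have htop : I ⊔ J = ⊤ := by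
    by_contra hne
    obtain ⟨P, hP, hIP⟩ := (I ⊔ J).exists_le_maximal hne
    have hle : K ≤ P • K := fun z hz => by
      obtain ⟨r, hr⟩ := hfix (z * z) (by rw [map_mul, hK z hz, neg_mul_neg])
      have hrP : r ∈ P := hIP (Ideal.mem_sup_right (Ideal.subset_span ⟨z, hK z hz, hr⟩))
      have h1 : z ∈ P • (⊤ : Submodule R S) := hred P hP z (by
        rw [← hr, Algebra.algebraMap_eq_smul_one]
        exact Submodule.smul_mem_smul hrP trivial)
      have h2 := Submodule.mem_map_of_mem (f := q) h1
      rwa [Submodule.map_smul'', ← LinearMap.range_eq_map, hqK z (hK z hz)] at h2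
    obtain ⟨r, hr, hr'⟩ :=
      Submodule.exists_sub_one_mem_and_smul_eq_zero_of_fg_of_le_smul P K hKfg hle
    have hrP : r ∈ P := hIP (Ideal.mem_sup_left (Submodule.mem_annihilator.2 hr'))
    exact hP.ne_top ((Ideal.eq_top_iff_one P).2 (by simpa using P.sub_mem hrP hr))
  obtain ⟨a, ha, b, hb, hab⟩ := Submodule.mem_sup.1 ((Ideal.eq_top_iff_one _).1 htop)
  have hab' := hIJ a ha b hb
  rcases PrimeSpectrum.eq_zero_or_one_of_isIdempotentElem (e := a) (by
    unfold IsIdempotentElem; linear_combination a * hab - hab') with h0 | h1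
  · right
    intro P hP
    by_contra! hcon
    have hJP : J ≤ P := Ideal.span_le.2 fun r ⟨z, hz, hr⟩ => by
      by_contra hrP
      exact hcon z hz r hrP hr
    rw [h0, zero_add] at hab
    exact hP.ne_top ((Ideal.eq_top_iff_one P).2 (hab ▸ hJP hb))
  · left
    intro z hz
    have := Submodule.mem_annihilator.1 ha z ⟨z, hqK z hz⟩
    rwa [h1, one_smul] at this

/-- Hilbert's theorem 90, up to sign, for an involution of a semilocal ring `S` with fixed ring `R`:
an element `c` of norm `1` is `± x / s x` for a unit `x`. If the involution is trivial, then `c` is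
a square root of `1`, hence `± 1`. Otherwise `x = z + s z * c`, where the class of `z` modulo each
maximal ideal `P` of `R` is either `1` or a skew element, as the norm of `1 + c` is `2 + (c + s c)`
and the norm of `z - z * c` is `z ^ 2 * ((c + s c) - 2)` for skew `z`. -/
theorem exists_isUnit_mul_eq (two_unit : IsUnit (2 : R)) [Finite (MaximalSpectrum R)]
    [ConnectedSpace (PrimeSpectrum R)] [ConnectedSpace (PrimeSpectrum S)] [Module.Finite R S]
    (hred : ∀ P : Ideal R, P.IsMaximal → ∀ z : S, z * z ∈ P • (⊤ : Submodule R S) →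
      z ∈ P • (⊤ : Submodule R S)) {c : S} (hc : c * s c = 1) :
    ∃ δ x : S, (δ = 1 ∨ δ = -1) ∧ IsUnit x ∧ s x * c = δ * x := by
  rcases forall_skew_eq_zero_or_exists_sq_notMem s hinj hs hfix two_unit hred with h | h
  · have hid : ∀ z, s z = z := fun z => by
      have := h (z - s z) (by rw [map_sub, hs, neg_sub])
      exact (sub_eq_zero.1 this).symm
    rw [hid] at hc
    obtain ⟨v, hv⟩ := two_unit.exists_left_inv
    have hv' : algebraMap R S v * 2 = 1 := by
      have := congrArg (algebraMap R S) hv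
      rwa [map_mul, map_ofNat, map_one] at this
    have he : IsIdempotentElem (algebraMap R S v * (1 + c)) := by
      unfold IsIdempotentElem
      linear_combination (algebraMap R S v) ^ 2 * hc + (algebraMap R S v * (1 + c)) * hv'
    refine ⟨c, 1, ?_, isUnit_one, by simp⟩
    rcases PrimeSpectrum.eq_zero_or_one_of_isIdempotentElem he with h0 | h1
    · right
      linear_combination 2 * h0 - (1 + c) * hv'
    · left
      linear_combination 2 * h1 - (1 + c) * hv'
  · obtain ⟨r, hr⟩ := hfix (c + s c) (by rw [map_add, hs, add_comm])
    -- `N z` is the norm of `z + s z * c`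
    let N : S → S := fun z => (z + s z * c) * (s z + z * s c)
    have hN : ∀ z, N z = 2 * (z * s z) + z * z * s c + s z * s z * c := fun z => by
      simp only [N]
      linear_combination (z * s z) * hc
    have key : ∀ P : MaximalSpectrum R, ∃ (z : S) (t : R), t ∉ P.asIdeal ∧
        algebraMap R S t = N z := fun P => by
      have hP := P.isMaximal.isPrime
      by_cases h2 : 2 + r ∈ P.asIdeal
      · obtain ⟨z, hz, t, ht, htz⟩ := h P.asIdeal P.isMaximal
        refine ⟨z, t * (r - 2), fun hmem => ?_, ?_⟩
        · rcases hP.mem_or_mem hmem with h' | h'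
          · exact ht h'
          · have h4 : (2 : R) * 2 ∈ P.asIdeal := by
              have := P.asIdeal.sub_mem h2 h'
              ring_nf at this ⊢
              exact this
            rcases hP.mem_or_mem h4 with h'' | h'' <;>
              exact hP.ne_top (P.asIdeal.eq_top_of_isUnit_mem h'' two_unit)
        · rw [hN, hz, map_mul, map_sub, hr, htz, map_ofNat]
          ring
      · refine ⟨1, 2 + r, h2, ?_⟩
        rw [hN, map_add, hr, map_ofNat, map_one]
        ring
    choose w t ht htw using key
    obtain ⟨z, hz⟩ := Ideal.pi_tensorProductMk_quotient_surjective S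
      (fun P : MaximalSpectrum R => P.asIdeal) (fun P Q hPQ =>
        Ideal.isCoprime_of_isMaximal fun h => hPQ (MaximalSpectrum.ext h)) fun P => 1 ⊗ₜ w P
    refine ⟨1, z + s z * c, Or.inl rfl, ?_, ?_⟩
    · refine isUnit_of_mul_isUnit_left (y := s z + z * s c) (isUnit_of_forall_isMaximal (S := R) _
        fun P hP => ?_)
      have hz1 : (1 : R ⧸ P) ⊗ₜ[R] z = 1 ⊗ₜ w ⟨P, hP⟩ := congrFun hz ⟨P, hP⟩
      have hz2 : (1 : R ⧸ P) ⊗ₜ[R] s z = 1 ⊗ₜ s (w ⟨P, hP⟩) := by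
        simpa using congrArg (s.toLinearMap.baseChange (R ⧸ P)) hz1
      have hNz : ∀ z, (1 : R ⧸ P) ⊗ₜ[R] N z = (1 ⊗ₜ z + 1 ⊗ₜ s z * 1 ⊗ₜ c) *
          (1 ⊗ₜ s z + 1 ⊗ₜ z * 1 ⊗ₜ s c) := fun z => by
        simp [N, ← TensorProduct.tmul_add]
      change IsUnit ((1 : R ⧸ P) ⊗ₜ[R] N z)
      rw [hNz, hz1, hz2, ← hNz, ← htw, Algebra.algebraMap_eq_smul_one, TensorProduct.tmul_smul,
        TensorProduct.smul_tmul', Algebra.smul_def, mul_one]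
      let _ : Field (R ⧸ P) := Ideal.Quotient.field _
      have hu : IsUnit (algebraMap R (R ⧸ P) (t ⟨P, hP⟩)) :=
        isUnit_iff_ne_zero.2 fun h0 => ht ⟨P, hP⟩ (Ideal.Quotient.eq_zero_iff_mem.1 h0)
      exact hu.map (Algebra.TensorProduct.includeLeft : R ⧸ P →ₐ[R] (R ⧸ P) ⊗[R] S)
    · rw [map_add, map_mul, hs]
      linear_combination z * hc

end Centre

section AzumayaCentre

variable {R S A : Type u} [CommRing R] [CommRing S] [Algebra R S] [Ring A] [Algebra R A]
  [Algebra S A] [IsScalarTower R S A] (hS : IsCentre S A)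
include hS

theorem IsCentre.mem_center (z : S) : algebraMap S A z ∈ Subring.center A :=
  hS.range_eq ▸ ⟨z, rfl⟩

theorem IsCentre.exists_algebraMap_eq {a : A} (ha : a ∈ Subring.center A) :
    ∃ z, algebraMap S A z = a := by
  rwa [← hS.range_eq] at ha

variable {ι : Type*} [Fintype ι] {x y : ι → A} (h : IsSeparabilityFamily R x y)
include h

/-- The centre of a separable algebra is a direct summand, by averaging. -/
theorem IsCentre.exists_retraction : ∃ π : A →ₗ[R] S, ∀ z, π (algebraMap S A z) = z := by
  choose f hf using fun a => hS.exists_algebraMap_eq (h.sum_mem_center a)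
  refine ⟨{ toFun := f, map_add' := fun a b => hS.injective ?_,
            map_smul' := fun r a => hS.injective ?_ }, fun z => hS.injective ?_⟩
  · simp only [map_add, hf, mul_add, add_mul, Finset.sum_add_distrib]
  · rw [RingHom.id_apply, hf, Algebra.smul_def r (f a), map_mul, hf,
      ← IsScalarTower.algebraMap_apply, ← Algebra.smul_def, Finset.smul_sum]
    simp
  · exact (hf _).trans (h.sum_mul_of_mem_center (hS.mem_center z))

theorem IsCentre.finite_base [Module.Projective R A] : Module.Finite R S := by
  obtain ⟨π, hπ⟩ := hS.exists_retraction h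
  have := h.finite
  exact Module.Finite.of_surjective π fun z => ⟨_, hπ z⟩

/-- The fibres of the centre of a separable algebra are reduced: a central element of square zero of
a separable algebra over a field generates a two-sided ideal, which is generated by a central
idempotent, and hence is zero. -/
theorem IsCentre.mem_of_mul_self_mem (P : Ideal R) (hP : P.IsMaximal) (z : S)
    (hz : z * z ∈ P • (⊤ : Submodule R S)) : z ∈ P • (⊤ : Submodule R S) := by
  rw [← one_tmul_quotient_eq_zero_iff] at hz ⊢
  let _ : Field (R ⧸ P) := Ideal.Quotient.field _
  let w : (R ⧸ P) ⊗[R] A := 1 ⊗ₜ algebraMap S A z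
  have hwc : ∀ d, d * w = w * d := fun d => by
    obtain ⟨a, rfl⟩ := exists_one_tmul_eq P d
    simp [w, Algebra.commutes]
  have hww : w * w = 0 := by
    have := congrArg ((IsScalarTower.toAlgHom R S A).toLinearMap.baseChange (R ⧸ P)) hz
    simpa [w] using this
  obtain ⟨p, hpN, hp, hpl, -⟩ := (h.baseChange (R ⧸ P)).exists_bimodule_projection
    (LinearMap.range (LinearMap.mulLeft (R ⧸ P) w)) (by
      rintro d _ ⟨v, rfl⟩
      exact ⟨d * v, by simp [← mul_assoc, hwc]⟩) (by
      rintro d _ ⟨v, rfl⟩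
      exact ⟨v * d, by simp [mul_assoc]⟩)
  obtain ⟨v, hv⟩ := hpN 1
  have hw0 : w = 0 := by
    rw [← hp w ⟨1, by simp⟩, ← mul_one w, ← smul_eq_mul w, hpl, ← hv, LinearMap.mulLeft_apply,
      smul_eq_mul, ← mul_assoc, hww, zero_mul]
  obtain ⟨π, hπ⟩ := hS.exists_retraction h
  have := congrArg (π.baseChange (R ⧸ P)) hw0
  simpa [w, hπ] using this

end AzumayaCentre

section CentreInvolution

variable {R S A B : Type u} [CommRing R] [CommRing S] [Algebra R S] [Ring A] [Algebra R A]
  [Algebra S A] [IsScalarTower R S A] [Ring B] [Algebra R B] [Algebra S B] [IsScalarTower R S B]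
  {σ : AlgInvolution R A} {τ : AlgInvolution R B}

/-- The automorphism of the common centre induced by two involutions. -/
theorem exists_centreInvolution (hA : IsCentre S A)
    (agree : ∀ s : S, ∃ s' : S,
      σ (algebraMap S A s) = algebraMap S A s' ∧ τ (algebraMap S B s) = algebraMap S B s') :
    ∃ s : S →ₐ[R] S, (∀ z, s (s z) = z) ∧ (∀ z, σ (algebraMap S A z) = algebraMap S A (s z)) ∧
      ∀ z, τ (algebraMap S B z) = algebraMap S B (s z) := by
  choose f hf hf' using agree
  have hσr : ∀ r : R, σ (algebraMap R A r) = algebraMap R A r := fun r => by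
    rw [Algebra.algebraMap_eq_smul_one, map_smul, σ.map_one]
  refine ⟨{ toFun := f, map_one' := hA.injective ?_, map_mul' := fun a b => hA.injective ?_,
            map_zero' := hA.injective ?_, map_add' := fun a b => hA.injective ?_,
            commutes' := fun r => hA.injective ?_ }, fun z => hA.injective ?_, hf, hf'⟩
  · rw [← hf, map_one, σ.map_one]
  · rw [← hf, map_mul, σ.map_mul, hf, hf, ← map_mul, mul_comm]
  · change algebraMap S A (f 0) = _
    rw [← hf, map_zero, map_zero]
  · change algebraMap S A (f (a + b)) = algebraMap S A (f a + f b)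
    rw [← hf, map_add, map_add, hf, hf, ← map_add]
  · rw [← hf, ← IsScalarTower.algebraMap_apply, hσr]
  · change algebraMap S A (f (f z)) = _
    rw [← hf, ← hf, σ.invol]

/-- An element of norm `1` of the centre is of the form `± x / σ x`. -/
theorem IsAzumayaWithInvolution.exists_isUnit_mul_eq (hσ : IsAzumayaWithInvolution σ)
    (hA : IsCentre S A) (two_unit : IsUnit (2 : R)) [Finite (MaximalSpectrum R)]
    [ConnectedSpace (PrimeSpectrum R)] [ConnectedSpace (PrimeSpectrum S)]
    (s : S →ₐ[R] S) (hs : ∀ z, s (s z) = z)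
    (hsσ : ∀ z, σ (algebraMap S A z) = algebraMap S A (s z)) {c : S} (hc : c * s c = 1) :
    ∃ δ x : S, (δ = 1 ∨ δ = -1) ∧ IsUnit x ∧ s x * c = δ * x := by
  obtain ⟨n, x, y, h⟩ := exists_isSeparabilityFamily hσ.separable
  have := hσ.projective
  have := hA.finite_base h
  refine _root_.exists_isUnit_mul_eq s ?_ hs (fun z hz => ?_) two_unit (hA.mem_of_mul_self_mem h) hc
  · refine Function.Injective.of_comp (f := algebraMap S A) ?_
    rw [← RingHom.coe_comp, ← IsScalarTower.algebraMap_eq]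
    exact hσ.injective
  · have : algebraMap S A z ∈ Set.range (algebraMap R A) := by
      rw [hσ.range_eq]
      exact ⟨hA.mem_center z, by rw [hsσ, hz]⟩
    obtain ⟨r, hr⟩ := this
    exact ⟨r, hA.injective (by rw [← hr, ← IsScalarTower.algebraMap_apply])⟩

end CentreInvolution

/-! ### Brauer equivalence and matrix algebras -/

section Brauer

/-- A finitely generated projective module over a connected semilocal ring is free, as its rank is
constant. -/
theorem nonempty_basis_of_projective {S U : Type*} [CommRing S] [Finite (MaximalSpectrum S)]
    [ConnectedSpace (PrimeSpectrum S)] [AddCommGroup U] [Module S U] [Module.Finite S U]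
    [Module.Projective S U] : ∃ n : ℕ, Nonempty (Module.Basis (Fin n) S U) := by
  have := Module.finitePresentation_of_projective S U
  have hconst :=
    (Module.isLocallyConstant_rankAtStalk (R := S) (M := U)).apply_eq_of_preconnectedSpace
  obtain ⟨p₀⟩ : Nonempty (PrimeSpectrum S) := inferInstance
  refine ⟨_, Module.nonempty_basis_of_flat_of_finrank_eq S U (Module.rankAtStalk U p₀) fun P => ?_⟩
  have := P.isMaximal
  let _ : Field (S ⧸ P.asIdeal) := Ideal.Quotient.field _
  obtain ⟨p⟩ : Nonempty (PrimeSpectrum (S ⧸ P.asIdeal)) := inferInstance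
  rw [← hconst (p.comap (algebraMap S _)), ← Module.rankAtStalk_baseChange,
    Module.rankAtStalk_eq_finrank_of_free]
  rfl

variable {S A B : Type u} [CommRing S] [Ring A] [Algebra S A] [Ring B] [Algebra S B]

/-- Over a connected semilocal ring, Brauer equivalent algebras have isomorphic matrix algebras. -/
theorem BrauerEquivalent.exists_matrix_algEquiv [Finite (MaximalSpectrum S)]
    [ConnectedSpace (PrimeSpectrum S)] (h : BrauerEquivalent S A B) :
    ∃ m n : ℕ, Nonempty (Matrix (Fin (m + 1)) (Fin (m + 1)) A ≃ₐ[S]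
      Matrix (Fin (n + 1)) (Fin (n + 1)) B) := by
  have key : ∀ (U : Type u) [AddCommGroup U] [Module S U], FaithfulSMul S U → Module.Finite S U →
      Module.Projective S U → ∃ n : ℕ, Nonempty (Module.Basis (Fin (n + 1)) S U) := by
    intro U _ _ _ _ _
    obtain ⟨n, ⟨b⟩⟩ := nonempty_basis_of_projective (S := S) (U := U)
    have : Nontrivial S := PrimeSpectrum.nonempty_iff_nontrivial.1 inferInstance
    cases n with
    | zero =>
      have : Subsingleton U := b.repr.toEquiv.subsingleton
      exact absurd (FaithfulSMul.eq_of_smul_eq_smul (M := S) (α := U) (m₁ := 0) (m₂ := 1)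
        fun _ => Subsingleton.elim _ _) zero_ne_one
    | succ n => exact ⟨n, ⟨b⟩⟩
  obtain ⟨U, V, _, _, _, _, ⟨h1, h2, h3⟩, ⟨h4, h5, h6⟩, ⟨e⟩⟩ := h
  obtain ⟨m, ⟨b⟩⟩ := key U h1 h2 h3
  obtain ⟨n, ⟨c⟩⟩ := key V h4 h5 h6
  exact ⟨m, n, ⟨(matrixEquivTensor _ S A).trans
    ((Algebra.TensorProduct.congr AlgEquiv.refl (LinearMap.toMatrixAlgEquiv b)).symm.trans
      (e.trans ((Algebra.TensorProduct.congr AlgEquiv.refl (LinearMap.toMatrixAlgEquiv c)).trans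
        (matrixEquivTensor _ S B).symm)))⟩⟩

theorem BrauerEquivalent.of_matrix_algEquiv {m n : ℕ}
    (f : Matrix (Fin (m + 1)) (Fin (m + 1)) A ≃ₐ[S] Matrix (Fin (n + 1)) (Fin (n + 1)) B) :
    BrauerEquivalent S A B :=
  ⟨Fin (m + 1) → S, Fin (n + 1) → S, inferInstance, inferInstance, inferInstance, inferInstance,
    ⟨inferInstance, inferInstance, inferInstance⟩, ⟨inferInstance, inferInstance, inferInstance⟩,
    ⟨(Algebra.TensorProduct.congr AlgEquiv.refl LinearMap.toMatrixAlgEquiv').trans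
      ((matrixEquivTensor (Fin (m + 1)) S A).symm.trans (f.trans
        ((matrixEquivTensor (Fin (n + 1)) S B).trans
          (Algebra.TensorProduct.congr AlgEquiv.refl LinearMap.toMatrixAlgEquiv').symm)))⟩⟩

theorem matrixEquivTensor_scalar {n : Type*} [Fintype n] [DecidableEq n] (a : A) :
    matrixEquivTensor n S A (Matrix.scalar n a) = a ⊗ₜ 1 := by
  rw [← AlgEquiv.eq_symm_apply, matrixEquivTensor_apply_symm]
  ext i j
  by_cases hij : i = j
  · subst hij; simp
  · simp [hij]

variable (R : Type u) [CommRing R] [Algebra R S] [Algebra R A] [IsScalarTower R S A] [Algebra R B]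
  [IsScalarTower R S B] (T : Type u) [CommRing T] [Algebra R T]

/-- Matrix algebras commute with scalar extension. -/
def matrixScalarExt (A : Type u) [Ring A] [Algebra R A] (n : Type) [Fintype n] [DecidableEq n] :
    Matrix n n (T ⊗[R] A) ≃ₐ[R] T ⊗[R] Matrix n n A :=
  (matrixEquivTensor n R (T ⊗[R] A)).trans ((Algebra.TensorProduct.assoc R R R T A _).trans
    (Algebra.TensorProduct.congr AlgEquiv.refl (matrixEquivTensor n R A).symm))

theorem matrixScalarExt_scalar (n : Type) [Fintype n] [DecidableEq n] (t : T) (a : A) :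
    matrixScalarExt R T A n (Matrix.scalar n (t ⊗ₜ a)) = t ⊗ₜ Matrix.scalar n a := by
  simp only [matrixScalarExt, AlgEquiv.trans_apply]
  rw [matrixEquivTensor_scalar, Algebra.TensorProduct.assoc_tmul, Algebra.TensorProduct.congr_apply,
    Algebra.TensorProduct.map_tmul]
  exact congrArg (t ⊗ₜ ·) ((AlgEquiv.symm_apply_eq _).2 (matrixEquivTensor_scalar a).symm)

/-- Brauer equivalence is preserved by scalar extension. -/
theorem BrauerEquivalent.scalarExt [Finite (MaximalSpectrum S)]
    [ConnectedSpace (PrimeSpectrum S)] (h : BrauerEquivalent S A B) :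
    BrauerEquivalent (T ⊗[R] S) (T ⊗[R] A) (T ⊗[R] B) := by
  obtain ⟨m, n, ⟨f⟩⟩ := h.exists_matrix_algEquiv
  let F := (matrixScalarExt R T A (Fin (m + 1))).trans
    ((Algebra.TensorProduct.congr AlgEquiv.refl (f.restrictScalars R)).trans
      (matrixScalarExt R T B (Fin (n + 1))).symm)
  have hF : ∀ (t : T) (s : S), F (Matrix.scalar _ (t ⊗ₜ algebraMap S A s)) =
      Matrix.scalar _ (t ⊗ₜ algebraMap S B s) := fun t s => by
    have := f.commutes s
    simp only [Matrix.algebraMap_eq_diagonal] at this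
    simp only [F, AlgEquiv.trans_apply]
    rw [AlgEquiv.symm_apply_eq, matrixScalarExt_scalar, matrixScalarExt_scalar,
      Algebra.TensorProduct.congr_apply, Algebra.TensorProduct.map_tmul]
    exact congrArg (t ⊗ₜ ·) this
  refine BrauerEquivalent.of_matrix_algEquiv (m := m) (n := n)
    (AlgEquiv.ofRingEquiv (f := F.toRingEquiv) fun x => ?_)
  induction x using TensorProduct.induction_on with
  | zero => simp
  | add x y hx hy => rw [map_add, map_add, map_add, hx, hy]
  | tmul t s => exact hF t s

end Brauer

/-! ### Involutions of matrix algebras -/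

section MatrixAlgebra

variable {R S B : Type u} [CommRing R] [CommRing S] [Ring B] [Algebra R B] [Algebra S B]
  {ν : Type} [Fintype ν] [DecidableEq ν]

/-- The matrices `E_{ko} x i` and `E_{ok} y i` are the components of a separability idempotent of a
matrix algebra. -/
theorem IsSeparabilityFamily.matrix {ι : Type*} [Fintype ι] {x y : ι → B}
    (h : IsSeparabilityFamily S x y) (o : ν) :
    IsSeparabilityFamily S (fun p : ν × ι => Matrix.single p.1 o (x p.2))
      (fun p : ν × ι => Matrix.single o p.1 (y p.2)) := by
  refine ⟨?_, fun c => ?_⟩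
  · simp only [Matrix.single_mul_single_same, Fintype.sum_prod_type]
    simp only [← Matrix.singleAddMonoidHom_apply, ← map_sum, h.sum_mul]
    simp only [Matrix.singleAddMonoidHom_apply]
    exact Matrix.sum_single_one
  · induction c using Matrix.induction_on' with
    | h_zero => simp
    | h_add c d hc hd =>
      simp only [add_mul, mul_add, TensorProduct.add_tmul, TensorProduct.tmul_add,
        Finset.sum_add_distrib, hc, hd]
    | h_std_basis p q b =>
      have := h.apply_eq ((TensorProduct.mk S (Matrix ν ν B) (Matrix ν ν B)).compl₁₂
        (Matrix.singleLinearMap S p o) (Matrix.singleLinearMap S o q)) b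
      simp only [LinearMap.compl₁₂_apply, TensorProduct.mk_apply,
        Matrix.singleLinearMap_apply] at this
      simp only [Fintype.sum_prod_type]
      rw [Fintype.sum_eq_single q, Fintype.sum_eq_single p]
      · simpa using this
      · intro k hk
        simp [Matrix.single_mul_single_of_ne, hk]
      · intro k hk
        simp [Matrix.single_mul_single_of_ne, hk.symm]

theorem IsCentre.matrix [Nonempty ν] (h : IsCentre S B) : IsCentre S (Matrix ν ν B) := by
  obtain ⟨o⟩ := ‹Nonempty ν›
  refine ⟨fun a b hab => h.injective ?_, ?_⟩
  · simpa [Matrix.algebraMap_matrix_apply] using congrFun (congrFun hab o) o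
  · ext c
    have hc : c ∈ Subring.center (Matrix ν ν B) ↔ c ∈ Set.center (Matrix ν ν B) := Iff.rfl
    rw [hc, Matrix.center_eq_scalar_image]
    constructor
    · rintro ⟨z, rfl⟩
      exact ⟨algebraMap S B z, h.mem_center z, rfl⟩
    · rintro ⟨b, hb, rfl⟩
      obtain ⟨z, rfl⟩ := h.exists_algebraMap_eq hb
      exact ⟨z, rfl⟩

/-- The involution `(b i j) ↦ (τ (b j i))` of a matrix algebra. -/
def AlgInvolution.matrix (τ : AlgInvolution R B) (ν : Type) [Fintype ν] [DecidableEq ν] :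
    AlgInvolution R (Matrix ν ν B) where
  toLin := (Matrix.transposeLinearEquiv ν ν R B).toLinearMap ∘ₗ τ.toLin.mapMatrix
  map_mul' x y := by
    ext i j
    simp [Matrix.mul_apply, τ.map_mul']
  invol' x := by
    ext i j
    simp [τ.invol']

theorem AlgInvolution.matrix_apply (τ : AlgInvolution R B) (c : Matrix ν ν B) (i j : ν) :
    τ.matrix ν c i j = τ (c j i) := rfl

theorem AlgInvolution.matrix_single (τ : AlgInvolution R B) (i j : ν) (b : B) :
    τ.matrix ν (Matrix.single i j b) = Matrix.single j i (τ b) := by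
  ext k l
  simp only [AlgInvolution.matrix_apply, Matrix.single_apply, and_comm]
  split_ifs <;> simp

theorem AlgInvolution.matrix_algebraMap (τ : AlgInvolution R B) {z w : S}
    (h : τ (algebraMap S B z) = algebraMap S B w) :
    τ.matrix ν (algebraMap S (Matrix ν ν B) z) = algebraMap S (Matrix ν ν B) w := by
  ext i j
  simp only [AlgInvolution.matrix_apply, Matrix.algebraMap_matrix_apply, eq_comm (a := i)]
  split_ifs <;> simp [h]

/-- The transport of an involution along an isomorphism. -/
def AlgInvolution.congr {A : Type u} [Ring A] [Algebra R A] (σ : AlgInvolution R A)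
    (f : A ≃ₐ[R] B) : AlgInvolution R B where
  toLin := f.toLinearMap ∘ₗ σ.toLin ∘ₗ f.symm.toLinearMap
  map_mul' x y := by simp [σ.map_mul']
  invol' x := by simp [σ.invol']

end MatrixAlgebra

section Intertwiner

variable {R S C : Type u} [CommRing R] [CommRing S] [Algebra R S] [Ring C] [Algebra R C]
  [Algebra S C] {t t' : AlgInvolution R C} {s : S → S}

/-- Two involutions of an Azumaya algebra over a semilocal ring which agree on the centre differ by
conjugation with a unit `u`, which is `±1`-symmetric provided that Hilbert's theorem 90 holds for
the action on the centre. -/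
theorem exists_isUnit_intertwining [Finite (MaximalSpectrum S)] [Module.Finite S C]
    (hC : IsCentre S C) {ι : Type*} [Fintype ι] {x y : ι → C} (h : IsSeparabilityFamily S x y)
    (ht : ∀ z, t (algebraMap S C z) = algebraMap S C (s z))
    (ht' : ∀ z, t' (algebraMap S C z) = algebraMap S C (s z))
    (H : ∀ c : S, c * s c = 1 → ∃ δ x : S, (δ = 1 ∨ δ = -1) ∧ IsUnit x ∧ s x * c = δ * x) :
    ∃ δ : S, (δ = 1 ∨ δ = -1) ∧ ∃ u : C, IsUnit u ∧ (∀ c, t c * u = u * t' c) ∧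
      t u = algebraMap S C δ * u := by
  let α : C ≃ₐ[S] C := AlgEquiv.ofRingEquiv (f :=
    { toFun := fun c => t' (t c)
      invFun := fun c => t (t' c)
      left_inv := fun c => by simp only [AlgInvolution.invol]
      right_inv := fun c => by simp only [AlgInvolution.invol]
      map_mul' := fun c d => by simp only [AlgInvolution.map_mul]
      map_add' := fun c d => by simp only [map_add] }) fun z => by
        have hinv : ∀ z, s (s z) = z := fun z => hC.injective (by rw [← ht, ← ht, t.invol])
        change t' (t (algebraMap S C z)) = _
        rw [ht, ht', hinv]
  have hα : ∀ c, α (t c) = t' c := fun c => by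
    change t' (t (t c)) = _
    rw [t.invol]
  obtain ⟨u, hu, huα⟩ := h.exists_isUnit_twisted_commute (fun d hd => hC.exists_algebraMap_eq hd) α
  have hut : ∀ c, t c * u = u * t' c := fun c => by rw [huα, hα]
  have htu : ∀ c, t c * t u = t u * t' c := fun c => by
    have := congrArg t (hut (t' c))
    rw [t.map_mul, t.map_mul, t'.invol, t.invol] at this
    exact this.symm
  obtain ⟨v, huv, hvu⟩ := isUnit_iff_exists.1 hu
  have hv : ∀ c, v * t c = t' c * v := fun c => by
    calc v * t c = v * (t c * u) * v := by rw [mul_assoc, mul_assoc, huv, mul_one]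
      _ = t' c * v := by rw [hut, ← mul_assoc, hvu, one_mul]
  obtain ⟨l, hl⟩ := hC.exists_algebraMap_eq (a := v * t u) (Subring.mem_center_iff.2 fun c => by
    rw [← t'.invol c, ← mul_assoc, ← hv, mul_assoc, htu, mul_assoc])
  have htul : t u = u * algebraMap S C l := by rw [hl, ← mul_assoc, huv, one_mul]
  obtain ⟨δ, x, hδ, hx, hxl⟩ := H l (hC.injective (by
    have h1 := congrArg t htul
    rw [t.invol, t.map_mul, ht, htul, ← Algebra.commutes l, ← mul_assoc, ← map_mul, mul_comm] at h1
    rw [map_one, ← mul_one (algebraMap S C _), ← huv, ← mul_assoc, ← h1]))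
  refine ⟨δ, hδ, algebraMap S C x * u, (hx.map _).mul hu, fun c => ?_, ?_⟩
  · rw [← mul_assoc, ← Algebra.commutes, mul_assoc, hut, mul_assoc]
  · rw [t.map_mul, ht, htul, mul_assoc, ← map_mul, mul_comm l, hxl, ← Algebra.commutes, map_mul,
      mul_assoc]

end Intertwiner

/-! ### The admitting form of an isomorphism of matrix algebras -/

section Construction

open Matrix

variable {R S A B : Type u} [CommRing R] [CommRing S] [Ring A] [Algebra R A] [Algebra S A]
  [Ring B] [Algebra R B] [Algebra S B]
  {m n : ℕ} (f : Matrix (Fin (m + 1)) (Fin (m + 1)) A ≃ₐ[R] Matrix (Fin (n + 1)) (Fin (n + 1)) B)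

/-- The non-unital homomorphism `a ↦ f (a E₀₀)` from `A` to the matrices over `B`. -/
def corner (a : A) : Matrix (Fin (n + 1)) (Fin (n + 1)) B := f (single 0 0 a)

theorem corner_mul (a b : A) : corner f (a * b) = corner f a * corner f b := by
  simp [corner, ← map_mul]

theorem corner_add (a b : A) : corner f (a + b) = corner f a + corner f b := by
  simp [corner, ← map_add, single_add]

theorem corner_smul (r : R) (a : A) : corner f (r • a) = r • corner f a := by
  rw [corner, corner, ← map_smul, smul_single]

theorem corner_one_mul (a : A) : corner f 1 * corner f a = corner f a := by
  rw [← corner_mul, one_mul]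

theorem corner_symm_apply {c : Matrix (Fin (n + 1)) (Fin (n + 1)) B} (hl : corner f 1 * c = c)
    (hr : c * corner f 1 = c) : corner f (f.symm c 0 0) = c := by
  rw [corner, ← AlgEquiv.eq_symm_apply]
  conv_rhs => rw [← hl, ← hr]
  rw [corner, map_mul, map_mul, AlgEquiv.symm_apply_apply, ← mul_assoc, single_mul_mul_single,
    one_mul, mul_one]

/-- The right `B`-module `P = e Bⁿ` of column vectors, where `e` is the image of the matrix unit
`E₀₀` under `f`. -/
def cornerModule : Submodule Bᵐᵒᵖ (Fin (n + 1) → B) where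
  carrier := {v | corner f 1 *ᵥ v = v}
  zero_mem' := mulVec_zero _
  add_mem' {v w} hv hw := by
    change _ *ᵥ (v + w) = v + w
    rw [mulVec_add, hv, hw]
  smul_mem' b v hv := by
    change _ *ᵥ (b • v) = b • v
    rw [mulVec_smul, hv]

theorem mem_cornerModule {v : Fin (n + 1) → B} : v ∈ cornerModule f ↔ corner f 1 *ᵥ v = v := Iff.rfl

theorem mulVec_mem_cornerModule {c : Matrix (Fin (n + 1)) (Fin (n + 1)) B}
    (hc : corner f 1 * c = c) (v : Fin (n + 1) → B) : c *ᵥ v ∈ cornerModule f := by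
  rw [mem_cornerModule, mulVec_mulVec, hc]

/-- The left action of `A` on `e Bⁿ` through `corner f`. -/
instance : Module A (cornerModule f) where
  smul a v := ⟨corner f a *ᵥ v.1, mulVec_mem_cornerModule f (corner_one_mul f a) _⟩
  one_smul v := Subtype.ext v.2
  mul_smul a b v := Subtype.ext (by
    change corner f (a * b) *ᵥ v.1 = corner f a *ᵥ (corner f b *ᵥ v.1)
    rw [corner_mul, mulVec_mulVec])
  smul_zero a := Subtype.ext (mulVec_zero (corner f a))
  smul_add a v w := Subtype.ext (mulVec_add (corner f a) v.1 w.1)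
  add_smul a b v := Subtype.ext (by
    change corner f (a + b) *ᵥ v.1 = corner f a *ᵥ v.1 + corner f b *ᵥ v.1
    rw [corner_add, add_mulVec])
  zero_smul v := Subtype.ext (by
    change corner f 0 *ᵥ v.1 = _
    rw [corner, single_zero, map_zero, zero_mulVec]
    rfl)

theorem coe_smul_cornerModule (a : A) (v : cornerModule f) :
    ((a • v : cornerModule f) : Fin (n + 1) → B) = corner f a *ᵥ v.1 := rfl

instance : IsScalarTower R A (cornerModule f) where
  smul_assoc r a v := Subtype.ext (by
    change corner f (r • a) *ᵥ v.1 = r • (corner f a *ᵥ v.1)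
    rw [corner_smul, smul_mulVec])

instance : SMulCommClass A Bᵐᵒᵖ (cornerModule f) where
  smul_comm a b v := Subtype.ext (mulVec_smul (corner f a) b v.1)

theorem sum_op_smul_mulVec_single {ν : Type*} [Fintype ν] [DecidableEq ν] (c : Matrix ν ν B)
    (v : ν → B) : ∑ j, op (v j) • (c *ᵥ Pi.single j 1) = c *ᵥ v := by
  ext i
  simp [mulVec, dotProduct, Finset.sum_apply]

theorem finite_projective_cornerModule :
    Module.Finite Bᵐᵒᵖ (cornerModule f) ∧ Module.Projective Bᵐᵒᵖ (cornerModule f) := by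
  refine finite_projective_of_dualBasis (ι := Fin (n + 1))
    (fun j => ⟨corner f 1 *ᵥ Pi.single j 1, mulVec_mem_cornerModule f (corner_one_mul f 1) _⟩)
    (fun j =>
      { toFun := fun v => op (v.1 j)
        map_add' := fun v w => by simp
        map_smul' := fun b v => by simp }) fun v => Subtype.ext ?_
  rw [Submodule.coe_sum]
  exact (sum_op_smul_mulVec_single _ _).trans v.2

variable (τ : AlgInvolution R B) (u : Matrix (Fin (n + 1)) (Fin (n + 1)) B)

/-- `(c v)^* = v^* c^*`. -/
theorem star_mulVec_vecMul {ν : Type} [Fintype ν] [DecidableEq ν] (c : Matrix ν ν B) (v : ν → B) :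
    (fun i => τ ((c *ᵥ v) i)) = (fun i => τ (v i)) ᵥ* τ.matrix ν c := by
  ext i
  simp [mulVec, vecMul, dotProduct, AlgInvolution.matrix_apply, map_sum, τ.map_mul]

/-- The sesquilinear form `(v, w) ↦ v^* u w` on column vectors, where `*` is the conjugate
transpose. -/
def starForm {ν : Type} [Fintype ν] (u : Matrix ν ν B) : (ν → B) →ₗ[R] (ν → B) →ₗ[R] B :=
  LinearMap.mk₂ R (fun v w => (fun i => τ (v i)) ⬝ᵥ (u *ᵥ w))
    (fun v v' w => by simp [dotProduct, add_mul, Finset.sum_add_distrib])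
    (fun r v w => by simp [dotProduct, Finset.smul_sum])
    (fun v w w' => by rw [mulVec_add, dotProduct_add])
    (fun r v w => by rw [mulVec_smul, dotProduct_smul])

theorem starForm_apply {ν : Type} [Fintype ν] (u : Matrix ν ν B) (v w : ν → B) :
    starForm τ u v w = (fun i => τ (v i)) ⬝ᵥ (u *ᵥ w) := rfl

theorem starForm_mulVec_left {ν : Type} [Fintype ν] [DecidableEq ν] (u c : Matrix ν ν B)
    (v w : ν → B) : starForm τ u (c *ᵥ v) w = starForm τ (τ.matrix ν c * u) v w := by
  rw [starForm_apply, starForm_apply, star_mulVec_vecMul, ← dotProduct_mulVec, mulVec_mulVec]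

theorem starForm_mulVec_right {ν : Type} [Fintype ν] (u c : Matrix ν ν B)
    (v w : ν → B) : starForm τ u v (c *ᵥ w) = starForm τ (u * c) v w := by
  rw [starForm_apply, starForm_apply, mulVec_mulVec]

theorem starForm_op_smul_left {ν : Type} [Fintype ν] (u : Matrix ν ν B) (b : B) (v w : ν → B) :
    starForm τ u (op b • v) w = τ b * starForm τ u v w := by
  simp [starForm_apply, dotProduct, Finset.mul_sum, τ.map_mul, mul_assoc]

theorem starForm_op_smul_right {ν : Type} [Fintype ν] (u : Matrix ν ν B) (b : B) (v w : ν → B) :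
    starForm τ u v (op b • w) = starForm τ u v w * b := by
  rw [starForm_apply, starForm_apply, mulVec_smul, dotProduct_smul]
  rfl

theorem apply_starForm {ν : Type} [Fintype ν] [DecidableEq ν] (u : Matrix ν ν B) (v w : ν → B) :
    τ (starForm τ u v w) = starForm τ (τ.matrix ν u) w v := by
  rw [starForm_apply, starForm_apply, dotProduct_mulVec _ (τ.matrix ν u), ← star_mulVec_vecMul]
  simp [dotProduct, map_sum, τ.map_mul, τ.invol]

variable {τ u} {σ : AlgInvolution R A} {δ : S} (hδ : δ = 1 ∨ δ = -1)
  (hf : ∀ z, f (algebraMap S _ z) = algebraMap S _ z)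
  (hu : ∀ c, τ.matrix (Fin (n + 1)) c * u = u * (σ.matrix (Fin (m + 1))).congr f c)
  (hδu : τ.matrix (Fin (n + 1)) u = algebraMap S _ δ * u)

theorem congr_corner (σ : AlgInvolution R A) (a : A) :
    (σ.matrix (Fin (m + 1))).congr f (corner f a) = corner f (σ a) := by
  change f (σ.matrix _ (f.symm (f _))) = _
  rw [AlgEquiv.symm_apply_apply, AlgInvolution.matrix_single]
  rfl

include hu in
theorem star_corner_mul (a : A) :
    τ.matrix (Fin (n + 1)) (corner f (σ a)) * u = u * corner f a := by
  rw [hu, congr_corner, σ.invol]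

/-- The form `v^* u w` on `e Bⁿ`, as a form admitting `(A, σ)`. -/
def cornerForm : AdmittingForm S σ τ (algebraMap S B δ) where
  carrier := cornerModule f
  instFinite := (finite_projective_cornerModule f).1
  instProjective := (finite_projective_cornerModule f).2
  form := (starForm τ u).compl₁₂ ((cornerModule f).subtype.restrictScalars R)
    ((cornerModule f).subtype.restrictScalars R)
  smul_left b v w := starForm_op_smul_left τ u b v.1 w.1
  smul_right b v w := starForm_op_smul_right τ u b v.1 w.1
  herm v w := by
    change starForm τ u v.1 w.1 = _ * τ (starForm τ u w.1 v.1)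
    rw [apply_starForm, hδu]
    rcases hδ with rfl | rfl
    · simp
    · simp [starForm_apply, neg_mulVec]
  central z v := Subtype.ext (by
    rw [coe_smul_cornerModule]
    change _ = op (algebraMap S B z) • v.1
    have h1 : corner f (algebraMap S A z) = algebraMap S _ z * corner f 1 := by
      rw [corner, corner, ← hf, ← map_mul, ← Algebra.smul_def, smul_single, Algebra.smul_def,
        mul_one]
    have h2 : corner f 1 *ᵥ v.1 = v.1 := v.2
    rw [h1, ← Algebra.smul_def, smul_mulVec, h2]
    ext i
    simp [Algebra.smul_def, Algebra.commutes])
  admits a v w := by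
    change starForm τ u (corner f (σ a) *ᵥ v.1) w.1 = starForm τ u v.1 (corner f a *ᵥ w.1)
    rw [starForm_mulVec_left, starForm_mulVec_right, star_corner_mul f hu]

end Construction

section CornerCompanion

open Matrix

variable {R S A B : Type u} [CommRing R] [CommRing S] [Ring A] [Algebra R A] [Algebra S A]
  [Ring B] [Algebra R B] [Algebra S B]
  {m n : ℕ} (f : Matrix (Fin (m + 1)) (Fin (m + 1)) A ≃ₐ[R] Matrix (Fin (n + 1)) (Fin (n + 1)) B)
  {σ : AlgInvolution R A} {τ : AlgInvolution R B} {u : Matrix (Fin (n + 1)) (Fin (n + 1)) B}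
  {δ : S} (hδ : δ = 1 ∨ δ = -1)
  (hf : ∀ z, f (algebraMap S _ z) = algebraMap S _ z)
  (hu : ∀ c, τ.matrix (Fin (n + 1)) c * u = u * (σ.matrix (Fin (m + 1))).congr f c)
  (hδu : τ.matrix (Fin (n + 1)) u = algebraMap S _ δ * u)

/-- The matrix `p q^* u`, which acts on column vectors as `x ↦ p (q^* u x)`. -/
def outer (τ : AlgInvolution R B) {ν : Type} [Fintype ν] (u : Matrix ν ν B) (p q : ν → B) :
    Matrix ν ν B :=
  vecMulVec p ((fun i => τ (q i)) ᵥ* u)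

theorem outer_mulVec {ν : Type} [Fintype ν] (u : Matrix ν ν B) (p q x : ν → B) :
    outer τ u p q *ᵥ x = op (starForm τ u q x) • p := by
  rw [outer, vecMulVec_mulVec, starForm_apply, dotProduct_mulVec]

include hu in
theorem corner_symm_outer {p q : Fin (n + 1) → B} (hp : p ∈ cornerModule f)
    (hq : q ∈ cornerModule f) :
    corner f (f.symm (outer τ u p q) 0 0) = outer τ u p q := by
  refine corner_symm_apply f ?_ ?_
  · rw [outer, mul_vecMulVec, (mem_cornerModule f).1 hp]
  · have h1 := star_corner_mul f hu 1
    rw [σ.map_one] at h1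
    rw [outer, vecMulVec_mul, vecMul_vecMul, ← h1, ← vecMul_vecMul, ← star_mulVec_vecMul,
      (mem_cornerModule f).1 hq]

include hu in
/-- The functional `q^* u` for `q` the `j`-th column of `c (u⁻¹)^*` is the `j`-th row of a matrix.
-/
theorem star_vecMul_eq_row {v : Matrix (Fin (n + 1)) (Fin (n + 1)) B} (hvu : v * u = 1)
    (c : Matrix (Fin (n + 1)) (Fin (n + 1)) B) (j : Fin (n + 1)) :
    (fun i => τ (((c * τ.matrix _ v) *ᵥ Pi.single j 1) i)) ᵥ* u =
      (σ.matrix (Fin (m + 1))).congr f c j := by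
  have h1 : (fun i => τ ((Pi.single j 1 : Fin (n + 1) → B) i)) = Pi.single j 1 := by
    ext i
    rcases eq_or_ne i j with rfl | h
    · simp [τ.map_one]
    · simp [h]
  rw [star_mulVec_vecMul, vecMul_vecMul, (τ.matrix _).map_mul, (τ.matrix _).invol, mul_assoc, hu,
    ← mul_assoc, hvu, one_mul, h1, single_one_vecMul]
  rfl

/-- The companion of the form on `e Bⁿ`: its value at `(p, q)` is the element of `A` corresponding
to the matrix `p q^* u`, which lies in the corner `e Mₙ(B) e`. With `v = u⁻¹`, the columns
of `e` and of `e v^*` show that `1` is a sum of values of the companion, and the first columns of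
`b k = f(E_{0k})` and of `b k * v^*` show it for the form, because `∑ f(E_{k0}) f(E_{0k}) = 1`. -/
theorem nonempty_companion_cornerForm (hunit : IsUnit u) :
    Nonempty (cornerForm f hδ hf hu hδu).Companion := by
  obtain ⟨v, -, hvu⟩ := isUnit_iff_exists.1 hunit
  have hcoe : ∀ p q x : cornerModule f,
      corner f (f.symm (outer τ u p.1 q.1) 0 0) *ᵥ x.1 = op (starForm τ u q.1 x.1) • p.1 :=
    fun p q x => by rw [corner_symm_outer f hu p.2 q.2, outer_mulVec]
  refine ⟨{
    form := LinearMap.mk₂ R (fun p q : cornerModule f => f.symm (outer τ u p.1 q.1) 0 0)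
      (fun p p' q => ?_) (fun r p q => ?_) (fun p q q' => ?_) (fun r p q => ?_)
    smul_left := fun a p q => ?_
    assoc := fun p q x => Subtype.ext (hcoe p q x)
    exists_sum_left := ?_
    exists_sum_right := ?_ }⟩
  · have : outer τ u (p + p').1 q.1 = outer τ u p.1 q.1 + outer τ u p'.1 q.1 :=
      add_vecMulVec _ _ _
    rw [this, map_add]
    rfl
  · have : outer τ u (r • p).1 q.1 = r • outer τ u p.1 q.1 := smul_vecMulVec _ _ _
    rw [this, map_smul]
    rfl
  · have : outer τ u p.1 (q + q').1 = outer τ u p.1 q.1 + outer τ u p.1 q'.1 := by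
      simp only [outer, ← vecMulVec_add, ← add_vecMul]
      congr 2
      ext i
      exact map_add _ _ _
    rw [this, map_add]
    rfl
  · have : outer τ u p.1 (r • q).1 = r • outer τ u p.1 q.1 := by
      simp only [outer, ← vecMulVec_smul, ← smul_vecMul]
      congr 2
      ext i
      exact map_smul _ _ _
    rw [this, map_smul]
    rfl
  · change f.symm (outer τ u (corner f a *ᵥ p.1) q.1) 0 0 = a * f.symm (outer τ u p.1 q.1) 0 0
    rw [outer, ← mul_vecMulVec, map_mul, corner, AlgEquiv.symm_apply_apply]
    exact single_mul_apply_same _ _ _ _ _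
  · have he : ∀ j : Fin (n + 1), corner f 1 *ᵥ Pi.single j 1 ∈ cornerModule f := fun j =>
      mulVec_mem_cornerModule f (corner_one_mul f 1) _
    have hq : ∀ j : Fin (n + 1), (corner f 1 * τ.matrix _ v) *ᵥ Pi.single j 1 ∈ cornerModule f :=
      fun j => mulVec_mem_cornerModule f (by rw [← mul_assoc, corner_one_mul]) _
    refine ⟨n + 1, fun j => ⟨_, he j⟩, fun j => ⟨_, hq j⟩, ?_⟩
    have hsum : ∑ j, outer τ u (corner f 1 *ᵥ Pi.single j 1)
        ((corner f 1 * τ.matrix _ v) *ᵥ Pi.single j 1) = corner f 1 := by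
      simp only [outer, star_vecMul_eq_row f hu hvu, congr_corner, σ.map_one]
      conv_rhs => rw [← corner_one_mul]
      ext i k
      simp [Matrix.sum_apply, Matrix.mul_apply, vecMulVec_apply]
    have h1 := congrArg (fun c => f.symm c 0 0) hsum
    simp only [map_sum, Matrix.sum_apply] at h1
    refine Eq.trans h1 ?_
    rw [corner, AlgEquiv.symm_apply_apply, single_apply_same]
  · let b : Fin (m + 1) → Matrix (Fin (n + 1)) (Fin (n + 1)) B := fun k => f (single 0 k 1)
    have hb : ∀ k, corner f 1 * b k = b k := fun k => by simp [b, corner, ← map_mul]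
    refine ⟨m + 1, fun k => ⟨b k *ᵥ Pi.single 0 1, mulVec_mem_cornerModule f (hb k) _⟩,
      fun k => ⟨(b k * τ.matrix _ v) *ᵥ Pi.single 0 1,
        mulVec_mem_cornerModule f (by rw [← mul_assoc, hb]) _⟩, ?_⟩
    have hform : ∀ k, starForm τ u ((b k * τ.matrix _ v) *ᵥ Pi.single 0 1) (b k *ᵥ Pi.single 0 1) =
        f (single k k 1) 0 0 := fun k => by
      have h1 : (σ.matrix (Fin (m + 1))).congr f (b k) = f (single k 0 1) := by
        change f (σ.matrix _ (f.symm (f _))) = _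
        rw [AlgEquiv.symm_apply_apply, AlgInvolution.matrix_single, σ.map_one]
      have h2 : f (single k k 1) = f (single k 0 1) * b k := by simp [b, ← map_mul]
      rw [starForm_apply, dotProduct_mulVec, star_vecMul_eq_row f hu hvu, h1, h2, Matrix.mul_apply]
      simp [dotProduct]
    refine (Finset.sum_congr rfl fun k _ => hform k).trans ?_
    rw [← Matrix.sum_apply, ← map_sum, Matrix.sum_single_one, map_one, one_apply_eq]

end CornerCompanion

section Existence

variable {R S A B : Type u} [CommRing R] [Finite (MaximalSpectrum R)]
  [ConnectedSpace (PrimeSpectrum R)] [CommRing S] [Algebra R S] [ConnectedSpace (PrimeSpectrum S)]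
  [Ring A] [Algebra R A] [Algebra S A] [IsScalarTower R S A]
  [Ring B] [Algebra R B] [Algebra S B] [IsScalarTower R S B]

/-- Over a semilocal connected ring, Brauer equivalent Azumaya algebras whose involutions agree on
the centre are linked by a hermitian Morita context. -/
theorem exists_nonempty_companion (two_unit : IsUnit (2 : R)) (hA : IsCentre S A)
    (hB : IsCentre S B) {σ : AlgInvolution R A} (hσ : IsAzumayaWithInvolution σ)
    {τ : AlgInvolution R B} (hτ : IsAzumayaWithInvolution τ) [Finite (MaximalSpectrum S)]
    (agree : ∀ s : S, ∃ s' : S,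
      σ (algebraMap S A s) = algebraMap S A s' ∧ τ (algebraMap S B s) = algebraMap S B s')
    (brauer : BrauerEquivalent S A B) :
    ∃ δ : S, (δ = 1 ∨ δ = -1) ∧ ∃ ϑ : AdmittingForm S σ τ (algebraMap S B δ),
      Nonempty ϑ.Companion := by
  obtain ⟨s, hs, hsσ, hsτ⟩ := exists_centreInvolution hA agree
  obtain ⟨m, n, ⟨f⟩⟩ := brauer.exists_matrix_algEquiv
  obtain ⟨k, x, y, h⟩ := exists_isSeparabilityFamily hτ.separable
  have := hτ.projective
  have := h.finite
  have : Module.Finite S B := Module.Finite.of_restrictScalars_finite R S B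
  have : Module.Finite S (Matrix (Fin (n + 1)) (Fin (n + 1)) B) :=
    inferInstanceAs (Module.Finite S (Fin (n + 1) → Fin (n + 1) → B))
  obtain ⟨δ, hδ, u, hunit, hu, hδu⟩ := exists_isUnit_intertwining (R := R) (s := s)
    (t := τ.matrix (Fin (n + 1))) (t' := (σ.matrix (Fin (m + 1))).congr (f.restrictScalars R))
    hB.matrix ((h.tower (S := S)).matrix (0 : Fin (n + 1)))
    (fun z => τ.matrix_algebraMap (hsτ z)) (fun z => by
      change f (σ.matrix _ (f.symm (algebraMap S _ z))) = _
      rw [f.symm.commutes, σ.matrix_algebraMap (hsσ z), f.commutes])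
    fun c hc => hσ.exists_isUnit_mul_eq hA two_unit s hs hsσ hc
  exact ⟨δ, hδ, _, nonempty_companion_cornerForm (f.restrictScalars R) hδ (fun z => f.commutes z)
    hu hδu hunit⟩

end Existence

theorem theoremA3 {R S A B T : Type u}
    -- `R` is a semilocal connected commutative ring in which `2` is invertible
    [CommRing R] [Finite (MaximalSpectrum R)] [ConnectedSpace (PrimeSpectrum R)]
    (two_unit : IsUnit (2 : R))
    -- `S` is a connected commutative `R`-algebra, the common centre of `A` and `B`
    [CommRing S] [Algebra R S] [ConnectedSpace (PrimeSpectrum S)]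
    [Ring A] [Algebra R A] [Algebra S A] [IsScalarTower R S A]
    [Ring B] [Algebra R B] [Algebra S B] [IsScalarTower R S B]
    (centre_A : IsCentre S A) (centre_B : IsCentre S B)
    -- `(A, σ)` and `(B, τ)` are Azumaya algebras with involution over `R`
    (σ : AlgInvolution R A) (azumaya_A : IsAzumayaWithInvolution σ)
    (τ : AlgInvolution R B) (azumaya_B : IsAzumayaWithInvolution τ)
    -- `σ` and `τ` agree on `S`
    (agree : ∀ s : S, ∃ s' : S,
      σ (algebraMap S A s) = algebraMap S A s' ∧ τ (algebraMap S B s) = algebraMap S B s')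
    -- `A` and `B` are Brauer equivalent over `S`
    (brauer : BrauerEquivalent S A B)
    -- `ε` is an element of `S` with `σ(ε) ε = 1`
    (ε : S) (sign : σ (algebraMap S A ε) * algebraMap S A ε = 1)
    -- `T` is a semilocal connected commutative `R`-algebra such that `T ⊗ S` is connected
    [CommRing T] [Algebra R T] [Finite (MaximalSpectrum T)] [ConnectedSpace (PrimeSpectrum T)]
    [ConnectedSpace (PrimeSpectrum (T ⊗[R] S))] :
    -- the scalar extensions of `A` and `B` are Brauer equivalent over `T ⊗ S`
    BrauerEquivalent (T ⊗[R] S) (T ⊗[R] A) (T ⊗[R] B) ∧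
    -- hermitian Morita equivalences `F_ϑ` exist
    (∃ δ : S, (δ = 1 ∨ δ = -1) ∧ ∃ ϑ : AdmittingForm S σ τ (algebraMap S B δ),
      ϑ.Nonsingular ∧
      IsHermitianMorita (ϑ.moritaFunctor (rfl : δ * ε = δ * ε))) ∧
    -- for every nonsingular `ϑ`, the form `ϑ_T` is nonsingular, `F_{ϑ_T}` is a hermitian Morita
    -- equivalence if `F_ϑ` is one, and `F_{ϑ_T} ∘ U_T` and `U_T ∘ F_ϑ` are naturally isomorphic
    ∀ δ : S, (δ = 1 ∨ δ = -1) → ∀ ϑ : AdmittingForm S σ τ (algebraMap S B δ), ϑ.Nonsingular →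
      (ϑ.scalarExt T).Nonsingular ∧
      (IsHermitianMorita (ϑ.moritaFunctor (rfl : δ * ε = δ * ε)) →
        IsHermitianMorita ((ϑ.scalarExt T).moritaFunctor (scalarExt_sign (R := R) T δ ε))) ∧
      Nonempty
        (scalarExtFunctor T S σ ε ⋙
            (ϑ.scalarExt T).moritaFunctor (scalarExt_sign (R := R) T δ ε) ≅
          ϑ.moritaFunctor (rfl : δ * ε = δ * ε) ⋙ scalarExtFunctor T S τ (δ * ε)) := by
  obtain ⟨k, x, y, h⟩ := exists_isSeparabilityFamily azumaya_A.separable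
  have := azumaya_A.projective
  have := centre_A.finite_base h
  have : Finite (MaximalSpectrum S) := finite_maximalSpectrum_of_finite (R := R)
  refine ⟨brauer.scalarExt R T, ?_, fun δ hδ ϑ hϑ => ⟨hϑ.scalarExt T, fun hM => ?_,
    ϑ.nonempty_scalarExt_iso T⟩⟩
  · obtain ⟨δ, hδ, ϑ, ⟨φ⟩⟩ := exists_nonempty_companion two_unit centre_A centre_B azumaya_A
      azumaya_B agree brauer
    obtain ⟨k, p, q, hpq⟩ := φ.exists_dualBasis
    exact ⟨δ, hδ, ϑ, HermForm.nonsingular_of_dualBasis p q hpq, φ.isHermitianMorita hδ rfl⟩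
  · have hδT : (1 ⊗ₜ[R] δ : T ⊗[R] S) = 1 ∨ (1 ⊗ₜ[R] δ : T ⊗[R] S) = -1 := by
      rcases hδ with rfl | rfl
      · exact Or.inl rfl
      · exact Or.inr (TensorProduct.tmul_neg _ _)
    obtain ⟨φ⟩ := ϑ.nonempty_companion rfl hϑ hM.isEquivalence
    obtain ⟨φ'⟩ := φ.nonempty_scalarExt T
    exact φ'.isHermitianMorita hδT _
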